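/- Let $u>0$, $0\le a<1$, and put $f(z)=\frac{z-a}{z^2-1}$, $g(z)=-\frac{1}{(z^2-1)^2}$ for $z>1$ (this is the case $b=0$ of $f(z)=\frac{(z-a)(z^2-1)-b}{(z^2-1)^2}$). **Notation.** $J_0,Y_0$ are the Bessel functions, $X_0$ is the smallest positive zero of $J_0+Y_0$, and for $x>0$ $$E_0=\sqrt{-Y_0/J_0},\quad M_0=\sqrt{2|Y_0|J_0}\quad (x\le X_0),\qquad E_0=1,\quad M_0=\sqrt{J_0^2+Y_0^2}\quad (x>X_0),$$ $$\lambda_{0,0}=\sup_{x>0}\pi x M_0(x)^2,\qquad \lambda_{0,1}=\sup_{x>0}\pi x\,|J_0(x)|E_0(x)M_0(x).$$ The Liouville variable $\zeta\le 0$ is given by $(-\zeta)^{1/2}=\int_1^z\sqrt{f(t)}\,dt$, with inverse $z=z(\zeta)$; and, with $f,g,f',f''$ taken at $z=z(\zeta)$, $$\psi(\zeta)=\frac1{16\zeta}-\frac{g}{4f}-\frac{4ff''-5f'^2}{64f^3},\qquad \mathcal V_{\zeta,0}=\int_\zeta^0\frac{|\psi(v)|}{|v|^{1/2}}\,dv,\qquad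 \mathcal V_{-\infty,0}=\int_{-\infty}^0\frac{|\psi(v)|}{|v|^{1/2}}\,dv .$$ Let $P_0(\zeta)=\frac{M_0(u|\zeta|^{1/2})}{E_0(u|\zeta|^{1/2})}$, $Q(v)=\pi|v|^{1/2}M_0(u|v|^{1/2})E_0(u|v|^{1/2})$, $\kappa_0(\zeta)=\sup_{\zeta\le v<0}P_0(v)Q(v)$, $\kappa(\zeta)=\sup_{\zeta\le v<0}Q(v)|J_0(u|v|^{1/2})|$. A *recessive solution* is a real solution $A$ on $(1,\infty)$ of $$A''+\frac{2z}{z^2-1}A'+\frac{u^2(z-a)}{z^2-1}A=0\qquad\text{with}\qquad A(z)\to\tfrac1{\sqrt2}\quad (z\to1+).$$ Let $w=(z^2-1)^{1/2}A$ (so that $w''=(-u^2f+g)w$), define $W$ by $w=(4|\zeta|f)^{-1/4}\,W(\zeta)$, and put $\varepsilon(u,\zeta)=W(\zeta)-|\zeta|^{1/2}J_0(u|\zeta|^{1/2})$ for $\zeta<0$. Put $$B=\frac{\lambda_{0,1}}{\lambda_{0,0}}\left[\exp\left(\frac{\lambda_{0,0}}{u}\mathcal V_{-\infty,0}\right)-1\right].$$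 **Theorem.** $0<\lambda_{0,0}<\infty$, $\lambda_{0,1}<\infty$, $\mathcal V_{-\infty,0}<\infty$; a recessive solution exists; and every recessive solution has the following properties. 1. For all $\zeta<0$, $\varepsilon$ satisfies the Volterra integral equation (with integrable integrand) $$\varepsilon(u,\zeta)=\int_\zeta^0 \mathsf K(\zeta,v)\frac{\psi(v)}{|v|^{1/2}}\left[\varepsilon(u,v)+|v|^{1/2}J_0(u|v|^{1/2})\right]dv,$$ $$\mathsf K(\zeta,v)=\pi|\zeta|^{1/2}\left[J_0(u|\zeta|^{1/2})Y_0(u|v|^{1/2})-Y_0(u|\zeta|^{1/2})J_0(u|v|^{1/2})\right].$$ 2. For all $\zeta<0$: $\kappa_0\le\lambda_{0,0}/u$, $\kappa\le\lambda_{0,1}/u$, and $$|\varepsilon(u,\zeta)|\le P_0(\zeta)\,|\zeta|^{1/2}\,\frac{\kappa}{\kappa_0}\left[e^{\kappa_0\mathcal V_{\zeta,0}}-1\right],\qquad |\varepsilon(u,\zeta)|\le P_0(\zeta)\,|\zeta|^{1/2}\,\frac{\lambda_{0,1}}{\lambda_{0,0}}\left[\exp\left(\frac{\lambda_{0,0}}{u}\mathcal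 V_{\zeta,0}\right)-1\right].$$ 3. There are real $\rho\ne-1$ and $\delta\in(-\frac\pi2,\frac\pi2]$ such that, as $\zeta\to-\infty$, $$W(\zeta)=\left(\frac{2|\zeta|^{1/2}}{\pi u}\right)^{1/2}\left[(1+\rho)\sin\left(u|\zeta|^{1/2}+\tfrac\pi4+\delta\right)+o(1)\right].\qquad(*)$$ The limit $L=\lim_{z\to\infty}\left(\int_1^z\sqrt{f(t)}\,dt-2\sqrt z\right)$ exists, and for all real $\rho,\delta$ the expansion $(*)$ is equivalent to $$A(z)=z^{-3/4}\left[\frac{1+\rho}{\sqrt{\pi u}}\sin\left(2u\sqrt z+uL+\tfrac\pi4+\delta\right)+o(1)\right]\qquad(z\to\infty).$$ 4. Whenever $(*)$ holds for real $\rho$ and $\delta$ with $|\delta|\le\frac\pi2$, the phase error satisfies $$\frac{2|\delta|}{\pi}\le\min\{1,B\},$$ and $1+\rho>0$ if $B<1$. -/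

import Mathlib

open Real Set Filter Topology MeasureTheory

namespace EguchiHanson

noncomputable section

/-! ### Bessel functions of order zero, their weight and modulus -/

/-- The Bessel function `J₀` of the first kind. -/
def besselJ0 (x : ℝ) : ℝ :=
  ∑' k : ℕ, (-1) ^ k / ((k.factorial : ℝ) ^ 2) * (x / 2) ^ (2 * k)

/-- The Bessel function `Y₀` of the second kind (for `x > 0`). -/
def besselY0 (x : ℝ) : ℝ :=
  2 / π * ((Real.log (x / 2) + Real.eulerMascheroniConstant) * besselJ0 x) +
    2 / π * ∑' k : ℕ,
      (-1) ^ (k + 1) * ((harmonic k : ℚ) : ℝ) / ((k.factorial : ℝ) ^ 2) * (x / 2) ^ (2 * k)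

/-- The smallest positive root `X₀` of `J₀(x) + Y₀(x) = 0`. -/
def besselX0 : ℝ := sInf {x : ℝ | 0 < x ∧ besselJ0 x + besselY0 x = 0}

/-- The auxiliary weight function `E₀` (for `x > 0`). -/
def weightE0 (x : ℝ) : ℝ :=
  if x ≤ besselX0 then √(-besselY0 x / besselJ0 x) else 1

/-- The auxiliary modulus function `M₀` (for `x > 0`). -/
def modulusM0 (x : ℝ) : ℝ :=
  if x ≤ besselX0 then √(2 * |besselY0 x| * besselJ0 x)
  else √(besselJ0 x ^ 2 + besselY0 x ^ 2)

/-- The values whose supremum is `λ₀₀`. -/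
def lambda00Set : Set ℝ := (fun x : ℝ => π * x * modulusM0 x ^ 2) '' Ioi 0

/-- The values whose supremum is `λ₀₁`. Since `J₀ = (M₀ / E₀) cos θ₀`, they are
`π x M₀(x)² |cos θ₀(x)|`. -/
def lambda01Set : Set ℝ :=
  (fun x : ℝ => π * x * (|besselJ0 x| * weightE0 x * modulusM0 x)) '' Ioi 0

/-- The constant `λ₀₀`. -/
def lambda00 : ℝ := sSup lambda00Set

/-- The constant `λ₀₁`. -/
def lambda01 : ℝ := sSup lambda01Set

/-! ### The differential equation and the Liouville transformation -/

/-- The coefficient `f` of `-u²` in `w'' = (-u² f + g) w`. -/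
def coefF (a b z : ℝ) : ℝ := ((z - a) * (z ^ 2 - 1) - b) / (z ^ 2 - 1) ^ 2

/-- The coefficient `g` in `w'' = (-u² f + g) w`. -/
def coefG (z : ℝ) : ℝ := -1 / (z ^ 2 - 1) ^ 2

/-- `A` solves the radial equation
`A'' + 2z/(z²-1) A' + [(β z - j(j+1))(z²-1) - q²]/(z²-1)² A = 0` on `z > 1`,
where `β = u²`, `j(j+1) = a β` and `q² = b β`. -/
def IsRadialSolution (u a b : ℝ) (A : ℝ → ℝ) : Prop :=
  ∃ A' : ℝ → ℝ, ∀ z : ℝ, 1 < z →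
    HasDerivAt A (A' z) z ∧
    HasDerivAt A'
      (-(2 * z / (z ^ 2 - 1) * A' z) -
        ((u ^ 2 * z - a * u ^ 2) * (z ^ 2 - 1) - b * u ^ 2) / (z ^ 2 - 1) ^ 2 * A z) z

/-- For `b = 0`: the solution that is regular (recessive) at `z = 1`, in the normalization
`A(z) → 1/√2` as `z → 1+`. -/
def IsRecessive (u a : ℝ) (A : ℝ → ℝ) : Prop :=
  IsRadialSolution u a 0 A ∧ Tendsto A (𝓝[>] 1) (𝓝 (1 / √2))

/-- `∫₁ᶻ √f(t) dt`, for `b = 0`. -/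
def phaseInt (a z : ℝ) : ℝ := ∫ t in (1 : ℝ)..z, √(coefF a 0 t)

/-- The Liouville variable `ζ`, given by `(-ζ)^(1/2) = ∫₁ᶻ √f(t) dt`. -/
def zetaOf (a z : ℝ) : ℝ := -(phaseInt a z) ^ 2

/-- The inverse Liouville transformation `ζ ↦ z`, from `ζ < 0` to `z > 1`. -/
def zOf (a ζ : ℝ) : ℝ := Function.invFunOn (zetaOf a) (Ioi 1) ζ

/-- The function `ψ` in the transformed equation
`W'' = [u²/(4ζ) - 1/(4ζ²) + ψ(ζ)/ζ] W`. -/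
def psi (a ζ : ℝ) : ℝ :=
  1 / (16 * ζ) - coefG (zOf a ζ) / (4 * coefF a 0 (zOf a ζ)) -
    (4 * coefF a 0 (zOf a ζ) * iteratedDeriv 2 (coefF a 0) (zOf a ζ)
        - 5 * deriv (coefF a 0) (zOf a ζ) ^ 2) / (64 * coefF a 0 (zOf a ζ) ^ 3)

/-- The transformed solution `W`: here `w = (z²-1)^(1/2) A` and
`w = (-dz/dζ)^(1/2) W = (4|ζ|f)^(-1/4) W`. -/
def bigW (a : ℝ) (A : ℝ → ℝ) (ζ : ℝ) : ℝ :=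
  (4 * |ζ| * coefF a 0 (zOf a ζ)) ^ (1 / 4 : ℝ) *
    (√((zOf a ζ) ^ 2 - 1) * A (zOf a ζ))

/-- The error `ε(u, ζ) = W(ζ) - |ζ|^(1/2) J₀(u |ζ|^(1/2))`. -/
def eps (u a : ℝ) (A : ℝ → ℝ) (ζ : ℝ) : ℝ :=
  bigW a A ζ - √|ζ| * besselJ0 (u * √|ζ|)

/-! ### The ingredients of the bounds -/

/-- The kernel of the Volterra integral equation. -/
def kernel (u ζ v : ℝ) : ℝ :=
  π * √|ζ| * (besselJ0 (u * √|ζ|) * besselY0 (u * √|v|) -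
    besselY0 (u * √|ζ|) * besselJ0 (u * √|v|))

/-- `P₀(ζ) = M₀(u|ζ|^(1/2)) / E₀(u|ζ|^(1/2))`. -/
def P0 (u ζ : ℝ) : ℝ := modulusM0 (u * √|ζ|) / weightE0 (u * √|ζ|)

/-- `Q(v) = π |v|^(1/2) M₀(u|v|^(1/2)) E₀(u|v|^(1/2))`. -/
def Q (u v : ℝ) : ℝ := π * √|v| * modulusM0 (u * √|v|) * weightE0 (u * √|v|)

/-- `κ₀`, the supremum of `P₀ Q` over `[ζ, 0)`. -/
def kappa0 (u ζ : ℝ) : ℝ := sSup ((fun v => P0 u v * Q u v) '' Ico ζ 0)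

/-- `κ`, the supremum of `Q(v) |J₀(u|v|^(1/2))|` over `[ζ, 0)`. -/
def kappa (u ζ : ℝ) : ℝ := sSup ((fun v => Q u v * |besselJ0 (u * √|v|)|) '' Ico ζ 0)

/-- The variation `𝒱_{ζ,0}`. -/
def variation (a ζ : ℝ) : ℝ := ∫ v in Ioo ζ 0, |psi a v| / √|v|

/-- The total variation `𝒱_{-∞,0}`. -/
def totalVariation (a : ℝ) : ℝ := ∫ v in Iio 0, |psi a v| / √|v|

/-- The bound for the phase error, before the minimum with `1` is taken. -/
def phaseBound (u a : ℝ) : ℝ :=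
  lambda01 / lambda00 * (exp (lambda00 / u * totalVariation a) - 1)

/-- `W(ζ) = (2|ζ|^(1/2)/(π u))^(1/2) ((1+ρ) sin(u|ζ|^(1/2) + π/4 + δ) + o(1))`
as `ζ → -∞`. -/
def HasPhase (u a : ℝ) (A : ℝ → ℝ) (ρ δ : ℝ) : Prop :=
  Tendsto (fun ζ : ℝ => bigW a A ζ / √(2 * √|ζ| / (π * u)) -
    (1 + ρ) * sin (u * √|ζ| + π / 4 + δ)) atBot (𝓝 0)

end

end EguchiHanson

open EguchiHanson

/-!
Let `ξ = |ζ|^(1/2) = ∫₁ᶻ √f`. Up to the amplitude factor `amp`, the radial equation in the variable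
`x = u ξ` is Bessel's equation of order zero with a perturbation whose density is that of the
variation `𝒱` (`varDensity`). The argument compares a recessive solution `A` with `J₀` and `Y₀` by
means of the two Wronskians `crossWronskian` of `A` with the transformed Bessel functions. Their
derivatives contain only the perturbation (`hasDerivAt_crossWronskian`), and they determine `A`
(`crossWronskian_identity`).

* Bessel functions. `J₀` and `Y₀` are defined by power series, which give Bessel's equation, the
  Wronskian and the behaviour at the origin. The function `J₀ + i Y₀` is identified with the Laplace
  integral `H(x) = -(4i/π) e^(ix) ∫₀^∞ e^(-xτ²) (τ² - 2i)^(-1/2) dτ`: both solve Bessel's equation,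
  and their difference vanishes at the origin (`IsBesselPair.eq_zero`). The bound
  `|τ² - 2i| ≥ 2` and scaling give `J₀² + Y₀² ≤ 2/(π x)` (`bessel_sq_add_sq_le`) and the asymptotic
  forms at infinity. With `E₀` nonincreasing these bound the kernel and the constants `λ₀₀`, `λ₀₁`.

* Finite variation. Elementary two-sided bounds for `ξ` show that the singular terms of `ψ` at `z = 1`
  cancel and that `ψ = O(1/z)`, so that `𝒱_{-∞,0}` is finite (`integrableOn_variation`).

* Volterra equation. A solution with a limit at `z = 1` has `(z² - 1) A' = O(z - 1)`, because
  otherwise it would have a logarithmic singularity (`recessive_near_one`). Hence the Wronskian with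
  `J₀` vanishes at `z = 1` and that with `Y₀` has an explicit limit. The sum of the squares of the
  Wronskians satisfies a linear differential inequality with integrable coefficient
  (`energy_bounds`). It is therefore bounded above and away from zero. Integrating the derivatives
  of the Wronskians yields the Volterra equation (`volterra_equation`).

* Error bounds. The kernel bound `bessel_kernel_le` turns the Volterra equation into an integral
  inequality for `|ε| / (P₀ |ζ|^(1/2))`, which a Grönwall argument solves (`abs_eps_le`).

* Phase. The Wronskians converge at infinity, not both to zero, which gives amplitude and phase
  (`exists_hasPhase`). Since `√f - z^(-1/2)` is integrable at infinity, the expansion can be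
  rewritten in terms of `z` (`hasPhase_iff_tendsto`). The error bound, compared along sequences with
  prescribed values of `u ξ` modulo `2π`, gives `|(1 + ρ) sin (y + δ) - sin y| ≤ B` for every `y`.
  The choice `y = -δ` yields `2|δ|/π ≤ |sin δ| ≤ B`, and `y = π/2` yields the sign of `1 + ρ`.

* Existence. A recessive solution is the alternating sum of the Picard iterates at the regular
  singular point `z = 1`, which are bounded by `(u² (z - 1))ⁿ / (n!)²`.
-/


namespace EguchiHanson

/-! ### Bessel functions of order zero: power series and differential equation -/

/-- The sum of the power series with coefficients `c`. -/
noncomputable def powerSum (c : ℕ → ℝ) (t : ℝ) : ℝ := ∑' k, c k * t ^ k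

/-- The coefficients of the derived power series. -/
def derivCoeff (c : ℕ → ℝ) (k : ℕ) : ℝ := (k + 1) * c (k + 1)

/-- Coefficients dominated by those of a multiple of the exponential series. This class is stable
under `derivCoeff`, and its power sums are entire. -/
def ExpBounded (c : ℕ → ℝ) : Prop := ∃ M : ℝ, 0 ≤ M ∧ ∀ k, |c k| ≤ M / (k.factorial : ℝ)

lemma ExpBounded.shift {c : ℕ → ℝ} (hc : ExpBounded c) : ExpBounded (derivCoeff c) := by
  obtain ⟨M, hM, h⟩ := hc
  refine ⟨M, hM, fun k => ?_⟩
  have h1 := h (k + 1)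
  rw [Nat.factorial_succ, Nat.cast_mul] at h1
  have hk : (0 : ℝ) < k + 1 := by positivity
  rw [derivCoeff, abs_mul, abs_of_pos hk]
  calc ((k : ℝ) + 1) * |c (k + 1)| ≤ (k + 1) * (M / (((k + 1 : ℕ) : ℝ) * k.factorial)) := by gcongr
    _ = M / k.factorial := by push_cast; field_simp

lemma ExpBounded.summable {c : ℕ → ℝ} (hc : ExpBounded c) (t : ℝ) :
    Summable fun k => c k * t ^ k := by
  obtain ⟨M, hM, h⟩ := hc
  refine Summable.of_norm_bounded ((Real.summable_pow_div_factorial |t|).mul_left M) fun k => ?_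
  rw [norm_mul, norm_pow, Real.norm_eq_abs, Real.norm_eq_abs]
  calc |c k| * |t| ^ k ≤ M / k.factorial * |t| ^ k := by gcongr; exact h k
    _ = M * (|t| ^ k / k.factorial) := by ring

lemma ExpBounded.hasDerivAt {c : ℕ → ℝ} (hc : ExpBounded c) (t : ℝ) :
    HasDerivAt (powerSum c) (powerSum (derivCoeff c) t) t := by
  obtain ⟨M, hM, h⟩ := id hc
  set r := |t| + 1 with hr
  have hr0 : 0 < r := by positivity
  have hsum : Summable fun k : ℕ => M / k.factorial * (k * r ^ (k - 1)) := by
    rw [← summable_nat_add_iff 1]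
    refine ((Real.summable_pow_div_factorial r).mul_left M).congr fun k => ?_
    rw [Nat.factorial_succ]; push_cast; field_simp
  have key : HasDerivAt (fun t => ∑' k, c k * t ^ k) (∑' k, c k * (k * t ^ (k - 1))) t := by
    refine hasDerivAt_tsum_of_isPreconnected (g := fun k t => c k * t ^ k)
      (g' := fun k t => c k * (k * t ^ (k - 1))) (t := Metric.ball (0 : ℝ) r) hsum Metric.isOpen_ball
      (convex_ball _ _).isPreconnected (fun k y _ => ?_) (fun k y hy => ?_)
      (y₀ := 0) (Metric.mem_ball_self hr0) (hc.summable 0) ?_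
    · exact (hasDerivAt_pow k y).const_mul _
    · have hy' : |y| ≤ r := by simpa using (Metric.mem_ball.1 hy).le
      rw [norm_mul, norm_mul, norm_pow, Real.norm_eq_abs, Real.norm_eq_abs, Real.norm_eq_abs,
        Nat.abs_cast]
      gcongr
      exact h k
    · simp [hr]
  have h2 : (∑' k : ℕ, c k * (k * t ^ (k - 1))) = powerSum (derivCoeff c) t := by
    have hs : Summable fun k : ℕ => c k * (k * t ^ (k - 1)) := by
      rw [← summable_nat_add_iff 1]
      refine (hc.shift.summable t).congr fun k => ?_
      simp [derivCoeff]; ring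
    rw [hs.tsum_eq_zero_add]
    simp only [powerSum, derivCoeff]
    simp
    exact tsum_congr fun k => by ring
  rw [← h2]
  exact key

lemma ExpBounded.mul_powerSum_derivCoeff {c : ℕ → ℝ} (hc : ExpBounded c) (t : ℝ) :
    t * powerSum (derivCoeff c) t = powerSum (fun k => k * c k) t := by
  have hs : Summable fun k : ℕ => (k * c k) * t ^ k := by
    rw [← summable_nat_add_iff 1]
    refine ((hc.shift.summable t).mul_left t).congr fun k => ?_
    simp [derivCoeff]; ring
  rw [powerSum, powerSum, ← tsum_mul_left, hs.tsum_eq_zero_add]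
  simp [derivCoeff]
  exact tsum_congr fun k => by ring

/-- The coefficients of `J₀` as a power series in `x² / 4`. -/
noncomputable def coeffJ (k : ℕ) : ℝ := (-1) ^ k / ((k.factorial : ℝ) ^ 2)

/-- The coefficients of the regular part of `(π / 2) Y₀` as a power series in `x² / 4`. -/
noncomputable def coeffY (k : ℕ) : ℝ :=
  (-1) ^ (k + 1) * ((harmonic k : ℚ) : ℝ) / ((k.factorial : ℝ) ^ 2)

lemma harmonic_le_self (k : ℕ) : ((harmonic k : ℚ) : ℝ) ≤ k := by
  induction k with
  | zero => simp
  | succ n ih =>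
    rw [harmonic_succ]
    push_cast
    have : ((n : ℝ) + 1)⁻¹ ≤ 1 := inv_le_one_of_one_le₀ (by linarith [n.cast_nonneg (α := ℝ)])
    linarith

lemma harmonic_nonneg (k : ℕ) : 0 ≤ ((harmonic k : ℚ) : ℝ) := by
  have : (0 : ℚ) ≤ harmonic k := Finset.sum_nonneg fun i _ => by positivity
  exact_mod_cast this

lemma expBounded_coeffJ : ExpBounded coeffJ := by
  refine ⟨1, zero_le_one, fun k => ?_⟩
  have h1 : (1 : ℝ) ≤ k.factorial := by exact_mod_cast Nat.one_le_iff_ne_zero.2 k.factorial_ne_zero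
  rw [coeffJ, abs_div, abs_pow, abs_neg, abs_one, one_pow, abs_of_nonneg (by positivity)]
  exact one_div_le_one_div_of_le (by positivity) (by nlinarith)

lemma expBounded_coeffY : ExpBounded coeffY := by
  refine ⟨1, zero_le_one, fun k => ?_⟩
  have h1 : (0 : ℝ) < k.factorial := by positivity
  have h2 : (k : ℝ) ≤ k.factorial := by exact_mod_cast k.self_le_factorial
  rw [coeffY, abs_div, abs_mul, abs_pow, abs_neg, abs_one, one_pow,
    abs_of_nonneg (harmonic_nonneg k), abs_of_nonneg (by positivity : (0 : ℝ) ≤ (k.factorial : ℝ) ^ 2),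
    div_le_div_iff₀ (by positivity) h1]
  nlinarith [harmonic_le_self k]

/-- The recursion for the coefficients; it says that `S = Σ coeffJ tᵏ` satisfies `(t S')' = -S`. -/
lemma natMul_coeffJ (k : ℕ) : derivCoeff (fun k => k * coeffJ k) k = -coeffJ k := by
  simp only [derivCoeff, coeffJ, Nat.factorial_succ]
  push_cast
  field_simp
  ring

/-- The recursion for the coefficients; it says that `T = Σ coeffY tᵏ` satisfies
`(t T')' = -T - S'`, where `S` is the series of `J₀`. -/
lemma natMul_coeffY (k : ℕ) :
    derivCoeff (fun k => k * coeffY k) k = -(coeffY k) - derivCoeff coeffJ k := by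
  simp only [derivCoeff, coeffY, coeffJ, Nat.factorial_succ, harmonic_succ]
  push_cast
  field_simp
  ring

lemma ExpBounded.natMul {c : ℕ → ℝ} (h : ExpBounded (derivCoeff fun k => k * c k)) :
    ExpBounded fun k => k * c k := by
  obtain ⟨M, hM, h⟩ := h
  refine ⟨M, hM, fun k => ?_⟩
  rcases k with _ | k
  · simpa using hM
  · have h1 := h k
    simp only [derivCoeff] at h1
    rw [abs_mul, abs_of_pos (by positivity : (0 : ℝ) < k + 1)] at h1
    rw [Nat.factorial_succ, Nat.cast_mul, le_div_iff₀ (by positivity)]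
    rw [le_div_iff₀ (by positivity)] at h1
    push_cast at h1 ⊢
    linarith

lemma hasDerivAt_mul_powerSum_coeffJ (t : ℝ) :
    HasDerivAt (fun t => t * powerSum (derivCoeff coeffJ) t) (-powerSum coeffJ t) t := by
  have hb : ExpBounded (derivCoeff fun k => k * coeffJ k) := by
    obtain ⟨M, hM, h⟩ := expBounded_coeffJ
    exact ⟨M, hM, fun k => by rw [natMul_coeffJ, abs_neg]; exact h k⟩
  have h1 := hb.natMul.hasDerivAt t
  have h2 : powerSum (derivCoeff fun k => k * coeffJ k) t = -powerSum coeffJ t := by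
    simp only [powerSum, natMul_coeffJ, neg_mul, tsum_neg]
  rw [h2] at h1
  exact h1.congr_of_eventuallyEq
    (Eventually.of_forall fun t => expBounded_coeffJ.mul_powerSum_derivCoeff t)

lemma hasDerivAt_mul_powerSum_coeffY (t : ℝ) :
    HasDerivAt (fun t => t * powerSum (derivCoeff coeffY) t)
      (-powerSum coeffY t - powerSum (derivCoeff coeffJ) t) t := by
  have hb : ExpBounded (derivCoeff fun k => k * coeffY k) := by
    obtain ⟨M, hM, h⟩ := expBounded_coeffY
    obtain ⟨M', hM', h'⟩ := expBounded_coeffJ.shift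
    refine ⟨M + M', by positivity, fun k => ?_⟩
    rw [natMul_coeffY, add_div]
    refine (abs_sub _ _).trans ?_
    rw [abs_neg]
    exact add_le_add (h k) (h' k)
  have h1 := hb.natMul.hasDerivAt t
  have h2 : powerSum (derivCoeff fun k => k * coeffY k) t =
      -powerSum coeffY t - powerSum (derivCoeff coeffJ) t := by
    simp only [powerSum, natMul_coeffY]
    rw [← tsum_neg, ← (expBounded_coeffY.summable t).neg.tsum_sub
      (expBounded_coeffJ.shift.summable t)]
    exact tsum_congr fun k => by ring
  rw [h2] at h1
  exact h1.congr_of_eventuallyEq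
    (Eventually.of_forall fun t => expBounded_coeffY.mul_powerSum_derivCoeff t)

/-- The Wronskian of the two Bessel functions, in terms of their power series. -/
lemma powerSum_wronskian (t : ℝ) :
    powerSum coeffJ t ^ 2 + 2 * (powerSum coeffJ t * (t * powerSum (derivCoeff coeffY) t) -
      (t * powerSum (derivCoeff coeffJ) t) * powerSum coeffY t) = 1 := by
  set w : ℝ → ℝ := fun t => powerSum coeffJ t ^ 2 +
    2 * (powerSum coeffJ t * (t * powerSum (derivCoeff coeffY) t) -
      (t * powerSum (derivCoeff coeffJ) t) * powerSum coeffY t) with hw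
  have hd : ∀ t, HasDerivAt w 0 t := fun t => by
    have hS := expBounded_coeffJ.hasDerivAt t
    have hT := expBounded_coeffY.hasDerivAt t
    refine ((hS.pow 2).add (((hS.mul (hasDerivAt_mul_powerSum_coeffY t)).sub
      ((hasDerivAt_mul_powerSum_coeffJ t).mul hT)).const_mul 2)).congr_deriv ?_
    push_cast
    ring
  have h0 : w 0 = 1 := by
    have : powerSum coeffJ 0 = 1 := by
      rw [powerSum, tsum_eq_single 0 (fun k hk => by simp [hk])]
      simp [coeffJ]
    simp [hw, this]
  have := is_const_of_deriv_eq_zero (fun t => (hd t).differentiableAt) (fun t => (hd t).deriv) t 0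
  rw [h0] at this
  exact this

lemma besselJ0_eq (x : ℝ) : besselJ0 x = powerSum coeffJ ((x / 2) ^ 2) := by
  simp only [besselJ0, powerSum, coeffJ, pow_mul]

lemma besselY0_eq (x : ℝ) : besselY0 x = 2 / π *
    ((Real.log (x / 2) + Real.eulerMascheroniConstant) * besselJ0 x +
      powerSum coeffY ((x / 2) ^ 2)) := by
  simp only [besselY0, powerSum, coeffY, pow_mul]
  ring

/-- `x J₀'(x)`. -/
noncomputable def thetaJ (x : ℝ) : ℝ :=
  2 * ((x / 2) ^ 2 * powerSum (derivCoeff coeffJ) ((x / 2) ^ 2))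

/-- `x Y₀'(x)`. -/
noncomputable def thetaY (x : ℝ) : ℝ :=
  2 / π * (besselJ0 x + (Real.log (x / 2) + Real.eulerMascheroniConstant) * thetaJ x +
    2 * ((x / 2) ^ 2 * powerSum (derivCoeff coeffY) ((x / 2) ^ 2)))

/-- `B` solves Bessel's equation `(x B')' = -x B` of order zero on `x > 0`, and `b = x B'`. -/
def IsBesselPair (B b : ℝ → ℝ) : Prop :=
  ∀ x : ℝ, 0 < x → HasDerivAt B (b x / x) x ∧ HasDerivAt b (-(x * B x)) x

lemma hasDerivAt_sq_half (x : ℝ) : HasDerivAt (fun x : ℝ => (x / 2) ^ 2) (x / 2) x := by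
  refine (((hasDerivAt_id x).div_const 2).pow 2).congr_deriv ?_
  simp; ring

lemma isBesselPair_J : IsBesselPair besselJ0 thetaJ := by
  intro x hx
  constructor
  · have := (expBounded_coeffJ.hasDerivAt ((x / 2) ^ 2)).comp x (hasDerivAt_sq_half x)
    rw [show besselJ0 = powerSum coeffJ ∘ fun x => (x / 2) ^ 2 from funext besselJ0_eq]
    refine this.congr_deriv ?_
    rw [thetaJ]; field_simp
  · have := ((hasDerivAt_mul_powerSum_coeffJ ((x / 2) ^ 2)).comp x
      (hasDerivAt_sq_half x)).const_mul 2
    refine this.congr_deriv ?_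
    rw [besselJ0_eq]; ring

lemma isBesselPair_Y : IsBesselPair besselY0 thetaY := by
  intro x hx
  obtain ⟨hJ, hJ'⟩ := isBesselPair_J x hx
  have hL : HasDerivAt (fun x : ℝ => Real.log (x / 2) + Real.eulerMascheroniConstant) (1 / x) x := by
    refine ((((hasDerivAt_id x).div_const 2).log (by simp; positivity)).add_const _).congr_deriv ?_
    simp only [id]; field_simp
  constructor
  · have hT := (expBounded_coeffY.hasDerivAt ((x / 2) ^ 2)).comp x (hasDerivAt_sq_half x)
    have := ((hL.mul hJ).add hT).const_mul (2 / π)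
    rw [show besselY0 = _ from funext besselY0_eq]
    refine this.congr_deriv ?_
    rw [thetaY]; field_simp
  · have hT := ((hasDerivAt_mul_powerSum_coeffY ((x / 2) ^ 2)).comp x
      (hasDerivAt_sq_half x)).const_mul 2
    have := ((hJ.add (hL.mul hJ')).add hT).const_mul (2 / π)
    refine this.congr_deriv ?_
    rw [besselY0_eq, thetaJ]; field_simp; ring

lemma bessel_wronskian (x : ℝ) :
    besselJ0 x * thetaY x - thetaJ x * besselY0 x = 2 / π := by
  have := powerSum_wronskian ((x / 2) ^ 2)
  rw [besselY0_eq, thetaY, thetaJ, besselJ0_eq]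
  linear_combination (2 / π) * this

lemma continuous_powerSum {c : ℕ → ℝ} (hc : ExpBounded c) : Continuous (powerSum c) :=
  continuous_iff_continuousAt.2 fun t => (hc.hasDerivAt t).continuousAt

lemma continuous_besselJ0 : Continuous besselJ0 := by
  rw [show besselJ0 = _ from funext besselJ0_eq]
  exact (continuous_powerSum expBounded_coeffJ).comp (by fun_prop)

lemma continuous_thetaJ : Continuous thetaJ := by
  have := continuous_powerSum expBounded_coeffJ.shift
  unfold thetaJ
  fun_prop

lemma IsBesselPair.continuousOn {B b : ℝ → ℝ} (h : IsBesselPair B b) : ContinuousOn B (Ioi 0) :=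
  fun x hx => (h x hx).1.continuousAt.continuousWithinAt

lemma powerSum_zero (c : ℕ → ℝ) : powerSum c 0 = c 0 := by
  rw [powerSum, tsum_eq_single 0 (fun k hk => by simp [hk])]
  simp

lemma besselJ0_zero : besselJ0 0 = 1 := by
  rw [besselJ0_eq]; norm_num [powerSum_zero, coeffJ]

lemma thetaJ_zero : thetaJ 0 = 0 := by simp [thetaJ]

lemma tendsto_besselJ0 : Tendsto besselJ0 (𝓝[>] 0) (𝓝 1) := by
  have := continuous_besselJ0.tendsto 0
  rw [besselJ0_zero] at this
  exact this.mono_left nhdsWithin_le_nhds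

lemma tendsto_sq_mul_logTerm :
    Tendsto (fun x : ℝ => (x / 2) ^ 2 * (Real.log (x / 2) + Real.eulerMascheroniConstant))
      (𝓝[>] 0) (𝓝 0) := by
  have h1 : Tendsto (fun y : ℝ => Real.log y * y) (𝓝[>] 0) (𝓝 0) :=
    by
    simpa using tendsto_log_mul_rpow_nhdsGT_zero one_pos
  have h2 : Tendsto (fun x : ℝ => x / 2) (𝓝[>] 0) (𝓝[>] 0) := by
    refine tendsto_nhdsWithin_iff.2 ⟨?_, ?_⟩
    · have : Continuous fun x : ℝ => x / 2 := by fun_prop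
      simpa using (this.tendsto 0).mono_left nhdsWithin_le_nhds
    · filter_upwards [self_mem_nhdsWithin] with x hx
      exact half_pos (mem_Ioi.1 hx)
  have h3 := h1.comp h2
  have h4 : Tendsto (fun x : ℝ => x / 2) (𝓝[>] 0) (𝓝 0) := h2.mono_right nhdsWithin_le_nhds
  have := (h4.mul h3).add ((h4.mul h4).mul_const Real.eulerMascheroniConstant)
  simp only [Function.comp_def] at this
  refine (this.congr fun x => by ring).trans_eq (by simp)

lemma tendsto_half_sq : Tendsto (fun x : ℝ => (x / 2) ^ 2) (𝓝[>] 0) (𝓝 0) := by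
  have : Continuous fun x : ℝ => (x / 2) ^ 2 := by fun_prop
  simpa using (this.tendsto 0).mono_left nhdsWithin_le_nhds

/-- Near the origin `Y₀` agrees with its logarithmic term. -/
lemma tendsto_besselY0_sub_log : Tendsto (fun x : ℝ => besselY0 x -
    2 / π * (Real.log (x / 2) + Real.eulerMascheroniConstant)) (𝓝[>] 0) (𝓝 0) := by
  have hS : HasDerivAt (powerSum coeffJ) (powerSum (derivCoeff coeffJ) 0) 0 :=
    expBounded_coeffJ.hasDerivAt 0
  have hO : (fun t => powerSum coeffJ t - 1) =O[𝓝 0] fun t => t := by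
    have := hS.isBigO_sub
    simpa [powerSum_zero, coeffJ] using this
  have hO2 := (hO.comp_tendsto tendsto_half_sq).mul (Asymptotics.isBigO_refl
    (fun x : ℝ => Real.log (x / 2) + Real.eulerMascheroniConstant) (𝓝[>] 0))
  have h1 := hO2.trans_tendsto tendsto_sq_mul_logTerm
  have h2 : Tendsto (fun x : ℝ => powerSum coeffY ((x / 2) ^ 2)) (𝓝[>] 0) (𝓝 0) := by
    have := ((continuous_powerSum expBounded_coeffY).tendsto 0).comp tendsto_half_sq
    simpa [powerSum_zero, coeffY, Function.comp_def] using this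
  have := (h1.add h2).const_mul (2 / π)
  refine (this.congr fun x => ?_).trans_eq (by simp)
  rw [besselY0_eq, besselJ0_eq]
  simp only [Function.comp_apply]
  ring

lemma tendsto_log_half_atBot : Tendsto (fun x : ℝ => 2 / π * (Real.log (x / 2) +
    Real.eulerMascheroniConstant)) (𝓝[>] 0) atBot := by
  refine Tendsto.const_mul_atBot (by positivity) (tendsto_atBot_add_const_right _ _ ?_)
  refine Real.tendsto_log_nhdsGT_zero.comp (tendsto_nhdsWithin_iff.2 ⟨?_, ?_⟩)
  · have : Continuous fun x : ℝ => x / 2 := by fun_prop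
    simpa using (this.tendsto 0).mono_left nhdsWithin_le_nhds
  · filter_upwards [self_mem_nhdsWithin] with x hx
    exact half_pos (mem_Ioi.1 hx)

lemma tendsto_besselY0 : Tendsto besselY0 (𝓝[>] 0) atBot := by
  refine (tendsto_besselY0_sub_log.add_atBot tendsto_log_half_atBot).congr fun x => by ring

lemma tendsto_thetaY : Tendsto thetaY (𝓝[>] 0) (𝓝 (2 / π)) := by
  have hc := ((continuous_powerSum expBounded_coeffJ.shift).tendsto 0).comp tendsto_half_sq
  have hd := ((continuous_powerSum expBounded_coeffY.shift).tendsto 0).comp tendsto_half_sq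
  have h := ((tendsto_besselJ0.add ((tendsto_sq_mul_logTerm.mul hc).const_mul 2)).add
    ((tendsto_half_sq.mul hd).const_mul 2)).const_mul (2 / π)
  refine (h.congr fun x => ?_).trans_eq (by simp)
  simp only [thetaY, thetaJ, Function.comp_apply]
  ring

lemma IsBesselPair.const_wronskian {B b C c : ℝ → ℝ} (h : IsBesselPair B b)
    (h' : IsBesselPair C c) {x y : ℝ} (hx : 0 < x) (hy : 0 < y) :
    B x * c x - b x * C x = B y * c y - b y * C y := by
  have hd : ∀ x ∈ Ioi (0 : ℝ), HasDerivAt (fun x => B x * c x - b x * C x) 0 x := fun x hx => by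
    obtain ⟨h1, h2⟩ := h x hx
    obtain ⟨h3, h4⟩ := h' x hx
    refine ((h1.mul h4).sub (h2.mul h3)).congr_deriv ?_
    have : x ≠ 0 := hx.ne'
    field_simp
    ring
  exact isOpen_Ioi.is_const_of_deriv_eq_zero isPreconnected_Ioi
    (fun x hx => (hd x hx).differentiableAt.differentiableWithinAt) (fun x hx => (hd x hx).deriv)
    hx hy

/-- A solution of Bessel's equation that vanishes at the origin is zero: it is a combination
`α J₀ + β Y₀`, in which `Y₀ → -∞` and `J₀ → 1`. -/
lemma IsBesselPair.eq_zero {B b : ℝ → ℝ} (h : IsBesselPair B b)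
    (h0 : Tendsto B (𝓝[>] 0) (𝓝 0)) {x : ℝ} (hx : 0 < x) : B x = 0 := by
  set α := π / 2 * (B 1 * thetaY 1 - b 1 * besselY0 1) with hα
  set β := π / 2 * (besselJ0 1 * b 1 - thetaJ 1 * B 1) with hβ
  have hrep : ∀ x, 0 < x → B x = α * besselJ0 x + β * besselY0 x := fun x hx => by
    rw [hα, hβ, h.const_wronskian isBesselPair_Y one_pos hx,
      isBesselPair_J.const_wronskian h one_pos hx]
    have h1 := bessel_wronskian x
    have h2 : π / 2 * (2 / π) = 1 := by field_simp
    linear_combination (-(B x)) * h2 - (π / 2 * B x) * h1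
  have hβ0 : β = 0 := by
    by_contra hne
    have h1 : Tendsto (fun x => β * besselY0 x) (𝓝[>] 0) (𝓝 (0 - α * 1)) := by
      refine (h0.sub (tendsto_besselJ0.const_mul α)).congr' ?_
      filter_upwards [self_mem_nhdsWithin] with x hx
      rw [hrep x hx]; ring
    have h2 := h1.const_mul β⁻¹
    refine not_tendsto_nhds_of_tendsto_atBot tendsto_besselY0 _ (h2.congr fun x => ?_)
    field_simp
  have hα0 : α = 0 := by
    have h1 : Tendsto (fun x => α * besselJ0 x) (𝓝[>] 0) (𝓝 0) := by
      refine h0.congr' ?_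
      filter_upwards [self_mem_nhdsWithin] with x hx
      rw [hrep x hx, hβ0]; ring
    have := tendsto_nhds_unique h1 (tendsto_besselJ0.const_mul α)
    linarith
  rw [hrep x hx, hα0, hβ0]; ring

/-! ### The Hankel function as a Laplace integral -/

/-- `(τ² - 2i)^(1/2)`, with positive real part. -/
noncomputable def hankelRoot (τ : ℝ) : ℂ := ((τ : ℂ) ^ 2 - 2 * Complex.I) ^ (1 / 2 : ℂ)

lemma hankelRoot_sq (τ : ℝ) : hankelRoot τ ^ 2 = (τ : ℂ) ^ 2 - 2 * Complex.I := by
  rw [hankelRoot, ← Complex.cpow_nat_mul]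
  norm_num

lemma hankelArg_im (τ : ℝ) : ((τ : ℂ) ^ 2 - 2 * Complex.I).im = -2 := by
  simp [pow_two]

lemma hankelArg_re (τ : ℝ) : ((τ : ℂ) ^ 2 - 2 * Complex.I).re = τ ^ 2 := by
  simp [pow_two]

lemma hankelArg_ne_zero (τ : ℝ) : (τ : ℂ) ^ 2 - 2 * Complex.I ≠ 0 := fun h => by
  have := hankelArg_im τ
  rw [h] at this
  norm_num at this

lemma hankelRoot_re_pos (τ : ℝ) : 0 < (hankelRoot τ).re := by
  rw [hankelRoot, Complex.cpow_def_of_ne_zero (hankelArg_ne_zero τ), Complex.exp_re]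
  refine mul_pos (Real.exp_pos _) (Real.cos_pos_of_mem_Ioo ?_)
  have h1 := Complex.neg_pi_lt_arg ((τ : ℂ) ^ 2 - 2 * Complex.I)
  have h2 : Complex.arg ((τ : ℂ) ^ 2 - 2 * Complex.I) ≤ π := Complex.arg_le_pi _
  have h3 : Complex.arg ((τ : ℂ) ^ 2 - 2 * Complex.I) < 0 := by
    rw [Complex.arg_neg_iff, hankelArg_im]; norm_num
  have h4 : (Complex.log ((τ : ℂ) ^ 2 - 2 * Complex.I) * (1 / 2 : ℂ)).im =
      Complex.arg ((τ : ℂ) ^ 2 - 2 * Complex.I) / 2 := by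
    rw [show (1 / 2 : ℂ) = ((1 / 2 : ℝ) : ℂ) by norm_num, Complex.im_mul_ofReal, Complex.log_im]
    ring
  rw [h4]
  constructor <;> linarith [pi_pos]

lemma hankelRoot_ne_zero (τ : ℝ) : hankelRoot τ ≠ 0 := fun h => by
  have := hankelRoot_re_pos τ
  simp [h] at this

lemma hasDerivAt_hankelRoot (τ : ℝ) :
    HasDerivAt hankelRoot ((τ : ℂ) / hankelRoot τ) τ := by
  have h1 : HasDerivAt (fun τ : ℝ => (τ : ℂ) ^ 2 - 2 * Complex.I) (2 * (τ : ℂ)) τ := by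
    refine ((Complex.ofRealCLM.hasDerivAt (x := τ)).pow 2 |>.sub_const _).congr_deriv ?_
    simp
  have h2 : (τ : ℂ) ^ 2 - 2 * Complex.I ∈ Complex.slitPlane :=
    Or.inr (by rw [hankelArg_im]; norm_num)
  have h3 := (hasDerivAt_id ((τ : ℂ) ^ 2 - 2 * Complex.I)).cpow_const (c := 1 / 2) h2
  refine (h3.comp_of_eq τ h1 rfl).congr_deriv ?_
  have h4 : ((τ : ℂ) ^ 2 - 2 * Complex.I) ^ ((1 / 2 : ℂ) - 1) =
      hankelRoot τ / ((τ : ℂ) ^ 2 - 2 * Complex.I) := by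
    rw [Complex.cpow_sub _ _ (hankelArg_ne_zero τ), Complex.cpow_one, hankelRoot]
  simp only [id]
  rw [h4, ← hankelRoot_sq]
  have := hankelRoot_ne_zero τ
  field_simp

lemma continuous_hankelRoot : Continuous hankelRoot :=
  continuous_iff_continuousAt.2 fun τ => (hasDerivAt_hankelRoot τ).continuousAt

lemma norm_hankelRoot_sq_ge (τ : ℝ) : 2 ≤ ‖hankelRoot τ‖ ^ 2 ∧ τ ^ 2 ≤ ‖hankelRoot τ‖ ^ 2 := by
  rw [← norm_pow, hankelRoot_sq]
  constructor
  · have := Complex.abs_im_le_norm ((τ : ℂ) ^ 2 - 2 * Complex.I)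
    rw [hankelArg_im] at this
    norm_num at this ⊢
    exact this
  · have := Complex.re_le_norm ((τ : ℂ) ^ 2 - 2 * Complex.I)
    rwa [hankelArg_re] at this

lemma sqrt_two_le_norm_hankelRoot (τ : ℝ) : √2 ≤ ‖hankelRoot τ‖ :=
  Real.sqrt_le_iff.2 ⟨norm_nonneg _, (norm_hankelRoot_sq_ge τ).1⟩

lemma norm_hankelRoot_le {τ : ℝ} (hτ : 0 ≤ τ) : ‖hankelRoot τ‖ ≤ τ + 2 := by
  refine abs_le_of_sq_le_sq' ?_ (by positivity) |>.2
  rw [← norm_pow, hankelRoot_sq]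
  refine (norm_sub_le _ _).trans ?_
  simp
  nlinarith

lemma hankelRoot_zero : hankelRoot 0 = 1 - Complex.I := by
  have h1 : (hankelRoot 0 - (1 - Complex.I)) * (hankelRoot 0 + (1 - Complex.I)) = 0 := by
    have := hankelRoot_sq 0
    have hI := Complex.I_sq
    linear_combination this + (-1 : ℂ) * hI + (by push_cast; ring : ((0:ℝ):ℂ)^2 = 0)
  rcases mul_eq_zero.1 h1 with h | h
  · exact sub_eq_zero.1 h
  · have h2 := hankelRoot_re_pos 0
    rw [eq_neg_of_add_eq_zero_left h] at h2
    norm_num at h2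

lemma norm_inv_hankelRoot_le (τ : ℝ) : ‖(hankelRoot τ)⁻¹‖ ≤ (√2)⁻¹ := by
  rw [norm_inv]
  exact inv_anti₀ (by positivity) (sqrt_two_le_norm_hankelRoot τ)

lemma norm_inv_hankelRoot_le_one (τ : ℝ) : ‖(hankelRoot τ)⁻¹‖ ≤ 1 :=
  (norm_inv_hankelRoot_le τ).trans (inv_le_one_of_one_le₀ (by
    rw [Real.one_le_sqrt]; norm_num))

lemma integrable_pow_mul_gauss (n : ℕ) {x : ℝ} (hx : 0 < x) :
    Integrable fun τ : ℝ => τ ^ n * rexp (-x * τ ^ 2) := by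
  have := integrable_rpow_mul_exp_neg_mul_sq hx (s := n) (by linarith [n.cast_nonneg (α := ℝ)])
  simpa only [rpow_natCast] using this

/-- The integrand of the moments of the Laplace integral for the Hankel function. -/
noncomputable def hankelIntegrand (n : ℕ) (x τ : ℝ) : ℂ :=
  ((τ ^ n * rexp (-x * τ ^ 2) : ℝ) : ℂ) * (hankelRoot τ)⁻¹

lemma continuous_hankelIntegrand (n : ℕ) (x : ℝ) : Continuous (hankelIntegrand n x) := by
  have h1 := continuous_hankelRoot.inv₀ hankelRoot_ne_zero
  have h2 : Continuous fun τ : ℝ => ((τ ^ n * rexp (-x * τ ^ 2) : ℝ) : ℂ) := by fun_prop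
  exact h2.mul h1

lemma norm_hankelIntegrand_le (n : ℕ) (x : ℝ) {τ : ℝ} (hτ : 0 ≤ τ) :
    ‖hankelIntegrand n x τ‖ ≤ τ ^ n * rexp (-x * τ ^ 2) := by
  rw [hankelIntegrand, norm_mul, Complex.norm_real, Real.norm_of_nonneg (by positivity)]
  exact mul_le_of_le_one_right (by positivity) (norm_inv_hankelRoot_le_one τ)

lemma integrableOn_hankelIntegrand (n : ℕ) {x : ℝ} (hx : 0 < x) :
    IntegrableOn (hankelIntegrand n x) (Ioi 0) := by
  refine Integrable.mono' (integrable_pow_mul_gauss n hx).integrableOn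
    (continuous_hankelIntegrand n x).aestronglyMeasurable ?_
  filter_upwards [ae_restrict_mem measurableSet_Ioi] with τ hτ
  exact norm_hankelIntegrand_le n x (mem_Ioi.1 hτ).le

/-- `∫₀^∞ τⁿ e^(-x τ²) (τ² - 2i)^(-1/2) dτ`. -/
noncomputable def hankelMoment (n : ℕ) (x : ℝ) : ℂ := ∫ τ in Ioi (0 : ℝ), hankelIntegrand n x τ

lemma hasDerivAt_hankelMoment (n : ℕ) {x : ℝ} (hx : 0 < x) :
    HasDerivAt (hankelMoment n) (-hankelMoment (n + 2) x) x := by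
  have key := (hasDerivAt_integral_of_dominated_loc_of_deriv_le (μ := volume.restrict (Ioi (0 : ℝ)))
    (F := fun x τ => hankelIntegrand n x τ) (F' := fun x τ => -hankelIntegrand (n + 2) x τ)
    (bound := fun τ => τ ^ (n + 2) * rexp (-(x / 2) * τ ^ 2)) (s := Ioi (x / 2)) (x₀ := x)
    (Ioi_mem_nhds (by linarith))
    (Eventually.of_forall fun y => (continuous_hankelIntegrand n y).aestronglyMeasurable)
    (integrableOn_hankelIntegrand n hx)
    (continuous_hankelIntegrand _ _).neg.aestronglyMeasurable ?_
    (integrable_pow_mul_gauss _ (half_pos hx)).integrableOn ?_).2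
  · rw [integral_neg] at key
    exact key
  · filter_upwards [ae_restrict_mem measurableSet_Ioi] with τ hτ y hy
    have hτ' : (0 : ℝ) < τ := hτ
    rw [norm_neg]
    refine (norm_hankelIntegrand_le _ _ hτ'.le).trans ?_
    have : x / 2 < y := hy
    gcongr
  · refine Eventually.of_forall fun τ y _ => ?_
    have h1 : HasDerivAt (fun y : ℝ => τ ^ n * rexp (-y * τ ^ 2))
        (-(τ ^ (n + 2) * rexp (-y * τ ^ 2))) y := by
      have h0 : HasDerivAt (fun y : ℝ => -y * τ ^ 2) (-τ ^ 2) y := by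
        simpa using (hasDerivAt_id y).neg.mul_const (τ ^ 2)
      refine (h0.exp.const_mul (τ ^ n)).congr_deriv ?_
      ring
    refine (h1.ofReal_comp.mul_const (hankelRoot τ)⁻¹).congr_deriv ?_
    simp [hankelIntegrand]

/-- Integration of `d/dτ (e^(-xτ²) τ (τ² - 2i)^(1/2))`; this is Bessel's equation for the Laplace
integral. -/
lemma hankelMoment_relation {x : ℝ} (hx : 0 < x) :
    Complex.I * hankelMoment 0 x - hankelMoment 2 x - 2 * Complex.I * x * hankelMoment 2 x +
      x * hankelMoment 4 x = 0 := by
  set P : ℝ → ℂ := fun τ => hankelIntegrand 3 x τ - 2 * Complex.I * hankelIntegrand 1 x τ with hP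
  set P' : ℝ → ℂ := fun τ => -2 * (Complex.I * hankelIntegrand 0 x τ - hankelIntegrand 2 x τ -
    2 * Complex.I * x * hankelIntegrand 2 x τ + x * hankelIntegrand 4 x τ) with hP'
  have hPeq : P = fun τ : ℝ => ((τ * rexp (-x * τ ^ 2) : ℝ) : ℂ) * hankelRoot τ := by
    funext τ
    simp only [hP, hankelIntegrand]
    have h1 := hankelRoot_ne_zero τ
    have h2 := hankelRoot_sq τ
    push_cast
    field_simp
    rw [h2]
  have hd : ∀ τ ∈ Ici (0 : ℝ), HasDerivAt P (P' τ) τ := fun τ _ => by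
    rw [hPeq]
    have h0 : HasDerivAt (fun τ : ℝ => -x * τ ^ 2) (-x * (2 * τ)) τ := by
      simpa using (hasDerivAt_pow 2 τ).const_mul (-x)
    have h1 := ((hasDerivAt_id τ).mul h0.exp).ofReal_comp
    refine (h1.mul (hasDerivAt_hankelRoot τ)).congr_deriv ?_
    simp only [hP', hankelIntegrand, id, Pi.mul_apply]
    have h1 := hankelRoot_ne_zero τ
    have h2 := hankelRoot_sq τ
    push_cast
    field_simp
    rw [h2]
    ring
  have hi := fun n => integrableOn_hankelIntegrand n hx
  have hP'i : IntegrableOn P' (Ioi 0) :=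
    (((((hi 0).const_mul _).sub (hi 2)).sub ((hi 2).const_mul _)).add ((hi 4).const_mul _)).const_mul _
  have hPi : IntegrableOn P (Ioi 0) := (hi 3).sub ((hi 1).const_mul _)
  have hlim := tendsto_zero_of_hasDerivAt_of_integrableOn_Ioi
    (fun τ hτ => hd τ (mem_Ioi.1 hτ).le) hP'i hPi
  have h := integral_Ioi_of_hasDerivAt_of_tendsto' hd hP'i hlim
  have h0 : P 0 = 0 := by rw [hPeq]; simp
  rw [h0, sub_zero, hP', integral_const_mul, integral_add, integral_sub, integral_sub,
    integral_const_mul, integral_const_mul, integral_const_mul] at h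
  · simpa [hankelMoment] using h
  · exact (hi 0).const_mul _
  · exact hi 2
  · exact ((hi 0).const_mul _).sub (hi 2)
  · exact (hi 2).const_mul _
  · exact (((hi 0).const_mul _).sub (hi 2)).sub ((hi 2).const_mul _)
  · exact (hi 4).const_mul _

/-- The Hankel function `H₀⁽¹⁾`, as a Laplace integral. -/
noncomputable def hankelH (x : ℝ) : ℂ :=
  -(4 / π) * Complex.I * (Complex.exp (x * Complex.I) * hankelMoment 0 x)

/-- `x` times the derivative of `hankelH`. -/
noncomputable def thetaH (x : ℝ) : ℂ :=
  -(4 / π) * Complex.I * (x * (Complex.exp (x * Complex.I) *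
    (Complex.I * hankelMoment 0 x - hankelMoment 2 x)))

lemma hasDerivAt_cexp_mul_I (x : ℝ) : HasDerivAt (fun x : ℝ => Complex.exp (x * Complex.I))
    (Complex.exp (x * Complex.I) * Complex.I) x := by
  refine (((Complex.ofRealCLM.hasDerivAt (x := x)).mul_const Complex.I).cexp).congr_deriv ?_
  simp

lemma hasDerivAt_hankelH {x : ℝ} (hx : 0 < x) :
    HasDerivAt hankelH (thetaH x / x) x ∧ HasDerivAt thetaH (-(x * hankelH x)) x := by
  have hx' : (x : ℂ) ≠ 0 := by exact_mod_cast hx.ne'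
  have hE := hasDerivAt_cexp_mul_I x
  have h0 := hasDerivAt_hankelMoment 0 hx
  have h2 := hasDerivAt_hankelMoment 2 hx
  constructor
  · refine ((hE.mul h0).const_mul _).congr_deriv ?_
    rw [thetaH]; field_simp; ring
  · refine (((Complex.ofRealCLM.hasDerivAt (x := x)).mul
      (hE.mul ((h0.const_mul Complex.I).sub h2))).const_mul _).congr_deriv ?_
    have h := hankelMoment_relation hx
    simp only [hankelH, Complex.ofRealCLM_apply, Complex.ofReal_one, Pi.mul_apply, Pi.sub_apply,
      zero_add, Nat.reduceAdd]
    linear_combination (-(4 / π) * Complex.I * Complex.exp (x * Complex.I)) * h -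
      (4 / π) * Complex.I * Complex.exp (x * Complex.I) * x * hankelMoment 0 x * Complex.I_sq

lemma isBesselPair_re_hankelH :
    IsBesselPair (fun x => (hankelH x).re) (fun x => (thetaH x).re) := fun x hx => by
  obtain ⟨h1, h2⟩ := hasDerivAt_hankelH hx
  have h3 := Complex.reCLM.hasFDerivAt.comp_hasDerivAt x h1
  have h4 := Complex.reCLM.hasFDerivAt.comp_hasDerivAt x h2
  refine ⟨h3.congr_deriv ?_, h4.congr_deriv ?_⟩ <;> simp

lemma isBesselPair_im_hankelH :
    IsBesselPair (fun x => (hankelH x).im) (fun x => (thetaH x).im) := fun x hx => by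
  obtain ⟨h1, h2⟩ := hasDerivAt_hankelH hx
  have h3 := Complex.imCLM.hasFDerivAt.comp_hasDerivAt x h1
  have h4 := Complex.imCLM.hasFDerivAt.comp_hasDerivAt x h2
  refine ⟨h3.congr_deriv ?_, h4.congr_deriv ?_⟩ <;> simp

/-- The substitution `τ = σ / √x`. -/
lemma integral_scale {x : ℝ} (hx : 0 < x) (G : ℝ → ℂ) :
    ∫ τ in Ioi (0 : ℝ), G τ = ((√x)⁻¹ : ℝ) • ∫ σ in Ioi (0 : ℝ), G ((√x)⁻¹ * σ) := by
  have := integral_comp_mul_left_Ioi' G 0 (b := (√x)⁻¹) (by positivity)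
  rw [mul_zero] at this
  exact this.symm

lemma hankelMoment_eq_scaled {x : ℝ} (hx : 0 < x) :
    hankelMoment 0 x = ((√x)⁻¹ : ℝ) • ∫ σ in Ioi (0 : ℝ),
      ((rexp (-σ ^ 2) : ℝ) : ℂ) * (hankelRoot ((√x)⁻¹ * σ))⁻¹ := by
  rw [hankelMoment, integral_scale hx]
  congr 1
  refine integral_congr_ae (Eventually.of_forall fun σ => ?_)
  simp only [hankelIntegrand, pow_zero, one_mul, mul_pow, inv_pow, Real.sq_sqrt hx.le]
  congr 4
  field_simp

lemma integral_gauss_half : ∫ σ in Ioi (0 : ℝ), rexp (-σ ^ 2) = √π / 2 := by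
  have := integral_gaussian_Ioi 1
  simpa using this

lemma integrable_gauss : Integrable fun σ : ℝ => rexp (-σ ^ 2) := by
  simpa using integrable_exp_neg_mul_sq one_pos

lemma norm_hankelMoment_le {x : ℝ} (hx : 0 < x) :
    ‖hankelMoment 0 x‖ ≤ (√x)⁻¹ * (√π / 2 * (√2)⁻¹) := by
  rw [hankelMoment_eq_scaled hx, norm_smul, Real.norm_of_nonneg (by positivity),
    ← integral_gauss_half, ← integral_mul_const]
  gcongr
  refine norm_integral_le_of_norm_le (integrable_gauss.integrableOn.mul_const _) ?_
  refine Eventually.of_forall fun σ => ?_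
  rw [norm_mul, Complex.norm_real, Real.norm_of_nonneg (by positivity)]
  gcongr
  exact norm_inv_hankelRoot_le _

lemma norm_cexp_mul_I (x : ℝ) : ‖Complex.exp (x * Complex.I)‖ = 1 := Complex.norm_exp_ofReal_mul_I x

lemma normSq_hankelH_le {x : ℝ} (hx : 0 < x) : ‖hankelH x‖ ^ 2 ≤ 2 / (π * x) := by
  have h1 : ‖hankelH x‖ = 4 / π * ‖hankelMoment 0 x‖ := by
    rw [hankelH, norm_mul, norm_mul, norm_mul, norm_cexp_mul_I, Complex.norm_I, norm_neg, norm_div,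
      Complex.norm_real, Real.norm_of_nonneg pi_pos.le]
    norm_num
  have h2 := norm_hankelMoment_le hx
  rw [h1, mul_pow]
  calc (4 / π) ^ 2 * ‖hankelMoment 0 x‖ ^ 2 ≤ (4 / π) ^ 2 * ((√x)⁻¹ * (√π / 2 * (√2)⁻¹)) ^ 2 := by
        gcongr
    _ = 2 / (π * x) := by
        simp only [mul_pow, div_pow, inv_pow, Real.sq_sqrt hx.le, Real.sq_sqrt pi_pos.le,
          Real.sq_sqrt (by norm_num : (0 : ℝ) ≤ 2)]
        field_simp
        norm_num

lemma tendsto_sqrt_mul_hankelMoment :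
    Tendsto (fun x : ℝ => ((√x : ℝ) : ℂ) * hankelMoment 0 x) atTop
      (𝓝 ((√π / 4 : ℝ) * (1 + Complex.I))) := by
  have hlim : Tendsto (fun x : ℝ => ∫ σ in Ioi (0 : ℝ),
      ((rexp (-σ ^ 2) : ℝ) : ℂ) * (hankelRoot ((√x)⁻¹ * σ))⁻¹) atTop
      (𝓝 (∫ σ in Ioi (0 : ℝ), ((rexp (-σ ^ 2) : ℝ) : ℂ) * (hankelRoot 0)⁻¹)) := by
    refine tendsto_integral_filter_of_dominated_convergence (fun σ => rexp (-σ ^ 2))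
      (Eventually.of_forall fun x => ?_) (Eventually.of_forall fun x => ?_)
      integrable_gauss.integrableOn (Eventually.of_forall fun σ => ?_)
    · have h1 : Continuous fun σ : ℝ => (hankelRoot ((√x)⁻¹ * σ))⁻¹ :=
        (continuous_hankelRoot.comp (by fun_prop)).inv₀ fun _ => hankelRoot_ne_zero _
      have : Continuous fun σ : ℝ => ((rexp (-σ ^ 2) : ℝ) : ℂ) * (hankelRoot ((√x)⁻¹ * σ))⁻¹ := by
        fun_prop
      exact this.aestronglyMeasurable
    · refine Eventually.of_forall fun σ => ?_
      rw [norm_mul, Complex.norm_real, Real.norm_of_nonneg (by positivity)]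
      exact mul_le_of_le_one_right (by positivity) (norm_inv_hankelRoot_le_one _)
    · refine Tendsto.const_mul _ (Tendsto.inv₀ ?_ (hankelRoot_ne_zero 0))
      refine (continuous_hankelRoot.tendsto 0).comp ?_
      have := (tendsto_inv_atTop_zero.comp Real.tendsto_sqrt_atTop).mul_const σ
      simpa using this
  have hval : ∫ σ in Ioi (0 : ℝ), ((rexp (-σ ^ 2) : ℝ) : ℂ) * (hankelRoot 0)⁻¹ =
      (√π / 4 : ℝ) * (1 + Complex.I) := by
    rw [integral_mul_const, integral_complex_ofReal, integral_gauss_half, hankelRoot_zero]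
    have h1 : (1 - Complex.I) ≠ 0 := by
      rw [← hankelRoot_zero]; exact hankelRoot_ne_zero 0
    have h2 : (1 - Complex.I)⁻¹ = (1 + Complex.I) / 2 := by
      refine inv_eq_of_mul_eq_one_right ?_
      linear_combination (-1 / 2 : ℂ) * Complex.I_sq
    rw [h2]
    push_cast
    ring
  rw [hval] at hlim
  refine hlim.congr' ?_
  filter_upwards [eventually_gt_atTop 0] with x hx
  rw [hankelMoment_eq_scaled hx, Complex.real_smul, ← mul_assoc, ← Complex.ofReal_mul,
    mul_inv_cancel₀ (by positivity), Complex.ofReal_one, one_mul]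

/-- A primitive of `(τ² - 2i)^(-1/2)`. -/
noncomputable def hankelLog (τ : ℝ) : ℂ := Complex.log (τ + hankelRoot τ)

lemma re_add_hankelRoot_pos {τ : ℝ} (hτ : 0 ≤ τ) : 0 < ((τ : ℂ) + hankelRoot τ).re := by
  have := hankelRoot_re_pos τ
  simp; linarith

lemma hasDerivAt_hankelLog {τ : ℝ} (hτ : 0 ≤ τ) :
    HasDerivAt hankelLog (hankelRoot τ)⁻¹ τ := by
  have h1 := (Complex.ofRealCLM.hasDerivAt (x := τ)).add (hasDerivAt_hankelRoot τ)
  have h2 : (τ : ℂ) + hankelRoot τ ∈ Complex.slitPlane := Or.inl (re_add_hankelRoot_pos hτ)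
  refine (h1.clog_real h2).congr_deriv ?_
  have h3 := hankelRoot_ne_zero τ
  have h4 : (τ : ℂ) + hankelRoot τ ≠ 0 := Complex.slitPlane_ne_zero h2
  simp only [Pi.add_apply, Complex.ofRealCLM_apply, Complex.ofReal_one]
  field_simp
  ring

/-- `log (τ + (τ² - 2i)^(1/2)) - log τ`. -/
noncomputable def hankelLogRem (τ : ℝ) : ℂ := Complex.log (1 + hankelRoot τ / τ)

lemma hankelLog_eq {τ : ℝ} (hτ : 0 < τ) : hankelLog τ = (Real.log τ : ℝ) + hankelLogRem τ := by
  have hτ' : (τ : ℂ) ≠ 0 := by exact_mod_cast hτ.ne'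
  rw [hankelLogRem, ← Complex.log_ofReal_mul hτ, hankelLog]
  · congr 1; field_simp
  · have h := re_add_hankelRoot_pos hτ.le
    intro h0
    have : (τ : ℂ) + hankelRoot τ = τ * (1 + hankelRoot τ / τ) := by field_simp
    rw [this, h0] at h
    simp at h

lemma one_le_re_one_add {τ : ℝ} (hτ : 0 < τ) : 1 ≤ (1 + hankelRoot τ / τ).re := by
  have h1 := hankelRoot_re_pos τ
  rw [Complex.add_re, Complex.div_ofReal_re, Complex.one_re]
  have := div_pos h1 hτ
  linarith

lemma norm_clog_le {w : ℂ} (hw : 1 ≤ ‖w‖) : ‖Complex.log w‖ ≤ ‖w‖ + 4 := by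
  have h1 := Complex.norm_le_abs_re_add_abs_im (Complex.log w)
  rw [Complex.log_re, Complex.log_im] at h1
  have h2 := Complex.abs_arg_le_pi w
  have h3 := Real.log_le_self (norm_nonneg w)
  rw [abs_of_nonneg (Real.log_nonneg hw)] at h1
  linarith [pi_lt_four]

lemma norm_hankelLogRem_le {τ : ℝ} (hτ : 0 < τ) : ‖hankelLogRem τ‖ ≤ 6 + 2 / τ := by
  have h1 : 1 ≤ ‖1 + hankelRoot τ / τ‖ := (one_le_re_one_add hτ).trans (Complex.re_le_norm _)
  refine (norm_clog_le h1).trans ?_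
  have h2 : ‖1 + hankelRoot τ / τ‖ ≤ 1 + (τ + 2) / τ := by
    refine (norm_add_le _ _).trans ?_
    rw [norm_one, norm_div, Complex.norm_real, Real.norm_of_nonneg hτ.le]
    gcongr
    exact norm_hankelRoot_le hτ.le
  have h3 : (τ + 2) / τ = 1 + 2 / τ := by field_simp
  linarith

lemma norm_hankelLog_le {τ : ℝ} (hτ : 0 ≤ τ) : ‖hankelLog τ‖ ≤ 2 * τ + 6 := by
  have h1 : 1 ≤ ‖(τ : ℂ) + hankelRoot τ‖ := by
    have h2 : ‖hankelRoot τ‖ ^ 2 ≤ ‖(τ : ℂ) + hankelRoot τ‖ ^ 2 := by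
      rw [← Complex.normSq_eq_norm_sq, ← Complex.normSq_eq_norm_sq, Complex.normSq_apply,
        Complex.normSq_apply]
      have := hankelRoot_re_pos τ
      simp
      nlinarith
    have h3 := (norm_hankelRoot_sq_ge τ).1
    nlinarith [norm_nonneg ((τ : ℂ) + hankelRoot τ)]
  refine (norm_clog_le h1).trans ?_
  have h2 : ‖(τ : ℂ) + hankelRoot τ‖ ≤ τ + (τ + 2) := by
    refine (norm_add_le _ _).trans ?_
    rw [Complex.norm_real, Real.norm_of_nonneg hτ]
    gcongr
    exact norm_hankelRoot_le hτ
  linarith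

lemma tendsto_hankelLogRem : Tendsto hankelLogRem atTop (𝓝 (Complex.log 2)) := by
  have h1 : Tendsto (fun τ : ℝ => hankelRoot τ / τ - 1) atTop (𝓝 0) := by
    refine squeeze_zero_norm' (a := fun τ : ℝ => 2 / τ ^ 2) ?_ ?_
    · filter_upwards [eventually_gt_atTop 0] with τ hτ
      have hτ' : (τ : ℂ) ≠ 0 := by exact_mod_cast hτ.ne'
      have h4 : (τ : ℂ) + hankelRoot τ ≠ 0 := fun h => by
        have := re_add_hankelRoot_pos hτ.le
        rw [h] at this
        simp at this
      have h5 : hankelRoot τ / τ - 1 = -2 * Complex.I / (τ * (τ + hankelRoot τ)) := by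
        rw [eq_div_iff (mul_ne_zero hτ' h4)]
        have := hankelRoot_sq τ
        field_simp
        linear_combination this
      have h6 : τ ≤ ‖(τ : ℂ) + hankelRoot τ‖ := by
        refine le_trans ?_ (Complex.re_le_norm _)
        have := hankelRoot_re_pos τ
        simp; linarith
      rw [h5, norm_div, norm_mul, norm_mul, Complex.norm_I, Complex.norm_real,
        Real.norm_of_nonneg hτ.le]
      have : τ ^ 2 ≤ τ * ‖(τ : ℂ) + hankelRoot τ‖ := by nlinarith
      simp only [norm_neg, RCLike.norm_ofNat, mul_one]
      gcongr
    · exact tendsto_const_nhds.div_atTop (tendsto_pow_atTop two_ne_zero)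
  have h2 : Tendsto (fun τ : ℝ => 1 + hankelRoot τ / τ) atTop (𝓝 2) := by
    have := h1.const_add 2
    rw [add_zero] at this
    exact this.congr fun τ => by ring
  exact h2.clog (by simp)

lemma continuousOn_hankelLog : ContinuousOn hankelLog (Ici 0) := fun _ hτ =>
  (hasDerivAt_hankelLog hτ).continuousAt.continuousWithinAt

lemma integrableOn_gauss_comb (a b : ℝ) (m n : ℕ) {x : ℝ} (hx : 0 < x) :
    IntegrableOn (fun τ : ℝ => a * (τ ^ m * rexp (-x * τ ^ 2)) + b * (τ ^ n * rexp (-x * τ ^ 2)))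
      (Ioi 0) := by
  have h1 := ((integrable_pow_mul_gauss m hx).const_mul a).add
    ((integrable_pow_mul_gauss n hx).const_mul b)
  exact h1.integrableOn

lemma integrableOn_mul_hankelLog {x : ℝ} (hx : 0 < x) :
    IntegrableOn (fun τ : ℝ => ((2 * x * (τ * rexp (-x * τ ^ 2)) : ℝ) : ℂ) * hankelLog τ)
      (Ioi 0) := by
  refine Integrable.mono' (g := fun τ => 2 * x * (2 * (τ ^ 2 * rexp (-x * τ ^ 2)) +
    6 * (τ ^ 1 * rexp (-x * τ ^ 2))))
    ((integrableOn_gauss_comb 2 6 2 1 hx).const_mul (2 * x)) ?_ ?_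
  · refine ContinuousOn.aestronglyMeasurable ?_ measurableSet_Ioi
    have : ContinuousOn hankelLog (Ioi 0) := continuousOn_hankelLog.mono Ioi_subset_Ici_self
    fun_prop
  · filter_upwards [ae_restrict_mem measurableSet_Ioi] with τ hτ
    have hτ' : (0 : ℝ) < τ := hτ
    rw [norm_mul, Complex.norm_real, Real.norm_of_nonneg (by positivity)]
    have := norm_hankelLog_le hτ'.le
    calc _ ≤ 2 * x * (τ * rexp (-x * τ ^ 2)) * (2 * τ + 6) := by gcongr
      _ = _ := by ring

/-- Integration by parts in the Laplace integral. -/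
lemma hankelMoment_eq_parts {x : ℝ} (hx : 0 < x) : hankelMoment 0 x = -hankelLog 0 +
    ∫ τ in Ioi (0 : ℝ), ((2 * x * (τ * rexp (-x * τ ^ 2)) : ℝ) : ℂ) * hankelLog τ := by
  set P : ℝ → ℂ := fun τ => ((rexp (-x * τ ^ 2) : ℝ) : ℂ) * hankelLog τ with hP
  set P' : ℝ → ℂ := fun τ => hankelIntegrand 0 x τ -
    ((2 * x * (τ * rexp (-x * τ ^ 2)) : ℝ) : ℂ) * hankelLog τ with hP'
  have hd : ∀ τ ∈ Ici (0 : ℝ), HasDerivAt P (P' τ) τ := fun τ hτ => by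
    have h0 : HasDerivAt (fun τ : ℝ => -x * τ ^ 2) (-x * (2 * τ)) τ := by
      simpa using (hasDerivAt_pow 2 τ).const_mul (-x)
    refine (h0.exp.ofReal_comp.mul (hasDerivAt_hankelLog hτ)).congr_deriv ?_
    simp only [hP', hankelIntegrand]
    push_cast
    ring
  have hi := integrableOn_hankelIntegrand 0 hx
  have hj := integrableOn_mul_hankelLog hx
  have hP'i : IntegrableOn P' (Ioi 0) := hi.sub hj
  have hPi : IntegrableOn P (Ioi 0) := by
    refine Integrable.mono' (g := fun τ => (2 * (τ ^ 1 * rexp (-x * τ ^ 2)) +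
      6 * (τ ^ 0 * rexp (-x * τ ^ 2))))
      (integrableOn_gauss_comb 2 6 1 0 hx) ?_ ?_
    · refine ContinuousOn.aestronglyMeasurable ?_ measurableSet_Ioi
      have : ContinuousOn hankelLog (Ioi 0) := continuousOn_hankelLog.mono Ioi_subset_Ici_self
      fun_prop
    · filter_upwards [ae_restrict_mem measurableSet_Ioi] with τ hτ
      have hτ' : (0 : ℝ) < τ := hτ
      rw [hP, norm_mul, Complex.norm_real, Real.norm_of_nonneg (by positivity)]
      have := norm_hankelLog_le hτ'.le
      calc _ ≤ (rexp (-x * τ ^ 2)) * (2 * τ + 6) := by gcongr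
        _ = _ := by ring
  have hlim := tendsto_zero_of_hasDerivAt_of_integrableOn_Ioi
    (fun τ hτ => hd τ (mem_Ioi.1 hτ).le) hP'i hPi
  have h := integral_Ioi_of_hasDerivAt_of_tendsto' hd hP'i hlim
  rw [hP', integral_sub hi hj] at h
  have h0 : P 0 = hankelLog 0 := by simp [hP]
  rw [h0] at h
  rw [hankelMoment]
  linear_combination h

/-- `Γ'(1) = -γ` as an integral; the source of Euler's constant in the behaviour of the Hankel function
at the origin. -/
lemma integral_exp_mul_log :
    ∫ y in Ioi (0 : ℝ), rexp (-y) * Real.log y = -Real.eulerMascheroniConstant := by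
  have h1 := Complex.hasDerivAt_GammaIntegral (s := 1) (by simp)
  have h2 := Complex.hasDerivAt_Gamma_one
  have h3 : Complex.Gamma =ᶠ[𝓝 1] Complex.GammaIntegral := by
    have : {s : ℂ | 0 < s.re} ∈ 𝓝 (1 : ℂ) :=
      (isOpen_lt continuous_const Complex.continuous_re).mem_nhds (by simp)
    filter_upwards [this] with s hs
    exact Complex.Gamma_eq_integral hs
  have h4 := h2.unique (h1.congr_of_eventuallyEq h3)
  have h5 : ∫ t : ℝ in Ioi 0, (t : ℂ) ^ ((1 : ℂ) - 1) * (Real.log t * Real.exp (-t)) =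
      ((∫ y in Ioi (0 : ℝ), rexp (-y) * Real.log y : ℝ) : ℂ) := by
    rw [← integral_complex_ofReal]
    refine integral_congr_ae (Eventually.of_forall fun t => ?_)
    simp
    ring
  rw [h5] at h4
  exact_mod_cast h4.symm

lemma integral_gauss_mul_log : ∫ σ in Ioi (0 : ℝ), 2 * (σ * rexp (-σ ^ 2)) * Real.log σ =
    -Real.eulerMascheroniConstant / 2 := by
  have h := integral_comp_rpow_Ioi_of_pos (g := fun y => rexp (-y) * Real.log y) (p := 2) two_pos
  rw [integral_exp_mul_log] at h
  rw [← h, eq_div_iff two_ne_zero, ← integral_mul_const]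
  refine setIntegral_congr_fun measurableSet_Ioi fun σ hσ => ?_
  norm_num
  ring

lemma integral_mul_gauss : ∫ σ in Ioi (0 : ℝ), 2 * (σ * rexp (-σ ^ 2)) = 1 := by
  have h := integral_comp_rpow_Ioi_of_pos (g := fun y => rexp (-y)) (p := 2) two_pos
  rw [integral_exp_neg_Ioi_zero] at h
  rw [← h]
  refine setIntegral_congr_fun measurableSet_Ioi fun σ hσ => ?_
  norm_num
  ring

lemma integrableOn_mul_gauss : IntegrableOn (fun σ : ℝ => 2 * (σ * rexp (-σ ^ 2))) (Ioi 0) := by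
  simpa using ((integrable_pow_mul_gauss 1 one_pos).const_mul 2).integrableOn

lemma abs_log_le_add_inv {σ : ℝ} (hσ : 0 < σ) : |Real.log σ| ≤ σ + σ⁻¹ := by
  rw [abs_le]
  have h1 := Real.one_sub_inv_le_log_of_pos hσ
  have h2 := Real.log_le_self hσ.le
  have h3 : 0 < σ⁻¹ := by positivity
  constructor <;> linarith

lemma integrableOn_gauss_mul_log :
    IntegrableOn (fun σ : ℝ => 2 * (σ * rexp (-σ ^ 2)) * Real.log σ) (Ioi 0) := by
  refine Integrable.mono' (g := fun σ => 2 * (σ ^ 2 * rexp (-1 * σ ^ 2)) +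
    2 * (σ ^ 0 * rexp (-1 * σ ^ 2))) (integrableOn_gauss_comb 2 2 2 0 one_pos) ?_ ?_
  · refine ContinuousOn.aestronglyMeasurable ?_ measurableSet_Ioi
    have : ContinuousOn Real.log (Ioi 0) := Real.continuousOn_log.mono fun x hx => ne_of_gt hx
    fun_prop
  · filter_upwards [ae_restrict_mem measurableSet_Ioi] with σ hσ
    have hσ' : (0 : ℝ) < σ := hσ
    rw [norm_mul, Real.norm_of_nonneg (by positivity), Real.norm_eq_abs]
    have := abs_log_le_add_inv hσ'
    calc _ ≤ 2 * (σ * rexp (-σ ^ 2)) * (σ + σ⁻¹) := by gcongr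
      _ = _ := by
        simp only [neg_one_mul]
        field_simp

lemma continuousOn_hankelLogRem_scaled {x : ℝ} (hx : 0 < x) :
    ContinuousOn (fun σ : ℝ => hankelLogRem ((√x)⁻¹ * σ)) (Ioi 0) := by
  intro σ hσ
  have hσ' : (0 : ℝ) < (√x)⁻¹ * σ := mul_pos (by positivity) hσ
  have h3 : ContinuousAt (fun σ : ℝ => ((((√x)⁻¹ * σ : ℝ)) : ℂ)) σ := by fun_prop
  have h4 : ContinuousAt (fun σ : ℝ => hankelRoot ((√x)⁻¹ * σ)) σ :=
    (continuous_hankelRoot.comp (by fun_prop)).continuousAt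
  refine (ContinuousAt.clog (continuousAt_const.add (h4.div h3 ?_)) ?_).continuousWithinAt
  · exact_mod_cast hσ'.ne'
  · exact Or.inl (lt_of_lt_of_le one_pos (one_le_re_one_add hσ'))

lemma tendsto_integral_hankelLogRem :
    Tendsto (fun x : ℝ => ∫ σ in Ioi (0 : ℝ),
      ((2 * (σ * rexp (-σ ^ 2)) : ℝ) : ℂ) * hankelLogRem ((√x)⁻¹ * σ)) (𝓝[>] 0)
      (𝓝 (Complex.log 2)) := by
  have hval : ∫ σ in Ioi (0 : ℝ), ((2 * (σ * rexp (-σ ^ 2)) : ℝ) : ℂ) * Complex.log 2 =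
      Complex.log 2 := by
    rw [integral_mul_const, integral_complex_ofReal, integral_mul_gauss]
    simp
  rw [← hval]
  refine tendsto_integral_filter_of_dominated_convergence
    (fun σ => 12 * (σ ^ 1 * rexp (-1 * σ ^ 2)) + 4 * (σ ^ 0 * rexp (-1 * σ ^ 2))) ?_ ?_
    (integrableOn_gauss_comb 12 4 1 0 one_pos) ?_
  · filter_upwards [self_mem_nhdsWithin] with x hx
    have hx' : (0 : ℝ) < x := hx
    refine ContinuousOn.aestronglyMeasurable ?_ measurableSet_Ioi
    have h2 := continuousOn_hankelLogRem_scaled hx'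
    have h5 : ContinuousOn (fun σ : ℝ => ((2 * (σ * rexp (-σ ^ 2)) : ℝ) : ℂ)) (Ioi 0) := by
      fun_prop
    exact h5.mul h2
  · have h6 : ∀ᶠ x : ℝ in 𝓝[>] 0, x < 1 := nhdsWithin_le_nhds (Iio_mem_nhds one_pos)
    filter_upwards [self_mem_nhdsWithin, h6] with x hx hx1
    have hx' : (0 : ℝ) < x := hx
    filter_upwards [ae_restrict_mem measurableSet_Ioi] with σ hσ
    have hσ' : (0 : ℝ) < σ := hσ
    rw [norm_mul, Complex.norm_real, Real.norm_of_nonneg (by positivity)]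
    have h2 := norm_hankelLogRem_le (τ := (√x)⁻¹ * σ) (by positivity)
    have h3 : 2 / ((√x)⁻¹ * σ) ≤ 2 / σ := by
      have : √x ≤ 1 := Real.sqrt_le_one.2 hx1.le
      have h7 : 2 / ((√x)⁻¹ * σ) = √x * (2 / σ) := by field_simp
      rw [h7]
      exact mul_le_of_le_one_left (by positivity) this
    calc _ ≤ 2 * (σ * rexp (-σ ^ 2)) * (6 + 2 / σ) := by gcongr; linarith
      _ = _ := by
        simp only [neg_one_mul]
        field_simp
        ring
  · filter_upwards [ae_restrict_mem measurableSet_Ioi] with σ hσ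
    have hσ' : (0 : ℝ) < σ := hσ
    refine Tendsto.const_mul _ (tendsto_hankelLogRem.comp ?_)
    refine Tendsto.atTop_mul_const hσ' (tendsto_inv_nhdsGT_zero.comp ?_)
    refine tendsto_nhdsWithin_iff.2 ⟨?_, ?_⟩
    · have := (Real.continuous_sqrt.tendsto 0).mono_left (nhdsWithin_le_nhds (s := Ioi 0))
      simpa using this
    · filter_upwards [self_mem_nhdsWithin] with x hx
      exact Real.sqrt_pos.2 hx

lemma hankelLog_zero : hankelLog 0 = (Real.log 2 / 2 : ℝ) - (π / 4 : ℝ) * Complex.I := by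
  have h1 : (1 - Complex.I) = ((√2 : ℝ) : ℂ) * Complex.exp (((-(π / 4) : ℝ) : ℂ) * Complex.I) := by
    rw [Complex.exp_mul_I, ← Complex.ofReal_cos, ← Complex.ofReal_sin, Real.cos_neg, Real.sin_neg,
      Real.cos_pi_div_four, Real.sin_pi_div_four]
    apply Complex.ext <;> simp <;> ring_nf <;> norm_num
  rw [hankelLog, hankelRoot_zero, Complex.ofReal_zero, zero_add, h1,
    Complex.log_ofReal_mul (by positivity) (Complex.exp_ne_zero _), Complex.log_exp, Real.log_sqrt
    zero_le_two]
  · push_cast; ring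
  · simp; linarith [pi_pos]
  · simp; linarith [pi_pos]

/-- The moment for small `x`: the rescaled logarithm splits into `log σ`, `-(log x) / 2` and a remainder
with limit `log 2`. -/
lemma hankelMoment_eq_log_add {x : ℝ} (hx : 0 < x) : hankelMoment 0 x =
    -hankelLog 0 + ((-Real.eulerMascheroniConstant / 2 - Real.log x / 2 : ℝ) : ℂ) +
      ∫ σ in Ioi (0 : ℝ), ((2 * (σ * rexp (-σ ^ 2)) : ℝ) : ℂ) * hankelLogRem ((√x)⁻¹ * σ) := by
  have hs : ((√x : ℝ) : ℂ) ≠ 0 := by exact_mod_cast (Real.sqrt_pos.2 hx).ne'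
  have e1 : ∫ τ in Ioi (0 : ℝ), ((2 * x * (τ * rexp (-x * τ ^ 2)) : ℝ) : ℂ) * hankelLog τ =
      ∫ σ in Ioi (0 : ℝ), ((2 * (σ * rexp (-σ ^ 2)) : ℝ) : ℂ) * hankelLog ((√x)⁻¹ * σ) := by
    rw [integral_scale hx, ← integral_smul]
    refine integral_congr_ae (Eventually.of_forall fun σ => ?_)
    have h1 : -x * ((√x)⁻¹ * σ) ^ 2 = -σ ^ 2 := by
      rw [mul_pow, inv_pow, Real.sq_sqrt hx.le]; field_simp
    simp only [Complex.real_smul]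
    rw [h1, ← mul_assoc, ← Complex.ofReal_mul]
    congr 2
    have h2 := Real.mul_self_sqrt hx.le
    have h3 := (Real.sqrt_pos.2 hx).ne'
    field_simp
    rw [Real.sq_sqrt hx.le]
  have hi1 := integrableOn_gauss_mul_log.ofReal (𝕜 := ℂ)
  have hi2 := (integrableOn_mul_gauss.ofReal (𝕜 := ℂ)).mul_const ((Real.log x / 2 : ℝ) : ℂ)
  have hi3 : IntegrableOn (fun σ : ℝ => ((2 * (σ * rexp (-σ ^ 2)) : ℝ) : ℂ) *
      hankelLogRem ((√x)⁻¹ * σ)) (Ioi 0) := by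
    refine Integrable.mono' (g := fun σ => 12 * (σ ^ 1 * rexp (-1 * σ ^ 2)) +
      4 * √x * (σ ^ 0 * rexp (-1 * σ ^ 2)))
      (integrableOn_gauss_comb 12 (4 * √x) 1 0 one_pos) ?_ ?_
    · refine ContinuousOn.aestronglyMeasurable ?_ measurableSet_Ioi
      have h2 := continuousOn_hankelLogRem_scaled hx
      have h5 : ContinuousOn (fun σ : ℝ => ((2 * (σ * rexp (-σ ^ 2)) : ℝ) : ℂ)) (Ioi 0) := by
        fun_prop
      exact h5.mul h2
    · filter_upwards [ae_restrict_mem measurableSet_Ioi] with σ hσ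
      have hσ' : (0 : ℝ) < σ := hσ
      rw [norm_mul, Complex.norm_real, Real.norm_of_nonneg (by positivity)]
      have h2 := norm_hankelLogRem_le (τ := (√x)⁻¹ * σ) (by positivity)
      calc _ ≤ 2 * (σ * rexp (-σ ^ 2)) * (6 + 2 / ((√x)⁻¹ * σ)) := by gcongr
        _ = _ := by
          simp only [neg_one_mul]
          field_simp
          ring
  have e2 : ∫ σ in Ioi (0 : ℝ), ((2 * (σ * rexp (-σ ^ 2)) : ℝ) : ℂ) * hankelLog ((√x)⁻¹ * σ) =
      ∫ σ in Ioi (0 : ℝ), (((2 * (σ * rexp (-σ ^ 2)) * Real.log σ : ℝ) : ℂ) -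
        ((2 * (σ * rexp (-σ ^ 2)) : ℝ) : ℂ) * ((Real.log x / 2 : ℝ) : ℂ) +
        ((2 * (σ * rexp (-σ ^ 2)) : ℝ) : ℂ) * hankelLogRem ((√x)⁻¹ * σ)) := by
    refine setIntegral_congr_fun measurableSet_Ioi fun σ hσ => ?_
    have hσ' : (0 : ℝ) < σ := hσ
    have h3 := (Real.sqrt_pos.2 hx).ne'
    rw [hankelLog_eq (mul_pos (by positivity) hσ'), Real.log_mul (by positivity) hσ'.ne', Real.log_inv,
      Real.log_sqrt hx.le]
    push_cast
    ring
  rw [hankelMoment_eq_parts hx, e1, e2, add_assoc]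
  congr 1
  have e3 := integral_add (hi1.sub hi2) hi3
  have e4 := integral_sub hi1 hi2
  simp only [Pi.sub_apply] at e3 e4
  refine e3.trans ?_
  congr 1
  refine e4.trans ?_
  have e5 : ∫ σ in Ioi (0 : ℝ), ((2 * (σ * rexp (-σ ^ 2)) * Real.log σ : ℝ) : ℂ) =
      ((-Real.eulerMascheroniConstant / 2 : ℝ) : ℂ) := by
    rw [integral_complex_ofReal, integral_gauss_mul_log]
  have e6 : ∫ σ in Ioi (0 : ℝ), ((2 * (σ * rexp (-σ ^ 2)) : ℝ) : ℂ) = 1 := by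
    rw [integral_complex_ofReal, integral_mul_gauss, Complex.ofReal_one]
  rw [integral_mul_const]
  erw [e5, e6]
  push_cast
  ring

/-- The Hankel integral behaves like `1 + (2i/π)(log (x/2) + γ)` at the origin, as `J₀ + i Y₀` does. -/
lemma tendsto_hankelH_sub_log : Tendsto (fun x : ℝ => hankelH x -
    Complex.I * ((2 / π * (Real.log (x / 2) + Real.eulerMascheroniConstant) : ℝ) : ℂ))
    (𝓝[>] 0) (𝓝 1) := by
  set ℓ : ℝ → ℝ := fun x => -(Real.log (x / 2) + Real.eulerMascheroniConstant) / 2 with hℓ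
  set c : ℝ → ℂ := fun x => (-hankelLog 0 - (Real.log 2 / 2 : ℝ)) + ∫ σ in Ioi (0 : ℝ),
    ((2 * (σ * rexp (-σ ^ 2)) : ℝ) : ℂ) * hankelLogRem ((√x)⁻¹ * σ) with hc
  have hc1 : Tendsto c (𝓝[>] 0) (𝓝 ((π / 4 : ℝ) * Complex.I)) := by
    have := tendsto_integral_hankelLogRem.const_add (-hankelLog 0 - (Real.log 2 / 2 : ℝ))
    refine this.trans_eq ?_
    have h2 : Complex.log 2 = ((Real.log 2 : ℝ) : ℂ) := by
      rw [Complex.ofReal_log zero_le_two]; norm_num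
    rw [hankelLog_zero, h2]
    congr 1
    push_cast
    ring
  have hE : Tendsto (fun x : ℝ => Complex.exp (x * Complex.I)) (𝓝[>] 0) (𝓝 1) := by
    have := (hasDerivAt_cexp_mul_I 0).continuousAt.tendsto.mono_left
      (nhdsWithin_le_nhds (s := Ioi 0))
    simpa using this
  have hE2 : Tendsto (fun x : ℝ => (Complex.exp (x * Complex.I) - 1) * (ℓ x : ℂ))
      (𝓝[>] 0) (𝓝 0) := by
    have hO : (fun x : ℝ => Complex.exp (x * Complex.I) - 1) =O[𝓝[>] 0] fun x : ℝ => x := by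
      have := (hasDerivAt_cexp_mul_I 0).isBigO_sub.mono (nhdsWithin_le_nhds (s := Ioi 0))
      simpa using this
    have hO2 : (fun x : ℝ => (ℓ x : ℂ)) =O[𝓝[>] 0] ℓ := by
      refine Asymptotics.IsBigO.of_bound 1 (Eventually.of_forall fun x => ?_)
      simp
    refine (hO.mul hO2).trans_tendsto ?_
    have h1 : Tendsto (fun y : ℝ => Real.log y * y) (𝓝[>] 0) (𝓝 0) := by
      simpa using tendsto_log_mul_rpow_nhdsGT_zero one_pos
    have h2 : Tendsto (fun x : ℝ => x / 2) (𝓝[>] 0) (𝓝[>] 0) := by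
      refine tendsto_nhdsWithin_iff.2 ⟨?_, ?_⟩
      · have : Continuous fun x : ℝ => x / 2 := by fun_prop
        simpa using (this.tendsto 0).mono_left nhdsWithin_le_nhds
      · filter_upwards [self_mem_nhdsWithin] with x hx
        exact half_pos (mem_Ioi.1 hx)
    have h3 := h1.comp h2
    have h4 : Tendsto (fun x : ℝ => x / 2) (𝓝[>] 0) (𝓝 0) := h2.mono_right nhdsWithin_le_nhds
    have := (h3.add (h4.mul_const Real.eulerMascheroniConstant)).neg
    refine (this.congr fun x => ?_).trans_eq (by simp)
    simp only [hℓ, Function.comp_apply]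
    ring
  have h := ((hE.mul hc1).add hE2).const_mul (-(4 / π : ℂ) * Complex.I)
  have hπ : (π : ℂ) ≠ 0 := by exact_mod_cast pi_ne_zero
  refine (h.congr' ?_).trans_eq ?_
  · filter_upwards [self_mem_nhdsWithin] with x hx
    have hx' : (0 : ℝ) < x := hx
    rw [hankelH, hankelMoment_eq_log_add hx']
    simp only [hc, hℓ]
    rw [Real.log_div hx'.ne' two_ne_zero]
    push_cast
    field_simp
    ring
  · congr 1
    push_cast
    field_simp
    linear_combination (-(π : ℂ)) * Complex.I_sq

/-- `J₀ = Re H₀⁽¹⁾` -/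
lemma besselJ0_eq_re {x : ℝ} (hx : 0 < x) : besselJ0 x = (hankelH x).re := by
  have hp : IsBesselPair (fun x => (hankelH x).re - besselJ0 x)
      (fun x => (thetaH x).re - thetaJ x) := fun x hx => by
    obtain ⟨h1, h2⟩ := isBesselPair_re_hankelH x hx
    obtain ⟨h3, h4⟩ := isBesselPair_J x hx
    exact ⟨(h1.sub h3).congr_deriv (by ring), (h2.sub h4).congr_deriv (by ring)⟩
  have h0 : Tendsto (fun x => (hankelH x).re - besselJ0 x) (𝓝[>] 0) (𝓝 0) := by
    have := (Complex.continuous_re.tendsto _).comp tendsto_hankelH_sub_log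
    refine ((this.sub tendsto_besselJ0).congr fun x => ?_).trans_eq (by simp)
    simp
  have := hp.eq_zero h0 hx
  linarith

/-- `Y₀ = Im H₀⁽¹⁾` -/
lemma besselY0_eq_im {x : ℝ} (hx : 0 < x) : besselY0 x = (hankelH x).im := by
  have hp : IsBesselPair (fun x => (hankelH x).im - besselY0 x)
      (fun x => (thetaH x).im - thetaY x) := fun x hx => by
    obtain ⟨h1, h2⟩ := isBesselPair_im_hankelH x hx
    obtain ⟨h3, h4⟩ := isBesselPair_Y x hx
    exact ⟨(h1.sub h3).congr_deriv (by ring), (h2.sub h4).congr_deriv (by ring)⟩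
  have h0 : Tendsto (fun x => (hankelH x).im - besselY0 x) (𝓝[>] 0) (𝓝 0) := by
    have := (Complex.continuous_im.tendsto _).comp tendsto_hankelH_sub_log
    refine ((this.sub tendsto_besselY0_sub_log).congr fun x => ?_).trans_eq (by simp)
    simp only [Function.comp_apply, Complex.sub_im, Complex.I_mul_im, Complex.ofReal_re]
    ring
  have := hp.eq_zero h0 hx
  linarith

/-- The modulus bound `J₀² + Y₀² ≤ 2 / (π x)`. -/
lemma bessel_sq_add_sq_le {x : ℝ} (hx : 0 < x) :
    besselJ0 x ^ 2 + besselY0 x ^ 2 ≤ 2 / (π * x) := by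
  refine le_trans (le_of_eq ?_) (normSq_hankelH_le hx)
  rw [← Complex.normSq_eq_norm_sq, Complex.normSq_apply, besselJ0_eq_re hx, besselY0_eq_im hx]
  ring

/-- The leading term of the Hankel function at infinity, from dominated convergence in the rescaled
Laplace integral. -/
lemma tendsto_sqrt_mul_hankelH :
    Tendsto (fun x : ℝ => ((√(π * x) : ℝ) : ℂ) * hankelH x -
      (1 - Complex.I) * Complex.exp (x * Complex.I)) atTop (𝓝 0) := by
  have h1 := tendsto_sqrt_mul_hankelMoment.sub_const ((√π / 4 : ℝ) * (1 + Complex.I))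
  rw [sub_self] at h1
  rw [tendsto_zero_iff_norm_tendsto_zero] at h1 ⊢
  have h2 := h1.const_mul (√π * (4 / π))
  rw [mul_zero] at h2
  refine h2.congr fun x => ?_
  have hπ : (π : ℂ) ≠ 0 := by exact_mod_cast pi_ne_zero
  have e : ((√(π * x) : ℝ) : ℂ) * hankelH x - (1 - Complex.I) * Complex.exp (x * Complex.I) =
      (((√π * (4 / π) : ℝ) : ℂ) * (-Complex.I)) * (Complex.exp (x * Complex.I) *
        (((√x : ℝ) : ℂ) * hankelMoment 0 x - (√π / 4 : ℝ) * (1 + Complex.I))) := by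
    rw [hankelH, Real.sqrt_mul pi_pos.le]
    have hs : ((√π : ℝ) : ℂ) ^ 2 = π := by
      rw [← Complex.ofReal_pow, Real.sq_sqrt pi_pos.le]
    push_cast
    field_simp
    linear_combination (Complex.I * (1 + Complex.I)) * (-hs) - (π : ℂ) * Complex.I_sq
  rw [e, norm_mul, norm_mul, norm_mul, norm_cexp_mul_I, norm_neg, Complex.norm_I,
    Complex.norm_real, Real.norm_of_nonneg (by positivity)]
  ring

lemma tendsto_sqrt_mul_besselJ0 :
    Tendsto (fun x : ℝ => √(π * x) * besselJ0 x - (cos x + sin x)) atTop (𝓝 0) := by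
  have := (Complex.continuous_re.tendsto _).comp tendsto_sqrt_mul_hankelH
  refine (this.congr' ?_).trans_eq (by simp)
  filter_upwards [eventually_gt_atTop 0] with x hx
  rw [besselJ0_eq_re hx, Function.comp_apply, Complex.exp_mul_I, ← Complex.ofReal_cos,
    ← Complex.ofReal_sin]
  simp
  rw [Complex.cos_ofReal_re, Complex.sin_ofReal_re]

lemma tendsto_sqrt_mul_besselY0 :
    Tendsto (fun x : ℝ => √(π * x) * besselY0 x - (sin x - cos x)) atTop (𝓝 0) := by
  have := (Complex.continuous_im.tendsto _).comp tendsto_sqrt_mul_hankelH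
  refine (this.congr' ?_).trans_eq (by simp)
  filter_upwards [eventually_gt_atTop 0] with x hx
  rw [besselY0_eq_im hx, Function.comp_apply, Complex.exp_mul_I, ← Complex.ofReal_cos,
    ← Complex.ofReal_sin]
  simp
  rw [Complex.cos_ofReal_re, Complex.sin_ofReal_re]
  ring

/-! ### The weight and modulus functions -/

lemma continuousOn_J_add_Y : ContinuousOn (fun x => besselJ0 x + besselY0 x) (Ioi 0) :=
  isBesselPair_J.continuousOn.add isBesselPair_Y.continuousOn

lemma exists_J_add_Y_neg : ∃ η : ℝ, 0 < η ∧ ∀ x, 0 < x → x < η → besselJ0 x + besselY0 x < 0 := by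
  have h : Tendsto (fun x => besselJ0 x + besselY0 x) (𝓝[>] 0) atBot :=
    tendsto_besselJ0.add_atBot tendsto_besselY0
  have h2 := h.eventually (eventually_lt_atBot 0)
  obtain ⟨η, hη, h3⟩ := mem_nhdsGT_iff_exists_Ioo_subset.1 h2
  exact ⟨η, hη, fun x hx hx' => h3 ⟨hx, hx'⟩⟩

lemma exists_J_add_Y_pos (X : ℝ) : ∃ x, X < x ∧ 0 < x ∧ 0 < besselJ0 x + besselY0 x := by
  have h := tendsto_sqrt_mul_besselJ0.add tendsto_sqrt_mul_besselY0
  have hseq : Tendsto (fun n : ℕ => π / 2 + n * (2 * π)) atTop atTop :=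
    tendsto_atTop_add_const_left _ _
      (tendsto_natCast_atTop_atTop.atTop_mul_const (by positivity))
  have h2 := h.comp hseq
  rw [add_zero] at h2
  have h3 := h2.eventually (lt_mem_nhds (show (-1 : ℝ) < 0 by norm_num))
  obtain ⟨n, hn, hX⟩ := (h3.and (hseq.eventually (eventually_gt_atTop (max X 0)))).exists
  refine ⟨_, (le_max_left _ _).trans_lt hX, (le_max_right _ _).trans_lt hX, ?_⟩
  simp only [Function.comp_apply] at hn
  rw [Real.sin_add_nat_mul_two_pi, Real.cos_add_nat_mul_two_pi, Real.sin_pi_div_two,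
    Real.cos_pi_div_two] at hn
  set x := π / 2 + n * (2 * π) with hx
  have h5 : 0 < √(π * x) * (besselJ0 x + besselY0 x) := by linarith
  exact pos_of_mul_pos_right h5 (Real.sqrt_nonneg _)

/-- The infimum `X₀` is attained: `J₀ + Y₀` tends to `-∞` at the origin and takes positive values, by
its asymptotic form. -/
lemma besselX0_spec : 0 < besselX0 ∧ besselJ0 besselX0 + besselY0 besselX0 = 0 ∧
    ∀ x, 0 < x → x < besselX0 → besselJ0 x + besselY0 x < 0 := by
  obtain ⟨η, hη, hneg⟩ := exists_J_add_Y_neg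
  have hivt : ∀ x, 0 < x → 0 ≤ besselJ0 x + besselY0 x →
      ∃ c, 0 < c ∧ c ≤ x ∧ besselJ0 c + besselY0 c = 0 := fun x hx hpos => by
    have h1 : min x (η / 2) ≤ x := min_le_left _ _
    have h0 : 0 < min x (η / 2) := lt_min hx (by positivity)
    have h2 := hneg _ h0 ((min_le_right _ _).trans_lt (by linarith))
    obtain ⟨c, hc, hc0⟩ := intermediate_value_Icc h1
      (continuousOn_J_add_Y.mono fun y hy => h0.trans_le hy.1) ⟨h2.le, hpos⟩
    exact ⟨c, h0.trans_le hc.1, hc.2, hc0⟩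
  set S : Set ℝ := {x : ℝ | 0 < x ∧ besselJ0 x + besselY0 x = 0} with hS
  have hSη : ∀ x ∈ S, η ≤ x := fun x hx => by
    by_contra! h
    exact (hneg x hx.1 h).ne hx.2
  have hne : S.Nonempty := by
    obtain ⟨x, -, hx, hp⟩ := exists_J_add_Y_pos 0
    obtain ⟨c, hc, -, hc0⟩ := hivt x hx hp.le
    exact ⟨c, hc, hc0⟩
  have hbdd : BddBelow S := ⟨η, hSη⟩
  have hclosed : IsClosed S := by
    have : S = Ici η ∩ (fun x => besselJ0 x + besselY0 x) ⁻¹' {0} := by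
      ext x
      exact ⟨fun hx => ⟨hSη x hx, hx.2⟩, fun hx => ⟨hη.trans_le hx.1, hx.2⟩⟩
    rw [this]
    exact (continuousOn_J_add_Y.mono fun y hy => hη.trans_le hy).preimage_isClosed_of_isClosed
      isClosed_Ici isClosed_singleton
  have hmem : besselX0 ∈ S := hclosed.csInf_mem hne hbdd
  refine ⟨hmem.1, hmem.2, fun x hx hxX => ?_⟩
  by_contra! h
  obtain ⟨c, hc, hcx, hc0⟩ := hivt x hx h
  exact notMem_of_lt_csInf (hcx.trans_lt hxX) hbdd ⟨hc, hc0⟩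

lemma besselX0_pos : 0 < besselX0 := besselX0_spec.1

lemma J_add_Y_nonpos {x : ℝ} (hx : 0 < x) (hX : x ≤ besselX0) : besselJ0 x + besselY0 x ≤ 0 := by
  rcases hX.eq_or_lt with rfl | h
  · exact besselX0_spec.2.1.le
  · exact (besselX0_spec.2.2 x hx h).le

/-- At a first zero `j ≤ X₀` of `J₀`, the function `x J₀'` is negative because it decreases from
zero, so the Wronskian forces `Y₀(j) > 0`, against `J₀ + Y₀ ≤ 0`. -/
lemma besselJ0_pos {x : ℝ} (hx : 0 ≤ x) (hX : x ≤ besselX0) : 0 < besselJ0 x := by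
  by_contra! hneg
  obtain ⟨c, hc, hc0⟩ := intermediate_value_Icc' hx continuous_besselJ0.continuousOn
    ⟨hneg, by rw [besselJ0_zero]; exact zero_le_one⟩
  have hcomp : IsCompact (Icc 0 x ∩ besselJ0 ⁻¹' {0}) :=
    isCompact_Icc.inter_right (isClosed_singleton.preimage continuous_besselJ0)
  obtain ⟨j, ⟨hj, hj0⟩, hjmin⟩ := hcomp.exists_isLeast ⟨c, hc, hc0⟩
  have hj0' : besselJ0 j = 0 := hj0
  have hjpos : 0 < j := by
    rcases hj.1.eq_or_lt with h | h
    · rw [← h, besselJ0_zero] at hj0'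
      norm_num at hj0'
    · exact h
  have hJ : ∀ t ∈ Ioo 0 j, 0 ≤ besselJ0 t := fun t ht => by
    by_contra! h
    obtain ⟨d, hd, hd0⟩ := intermediate_value_Icc' ht.1.le continuous_besselJ0.continuousOn
      ⟨h.le, by rw [besselJ0_zero]; exact zero_le_one⟩
    have := hjmin ⟨⟨hd.1, (hd.2.trans ht.2.le).trans hj.2⟩, hd0⟩
    linarith [hd.2, ht.2]
  have hanti : AntitoneOn thetaJ (Icc 0 j) := by
    refine antitoneOn_of_deriv_nonpos (convex_Icc _ _) continuous_thetaJ.continuousOn ?_ ?_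
    · rw [interior_Icc]
      exact fun t ht => (isBesselPair_J t ht.1).2.differentiableAt.differentiableWithinAt
    · rw [interior_Icc]
      intro t ht
      rw [(isBesselPair_J t ht.1).2.deriv]
      have := mul_nonneg ht.1.le (hJ t ht)
      linarith
  have h1 := hanti (left_mem_Icc.2 hjpos.le) (right_mem_Icc.2 hjpos.le) hjpos.le
  rw [thetaJ_zero] at h1
  have h2 := bessel_wronskian j
  have h3 := J_add_Y_nonpos hjpos (hj.2.trans hX)
  rw [hj0'] at h2 h3
  have h4 : (0 : ℝ) < 2 / π := by positivity
  nlinarith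

lemma neg_Y_ge_J {x : ℝ} (hx : 0 < x) (hX : x ≤ besselX0) : besselJ0 x ≤ -besselY0 x := by
  linarith [J_add_Y_nonpos hx hX]

lemma neg_Y_pos {x : ℝ} (hx : 0 < x) (hX : x ≤ besselX0) : 0 < -besselY0 x :=
  (besselJ0_pos hx.le hX).trans_le (neg_Y_ge_J hx hX)

lemma bessel_sq_pos (x : ℝ) : 0 < besselJ0 x ^ 2 + besselY0 x ^ 2 := by
  by_contra! h
  have h1 : besselJ0 x = 0 := by nlinarith [sq_nonneg (besselJ0 x), sq_nonneg (besselY0 x)]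
  have h2 : besselY0 x = 0 := by nlinarith [sq_nonneg (besselJ0 x), sq_nonneg (besselY0 x)]
  have h3 := bessel_wronskian x
  rw [h1, h2] at h3
  have : (0 : ℝ) < 2 / π := by positivity
  linarith

lemma weightE0_of_le {x : ℝ} (hX : x ≤ besselX0) : weightE0 x = √(-besselY0 x / besselJ0 x) :=
  if_pos hX

lemma weightE0_of_gt {x : ℝ} (hX : besselX0 < x) : weightE0 x = 1 := if_neg hX.not_ge

lemma modulusM0_of_le {x : ℝ} (hx : 0 < x) (hX : x ≤ besselX0) :
    modulusM0 x = √(2 * (-besselY0 x * besselJ0 x)) := by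
  rw [modulusM0, if_pos hX, abs_of_neg (by linarith [neg_Y_pos hx hX]), mul_assoc]

lemma modulusM0_of_gt {x : ℝ} (hX : besselX0 < x) :
    modulusM0 x = √(besselJ0 x ^ 2 + besselY0 x ^ 2) := if_neg hX.not_ge

lemma weightE0_pos {x : ℝ} (hx : 0 < x) : 0 < weightE0 x := by
  rcases le_or_gt x besselX0 with h | h
  · rw [weightE0_of_le h]
    exact Real.sqrt_pos.2 (div_pos (neg_Y_pos hx h) (besselJ0_pos hx.le h))
  · rw [weightE0_of_gt h]; exact one_pos

lemma modulusM0_pos {x : ℝ} (hx : 0 < x) : 0 < modulusM0 x := by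
  rcases le_or_gt x besselX0 with h | h
  · rw [modulusM0_of_le hx h]
    have := mul_pos (neg_Y_pos hx h) (besselJ0_pos hx.le h)
    positivity
  · rw [modulusM0_of_gt h]; exact Real.sqrt_pos.2 (bessel_sq_pos x)

lemma modulus_div_weight_of_le {x : ℝ} (hx : 0 < x) (hX : x ≤ besselX0) :
    modulusM0 x / weightE0 x = √2 * besselJ0 x := by
  have h1 := besselJ0_pos hx.le hX
  have h2 := neg_Y_pos hx hX
  have h3 : besselY0 x ≠ 0 := by intro h; rw [h] at h2; simp at h2
  rw [modulusM0_of_le hx hX, weightE0_of_le hX, ← Real.sqrt_div (by positivity)]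
  rw [show 2 * (-besselY0 x * besselJ0 x) / (-besselY0 x / besselJ0 x) = 2 * besselJ0 x ^ 2 by
    field_simp, Real.sqrt_mul zero_le_two, Real.sqrt_sq h1.le]

lemma modulus_mul_weight_of_le {x : ℝ} (hx : 0 < x) (hX : x ≤ besselX0) :
    modulusM0 x * weightE0 x = √2 * -besselY0 x := by
  have h1 := besselJ0_pos hx.le hX
  have h2 := neg_Y_pos hx hX
  rw [modulusM0_of_le hx hX, weightE0_of_le hX, ← Real.sqrt_mul (by positivity)]
  rw [show 2 * (-besselY0 x * besselJ0 x) * (-besselY0 x / besselJ0 x) = 2 * (-besselY0 x) ^ 2 by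
    field_simp, Real.sqrt_mul zero_le_two, Real.sqrt_sq h2.le]

lemma modulusM0_sq_le {x : ℝ} (hx : 0 < x) :
    modulusM0 x ^ 2 ≤ besselJ0 x ^ 2 + besselY0 x ^ 2 := by
  rcases le_or_gt x besselX0 with h | h
  · rw [modulusM0_of_le hx h, Real.sq_sqrt (by
      have := mul_pos (neg_Y_pos hx h) (besselJ0_pos hx.le h); positivity)]
    nlinarith [sq_nonneg (besselJ0 x + besselY0 x)]
  · rw [modulusM0_of_gt h, Real.sq_sqrt (bessel_sq_pos x).le]

lemma abs_besselJ0_mul_weight_modulus_le {x : ℝ} (hx : 0 < x) :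
    |besselJ0 x| * weightE0 x * modulusM0 x ≤ besselJ0 x ^ 2 + besselY0 x ^ 2 := by
  rcases le_or_gt x besselX0 with h | h
  · have h1 := besselJ0_pos hx.le h
    have h2 := neg_Y_pos hx h
    rw [mul_assoc, mul_comm (weightE0 x), modulus_mul_weight_of_le hx h, abs_of_pos h1]
    have h3 : √2 ≤ 2 := by
      rw [Real.sqrt_le_left zero_le_two]; norm_num
    have h4 := mul_pos h1 h2
    nlinarith [sq_nonneg (besselJ0 x + besselY0 x), mul_le_mul_of_nonneg_right h3 h4.le]
  · rw [weightE0_of_gt h, modulusM0_of_gt h, mul_one]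
    have h1 : |besselJ0 x| ≤ √(besselJ0 x ^ 2 + besselY0 x ^ 2) := by
      refine Real.abs_le_sqrt ?_
      nlinarith [sq_nonneg (besselY0 x)]
    have h2 := Real.mul_self_sqrt (bessel_sq_pos x).le
    nlinarith [Real.sqrt_nonneg (besselJ0 x ^ 2 + besselY0 x ^ 2)]

/-- The kernel of the Volterra equation is dominated by a product; this is where the monotonicity
of the weight function `E₀` enters. -/
lemma bessel_kernel_le {x y : ℝ} (hy : 0 < y) (hyx : y ≤ x) :
    |besselJ0 x * besselY0 y - besselY0 x * besselJ0 y| ≤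
      modulusM0 x / weightE0 x * (modulusM0 y * weightE0 y) := by
  have hx := hy.trans_le hyx
  have hCS : |besselJ0 x * besselY0 y - besselY0 x * besselJ0 y| ≤
      √(besselJ0 x ^ 2 + besselY0 x ^ 2) * √(besselJ0 y ^ 2 + besselY0 y ^ 2) := by
    rw [← Real.sqrt_mul (by positivity)]
    refine Real.abs_le_sqrt ?_
    nlinarith [sq_nonneg (besselJ0 x * besselJ0 y + besselY0 x * besselY0 y)]
  rcases le_or_gt x besselX0 with h | h
  · have hy' := hyx.trans h
    rw [modulus_div_weight_of_le hx h, modulus_mul_weight_of_le hy hy']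
    have h1 := besselJ0_pos hx.le h
    have h2 := neg_Y_pos hx h
    have h3 := besselJ0_pos hy.le hy'
    have h4 := neg_Y_pos hy hy'
    have hmono : MonotoneOn (fun t => besselY0 t / besselJ0 t) (Icc y x) := by
      have hd : ∀ t ∈ Icc y x, HasDerivAt (fun t => besselY0 t / besselJ0 t)
          (2 / π / (t * besselJ0 t ^ 2)) t := fun t ht => by
        have ht0 := hy.trans_le ht.1
        have hJ := besselJ0_pos ht0.le (ht.2.trans h)
        refine ((isBesselPair_Y t ht0).1.div (isBesselPair_J t ht0).1 hJ.ne').congr_deriv ?_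
        have := bessel_wronskian t
        rw [← this]
        field_simp
      refine monotoneOn_of_deriv_nonneg (convex_Icc _ _)
        (fun t ht => (hd t ht).continuousAt.continuousWithinAt) ?_ ?_
      · exact fun t ht => (hd t (interior_subset ht)).differentiableAt.differentiableWithinAt
      · intro t ht
        rw [(hd t (interior_subset ht)).deriv]
        have ht0 := hy.trans_le (interior_subset ht).1
        positivity
    have h5 := hmono (left_mem_Icc.2 hyx) (right_mem_Icc.2 hyx) hyx
    simp only at h5
    rw [div_le_div_iff₀ h3 h1] at h5
    have h6 : √2 * besselJ0 x * (√2 * -besselY0 y) = 2 * (besselJ0 x * -besselY0 y) := by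
      have := Real.mul_self_sqrt (zero_le_two (α := ℝ))
      linear_combination (besselJ0 x * -besselY0 y) * this
    rw [h6, abs_le]
    constructor <;> nlinarith [mul_pos h1 h4, mul_pos h2 h3]
  · rw [weightE0_of_gt h, modulusM0_of_gt h, div_one]
    refine hCS.trans ?_
    gcongr
    rcases le_or_gt y besselX0 with h' | h'
    · rw [modulus_mul_weight_of_le hy h']
      have h3 := besselJ0_pos hy.le h'
      have h4 := neg_Y_pos hy h'
      have h5 := neg_Y_ge_J hy h'
      rw [← Real.sqrt_sq h4.le, ← Real.sqrt_mul zero_le_two]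
      refine Real.sqrt_le_sqrt ?_
      nlinarith
    · rw [weightE0_of_gt h', modulusM0_of_gt h', mul_one]

lemma lambda00Set_le {y : ℝ} (hy : y ∈ lambda00Set) : y ≤ 2 := by
  obtain ⟨x, hx, rfl⟩ := hy
  have hx' : (0 : ℝ) < x := hx
  have h := (modulusM0_sq_le hx').trans (bessel_sq_add_sq_le hx')
  calc π * x * modulusM0 x ^ 2 ≤ π * x * (2 / (π * x)) := by gcongr
    _ = 2 := by field_simp

lemma lambda01Set_le {y : ℝ} (hy : y ∈ lambda01Set) : y ≤ 2 := by
  obtain ⟨x, hx, rfl⟩ := hy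
  have hx' : (0 : ℝ) < x := hx
  have h := (abs_besselJ0_mul_weight_modulus_le hx').trans (bessel_sq_add_sq_le hx')
  calc π * x * (|besselJ0 x| * weightE0 x * modulusM0 x) ≤ π * x * (2 / (π * x)) := by gcongr
    _ = 2 := by field_simp

lemma bddAbove_lambda00Set : BddAbove lambda00Set := ⟨2, fun _ h => lambda00Set_le h⟩

lemma bddAbove_lambda01Set : BddAbove lambda01Set := ⟨2, fun _ h => lambda01Set_le h⟩

lemma le_lambda00 {x : ℝ} (hx : 0 < x) : π * x * modulusM0 x ^ 2 ≤ lambda00 :=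
  le_csSup bddAbove_lambda00Set ⟨x, hx, rfl⟩

lemma le_lambda01 {x : ℝ} (hx : 0 < x) :
    π * x * (|besselJ0 x| * weightE0 x * modulusM0 x) ≤ lambda01 :=
  le_csSup bddAbove_lambda01Set ⟨x, hx, rfl⟩

lemma lambda00_pos : 0 < lambda00 := by
  refine lt_of_lt_of_le ?_ (le_lambda00 one_pos)
  have := modulusM0_pos one_pos
  positivity

lemma lambda01_nonneg : 0 ≤ lambda01 := by
  refine le_trans ?_ (le_lambda01 one_pos)
  have := modulusM0_pos one_pos
  have := weightE0_pos one_pos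
  positivity

lemma tendsto_mul_modulusM0_sq :
    Tendsto (fun x => π * x * modulusM0 x ^ 2) atTop (𝓝 2) := by
  have hb : ∀ (c : ℝ → ℝ) (F : ℝ → ℝ), (∀ x, |c x| ≤ 2) → Tendsto (fun x => F x - c x) atTop (𝓝 0) →
      Tendsto (fun x => F x ^ 2 - c x ^ 2) atTop (𝓝 0) := fun c F hc hF => by
    have h1 : Tendsto (fun x => (F x - c x) * c x) atTop (𝓝 0) := by
      refine hF.zero_mul_isBoundedUnder_le ⟨2, eventually_map.2 (Eventually.of_forall hc)⟩
    have h2 := (hF.mul hF).add (h1.const_mul 2)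
    refine (h2.congr fun x => by ring).trans_eq (by simp)
  have hJ := hb (fun x => cos x + sin x) (fun x => √(π * x) * besselJ0 x) (fun x => by
    have h1 := abs_add_le (cos x) (sin x)
    have h2 := abs_cos_le_one x
    have h3 := abs_sin_le_one x
    linarith) tendsto_sqrt_mul_besselJ0
  have hY := hb (fun x => sin x - cos x) (fun x => √(π * x) * besselY0 x) (fun x => by
    have h1 := abs_sub (sin x) (cos x)
    have h2 := abs_cos_le_one x
    have h3 := abs_sin_le_one x
    linarith) tendsto_sqrt_mul_besselY0
  have h := (hJ.add hY).add_const 2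
  refine (h.congr' ?_).trans_eq (by simp)
  filter_upwards [eventually_gt_atTop besselX0] with x hx
  have hx0 := besselX0_pos.trans hx
  rw [modulusM0_of_gt hx, Real.sq_sqrt (bessel_sq_pos x).le, mul_pow, mul_pow,
    Real.sq_sqrt (by positivity)]
  linear_combination (-2 : ℝ) * Real.sin_sq_add_cos_sq x

/-! ### The Liouville transformation -/

lemma coefF_eq (a : ℝ) {z : ℝ} (hz : 1 < z) : coefF a 0 z = (z - a) / (z ^ 2 - 1) := by
  have : 0 < z ^ 2 - 1 := by nlinarith
  rw [coefF]
  field_simp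
  ring

lemma coefF_pos {a : ℝ} (ha1 : a < 1) {z : ℝ} (hz : 1 < z) : 0 < coefF a 0 z := by
  rw [coefF_eq a hz]
  exact div_pos (by linarith) (by nlinarith)

/-- `√f`. -/
noncomputable def sqrtF (a z : ℝ) : ℝ := √(coefF a 0 z)

lemma sqrtF_pos {a : ℝ} (ha1 : a < 1) {z : ℝ} (hz : 1 < z) : 0 < sqrtF a z :=
  Real.sqrt_pos.2 (coefF_pos ha1 hz)

lemma sqrtF_sq {a : ℝ} (ha1 : a < 1) {z : ℝ} (hz : 1 < z) :
    sqrtF a z ^ 2 = (z - a) / (z ^ 2 - 1) := by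
  rw [sqrtF, Real.sq_sqrt (coefF_pos ha1 hz).le, coefF_eq a hz]

lemma sqrtF_sq_mul {a : ℝ} (ha1 : a < 1) {z : ℝ} (hz : 1 < z) :
    sqrtF a z ^ 2 * (z ^ 2 - 1) = z - a := by
  have : 0 < z ^ 2 - 1 := by nlinarith
  rw [sqrtF_sq ha1 hz]
  field_simp

lemma hasDerivAt_coefF (a : ℝ) {z : ℝ} (hz : 1 < z) :
    HasDerivAt (coefF a 0) (((z ^ 2 - 1) - (z - a) * (2 * z)) / (z ^ 2 - 1) ^ 2) z := by
  have h0 : z ^ 2 - 1 ≠ 0 := by nlinarith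
  have h1 : HasDerivAt (fun z => (z - a) / (z ^ 2 - 1))
      (((z ^ 2 - 1) - (z - a) * (2 * z)) / (z ^ 2 - 1) ^ 2) z := by
    refine (((hasDerivAt_id z).sub_const a).div ((hasDerivAt_pow 2 z).sub_const 1) h0).congr_deriv ?_
    simp
  refine h1.congr_of_eventuallyEq ?_
  filter_upwards [Ioi_mem_nhds hz] with t ht
  exact coefF_eq a ht

lemma iteratedDeriv_two_coefF (a : ℝ) {z : ℝ} (hz : 1 < z) :
    iteratedDeriv 2 (coefF a 0) z =
      (2 * a - 2 * z) / (z ^ 2 - 1) ^ 2 + 4 * z * (z ^ 2 - 2 * a * z + 1) / (z ^ 2 - 1) ^ 3 := by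
  have h0 : z ^ 2 - 1 ≠ 0 := by nlinarith
  rw [iteratedDeriv_succ, iteratedDeriv_one]
  have h1 : deriv (coefF a 0) =ᶠ[𝓝 z]
      fun z => ((z ^ 2 - 1) - (z - a) * (2 * z)) / (z ^ 2 - 1) ^ 2 := by
    filter_upwards [Ioi_mem_nhds hz] with t ht
    exact (hasDerivAt_coefF a ht).deriv
  rw [h1.deriv_eq]
  have hp := (hasDerivAt_pow 2 z).sub_const 1
  have h2 := ((hp.sub (((hasDerivAt_id z).sub_const a).mul ((hasDerivAt_id z).const_mul 2))).div
    (hp.pow 2) (pow_ne_zero 2 h0))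
  refine (h2.congr_deriv (f' := _) ?_).deriv
  simp only [id, Pi.pow_apply, Pi.sub_apply, Pi.mul_apply]
  push_cast
  field_simp
  ring

lemma hasDerivAt_sqrtF {a : ℝ} (ha1 : a < 1) {z : ℝ} (hz : 1 < z) :
    HasDerivAt (sqrtF a)
      (sqrtF a z * (1 / (2 * (z - a)) - z / (z ^ 2 - 1))) z := by
  have h0 : 0 < z ^ 2 - 1 := by nlinarith
  have h3 : 0 < z - a := by linarith
  refine ((hasDerivAt_coefF a hz).sqrt (coefF_pos ha1 hz).ne').congr_deriv ?_
  have h1 := sqrtF_pos ha1 hz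
  have h2 := sqrtF_sq_mul ha1 hz
  change _ / (2 * sqrtF a z) = _
  field_simp
  linear_combination (-(z ^ 2 - 1 - z * (z - a) * 2)) * h2

lemma continuousOn_sqrtF {a : ℝ} (ha1 : a < 1) : ContinuousOn (sqrtF a) (Ioi 1) := fun _ hz =>
  (hasDerivAt_sqrtF ha1 hz).continuousAt.continuousWithinAt

lemma rpow_neg_half {x : ℝ} (hx : 0 < x) : x ^ (-(1 / 2) : ℝ) = (√x)⁻¹ := by
  rw [Real.rpow_neg hx.le, Real.sqrt_eq_rpow]

lemma integral_inv_sqrt (z : ℝ) :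
    ∫ t in (1 : ℝ)..z, (t - 1) ^ (-(1 / 2) : ℝ) = 2 * √(z - 1) := by
  rw [intervalIntegral.integral_comp_sub_right (fun t => t ^ (-(1 / 2) : ℝ)) 1,
    integral_rpow (Or.inl (by norm_num))]
  norm_num
  rw [Real.sqrt_eq_rpow]
  ring

lemma intervalIntegrable_inv_sqrt (z : ℝ) :
    IntervalIntegrable (fun t : ℝ => (t - 1) ^ (-(1 / 2) : ℝ)) volume 1 z := by
  have := (intervalIntegral.intervalIntegrable_rpow' (a := 0) (b := z - 1)
    (r := -(1 / 2)) (by norm_num)).comp_sub_right 1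
  simpa using this

lemma coefF_eq_mul (a : ℝ) {z : ℝ} (hz : 1 < z) :
    coefF a 0 z = ((z - a) / (z + 1)) * (z - 1)⁻¹ := by
  rw [coefF_eq a hz]
  have h1 : 0 < z - 1 := by linarith
  have h2 : 0 < z + 1 := by linarith
  have h3 : z ^ 2 - 1 = (z - 1) * (z + 1) := by ring
  rw [h3]
  field_simp

lemma sqrtF_eq_mul {a : ℝ} (ha1 : a < 1) {z : ℝ} (hz : 1 < z) :
    sqrtF a z = √((z - a) / (z + 1)) * (z - 1) ^ (-(1 / 2) : ℝ) := by
  rw [sqrtF, coefF_eq_mul a hz, Real.sqrt_mul (div_pos (by linarith) (by linarith)).le,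
    rpow_neg_half (by linarith), Real.sqrt_inv]

lemma sqrtF_le {a : ℝ} (ha0 : 0 ≤ a) (ha1 : a < 1) {z : ℝ} (hz : 1 < z) :
    sqrtF a z ≤ (z - 1) ^ (-(1 / 2) : ℝ) := by
  rw [sqrtF_eq_mul ha1 hz]
  refine mul_le_of_le_one_left (Real.rpow_nonneg (by linarith) _) ?_
  rw [Real.sqrt_le_one, div_le_one (by linarith)]
  linarith

lemma intervalIntegrable_sqrtF {a : ℝ} (ha0 : 0 ≤ a) (ha1 : a < 1) {z : ℝ} (hz : 1 < z) :
    IntervalIntegrable (sqrtF a) volume 1 z := by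
  have h := intervalIntegrable_inv_sqrt z
  rw [intervalIntegrable_iff_integrableOn_Ioc_of_le hz.le] at h ⊢
  refine Integrable.mono' h (((continuousOn_sqrtF ha1).mono fun t ht => ht.1).aestronglyMeasurable
    measurableSet_Ioc) ?_
  filter_upwards [ae_restrict_mem measurableSet_Ioc] with t ht
  rw [Real.norm_of_nonneg (sqrtF_pos ha1 ht.1).le]
  exact sqrtF_le ha0 ha1 ht.1

lemma phaseInt_eq (a z : ℝ) : phaseInt a z = ∫ t in (1 : ℝ)..z, sqrtF a t := rfl

lemma hasDerivAt_phaseInt {a : ℝ} (ha0 : 0 ≤ a) (ha1 : a < 1) {z : ℝ} (hz : 1 < z) :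
    HasDerivAt (phaseInt a) (sqrtF a z) z := by
  refine intervalIntegral.integral_hasDerivAt_right (intervalIntegrable_sqrtF ha0 ha1 hz) ?_
    (hasDerivAt_sqrtF ha1 hz).continuousAt
  exact (continuousOn_sqrtF ha1).stronglyMeasurableAtFilter isOpen_Ioi z hz

lemma le_phaseInt {a : ℝ} (ha0 : 0 ≤ a) (ha1 : a < 1) {z : ℝ} (hz : 1 < z) :
    √((1 - a) / 2) * (2 * √(z - 1)) ≤ phaseInt a z := by
  rw [phaseInt_eq, ← integral_inv_sqrt z, ← intervalIntegral.integral_const_mul]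
  refine intervalIntegral.integral_mono_on_of_le_Ioo hz.le
    ((intervalIntegrable_inv_sqrt z).const_mul _) (intervalIntegrable_sqrtF ha0 ha1 hz) ?_
  intro t ht
  rw [sqrtF_eq_mul ha1 ht.1]
  have h1 : 0 < t - 1 := by linarith [ht.1]
  gcongr √?_ * _
  rw [div_le_div_iff₀ two_pos (by linarith)]
  nlinarith

lemma phaseInt_le {a : ℝ} (ha0 : 0 ≤ a) (ha1 : a < 1) {z : ℝ} (hz : 1 < z) :
    phaseInt a z ≤ √((z - a) / (z + 1)) * (2 * √(z - 1)) := by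
  rw [phaseInt_eq, ← integral_inv_sqrt z, ← intervalIntegral.integral_const_mul]
  refine intervalIntegral.integral_mono_on_of_le_Ioo hz.le
    (intervalIntegrable_sqrtF ha0 ha1 hz) ((intervalIntegrable_inv_sqrt z).const_mul _) ?_
  intro t ht
  rw [sqrtF_eq_mul ha1 ht.1]
  have h1 : 0 < t - 1 := by linarith [ht.1]
  gcongr √?_ * _
  rw [div_le_div_iff₀ (by linarith) (by linarith)]
  nlinarith [ht.2]

lemma phaseInt_pos {a : ℝ} (ha0 : 0 ≤ a) (ha1 : a < 1) {z : ℝ} (hz : 1 < z) :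
    0 < phaseInt a z := by
  refine lt_of_lt_of_le ?_ (le_phaseInt ha0 ha1 hz)
  have h1 : 0 < √((1 - a) / 2) := Real.sqrt_pos.2 (by linarith)
  have h2 : 0 < √(z - 1) := Real.sqrt_pos.2 (by linarith)
  positivity

/-- The two-sided bounds for the Liouville variable that control the transformed equation at both
ends of the interval. -/
lemma phaseInt_sq_bounds {a : ℝ} (ha0 : 0 ≤ a) (ha1 : a < 1) {z : ℝ} (hz : 1 < z) :
    2 * (1 - a) * (z - 1) ≤ phaseInt a z ^ 2 ∧
      phaseInt a z ^ 2 * (z + 1) ≤ 4 * (z - 1) * (z - a) := by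
  have h0 := phaseInt_pos ha0 ha1 hz
  have h1 := le_phaseInt ha0 ha1 hz
  have h2 := phaseInt_le ha0 ha1 hz
  have hz1 : 0 < z - 1 := by linarith
  have hz2 : 0 < z + 1 := by linarith
  have hN : 0 < z - a := by linarith
  constructor
  · have := pow_le_pow_left₀ (by positivity) h1 2
    rw [mul_pow, mul_pow, Real.sq_sqrt (by linarith), Real.sq_sqrt hz1.le] at this
    linarith
  · have := pow_le_pow_left₀ h0.le h2 2
    rw [mul_pow, mul_pow, Real.sq_sqrt (by positivity), Real.sq_sqrt hz1.le] at this
    calc phaseInt a z ^ 2 * (z + 1) ≤ ((z - a) / (z + 1) * (2 ^ 2 * (z - 1))) * (z + 1) := by gcongr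
      _ = _ := by field_simp; ring

lemma tendsto_phaseInt_one {a : ℝ} (ha0 : 0 ≤ a) (ha1 : a < 1) :
    Tendsto (phaseInt a) (𝓝[>] 1) (𝓝 0) := by
  have h : Tendsto (fun z : ℝ => 2 * √(z - 1)) (𝓝[>] 1) (𝓝 0) := by
    have : Continuous fun z : ℝ => 2 * √(z - 1) := by fun_prop
    simpa using (this.tendsto 1).mono_left nhdsWithin_le_nhds
  refine squeeze_zero' ?_ ?_ h
  · filter_upwards [self_mem_nhdsWithin] with z hz
    exact (phaseInt_pos ha0 ha1 hz).le
  · filter_upwards [self_mem_nhdsWithin] with z hz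
    have hz' : 1 < z := hz
    refine (phaseInt_le ha0 ha1 hz').trans (mul_le_of_le_one_left (by positivity) ?_)
    rw [Real.sqrt_le_one, div_le_one (by linarith)]
    linarith

lemma tendsto_phaseInt_atTop {a : ℝ} (ha0 : 0 ≤ a) (ha1 : a < 1) :
    Tendsto (phaseInt a) atTop atTop := by
  have h1 : 0 < √((1 - a) / 2) := Real.sqrt_pos.2 (by linarith)
  have h : Tendsto (fun z : ℝ => √((1 - a) / 2) * (2 * √(z - 1))) atTop atTop := by
    refine Tendsto.const_mul_atTop h1 (Tendsto.const_mul_atTop two_pos ?_)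
    exact Real.tendsto_sqrt_atTop.comp (tendsto_atTop_add_const_right _ _ tendsto_id)
  refine tendsto_atTop_mono' _ ?_ h
  filter_upwards [eventually_gt_atTop 1] with z hz
  exact le_phaseInt ha0 ha1 hz

lemma strictMonoOn_phaseInt {a : ℝ} (ha0 : 0 ≤ a) (ha1 : a < 1) :
    StrictMonoOn (phaseInt a) (Ioi 1) := by
  refine strictMonoOn_of_deriv_pos (convex_Ioi 1)
    (fun z hz => (hasDerivAt_phaseInt ha0 ha1 hz).continuousAt.continuousWithinAt) fun z hz => ?_
  rw [interior_Ioi] at hz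
  rw [(hasDerivAt_phaseInt ha0 ha1 hz).deriv]
  exact sqrtF_pos ha1 hz

lemma continuousOn_phaseInt {a : ℝ} (ha0 : 0 ≤ a) (ha1 : a < 1) :
    ContinuousOn (phaseInt a) (Ioi 1) := fun _ hz =>
  (hasDerivAt_phaseInt ha0 ha1 hz).continuousAt.continuousWithinAt

lemma exists_phaseInt_eq {a : ℝ} (ha0 : 0 ≤ a) (ha1 : a < 1) {x : ℝ} (hx : 0 < x) :
    ∃ z, 1 < z ∧ phaseInt a z = x := by
  obtain ⟨z₁, h1, hz1⟩ := (((tendsto_phaseInt_one ha0 ha1).eventually (gt_mem_nhds hx)).and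
    self_mem_nhdsWithin).exists
  obtain ⟨z₂, h2, hz2⟩ := (((tendsto_phaseInt_atTop ha0 ha1).eventually (eventually_gt_atTop x)).and
    (eventually_gt_atTop z₁)).exists
  obtain ⟨z, hz, hzx⟩ := intermediate_value_Icc hz2.le
    ((continuousOn_phaseInt ha0 ha1).mono fun t ht => lt_of_lt_of_le hz1 ht.1) ⟨h1.le, h2.le⟩
  exact ⟨z, lt_of_lt_of_le hz1 hz.1, hzx⟩

lemma zetaOf_neg {a : ℝ} (ha0 : 0 ≤ a) (ha1 : a < 1) {z : ℝ} (hz : 1 < z) : zetaOf a z < 0 := by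
  have := phaseInt_pos ha0 ha1 hz
  rw [zetaOf]
  nlinarith

lemma sqrt_abs_zetaOf {a : ℝ} (ha0 : 0 ≤ a) (ha1 : a < 1) {z : ℝ} (hz : 1 < z) :
    √|zetaOf a z| = phaseInt a z := by
  rw [zetaOf, abs_neg, abs_of_nonneg (sq_nonneg _), Real.sqrt_sq (phaseInt_pos ha0 ha1 hz).le]

lemma strictAntiOn_zetaOf {a : ℝ} (ha0 : 0 ≤ a) (ha1 : a < 1) :
    StrictAntiOn (zetaOf a) (Ioi 1) := fun x hx y hy hxy => by
  have h1 := strictMonoOn_phaseInt ha0 ha1 hx hy hxy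
  have h2 := phaseInt_pos ha0 ha1 hx
  simp only [zetaOf]
  nlinarith

lemma injOn_zetaOf {a : ℝ} (ha0 : 0 ≤ a) (ha1 : a < 1) : InjOn (zetaOf a) (Ioi 1) :=
  (strictAntiOn_zetaOf ha0 ha1).injOn

lemma zOf_zetaOf {a : ℝ} (ha0 : 0 ≤ a) (ha1 : a < 1) {z : ℝ} (hz : 1 < z) :
    zOf a (zetaOf a z) = z :=
  (injOn_zetaOf ha0 ha1).leftInvOn_invFunOn hz

lemma exists_zetaOf_eq {a : ℝ} (ha0 : 0 ≤ a) (ha1 : a < 1) {ζ : ℝ} (hζ : ζ < 0) :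
    ∃ z, 1 < z ∧ zetaOf a z = ζ := by
  obtain ⟨z, hz, h⟩ := exists_phaseInt_eq ha0 ha1 (Real.sqrt_pos.2 (neg_pos.2 hζ))
  refine ⟨z, hz, ?_⟩
  rw [zetaOf, h, Real.sq_sqrt (by linarith), neg_neg]

lemma image_zetaOf_Ioi {a : ℝ} (ha0 : 0 ≤ a) (ha1 : a < 1) : zetaOf a '' Ioi 1 = Iio 0 := by
  ext ζ
  constructor
  · rintro ⟨z, hz, rfl⟩
    exact zetaOf_neg ha0 ha1 hz
  · intro hζ
    obtain ⟨z, hz, rfl⟩ := exists_zetaOf_eq ha0 ha1 hζ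
    exact ⟨z, hz, rfl⟩

lemma image_zetaOf_Ioo {a : ℝ} (ha0 : 0 ≤ a) (ha1 : a < 1) {z : ℝ} (hz : 1 < z) :
    zetaOf a '' Ioo 1 z = Ioo (zetaOf a z) 0 := by
  ext ζ
  constructor
  · rintro ⟨t, ht, rfl⟩
    exact ⟨strictAntiOn_zetaOf ha0 ha1 ht.1 hz ht.2, zetaOf_neg ha0 ha1 ht.1⟩
  · intro hζ
    obtain ⟨t, ht, rfl⟩ := exists_zetaOf_eq ha0 ha1 hζ.2
    exact ⟨t, ⟨ht, (strictAntiOn_zetaOf ha0 ha1).lt_iff_gt hz ht |>.1 hζ.1⟩, rfl⟩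

lemma hasDerivAt_zetaOf {a : ℝ} (ha0 : 0 ≤ a) (ha1 : a < 1) {z : ℝ} (hz : 1 < z) :
    HasDerivAt (zetaOf a) (-(2 * phaseInt a z * sqrtF a z)) z := by
  refine ((hasDerivAt_phaseInt ha0 ha1 hz).pow 2).neg.congr_deriv ?_
  norm_num

lemma abs_deriv_zetaOf {a : ℝ} (ha0 : 0 ≤ a) (ha1 : a < 1) {z : ℝ} (hz : 1 < z) :
    |-(2 * phaseInt a z * sqrtF a z)| = 2 * phaseInt a z * sqrtF a z := by
  have h1 := phaseInt_pos ha0 ha1 hz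
  have h2 := sqrtF_pos ha1 hz
  rw [abs_neg, abs_of_pos (by positivity)]

lemma tendsto_zetaOf {a : ℝ} (ha0 : 0 ≤ a) (ha1 : a < 1) : Tendsto (zetaOf a) atTop atBot :=
  tendsto_neg_atTop_atBot.comp ((tendsto_pow_atTop two_ne_zero).comp
    (tendsto_phaseInt_atTop ha0 ha1))

/-- Limits as `ζ → -∞` are limits as `z → ∞`. -/
lemma tendsto_atBot_iff_zetaOf {a : ℝ} (ha0 : 0 ≤ a) (ha1 : a < 1) {F : ℝ → ℝ} {l : Filter ℝ} :
    Tendsto F atBot l ↔ Tendsto (fun z => F (zetaOf a z)) atTop l := by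
  refine ⟨fun h => h.comp (tendsto_zetaOf ha0 ha1), fun h => ?_⟩
  have hz : Tendsto (zOf a) atBot atTop := by
    refine tendsto_atTop.2 fun b => ?_
    set c := max b 2
    have hc : 1 < c := lt_of_lt_of_le one_lt_two (le_max_right _ _)
    filter_upwards [eventually_lt_atBot (zetaOf a c)] with ζ hζ
    obtain ⟨z, hz, rfl⟩ := exists_zetaOf_eq ha0 ha1 (hζ.trans (zetaOf_neg ha0 ha1 hc))
    rw [zOf_zetaOf ha0 ha1 hz]
    exact (le_max_left _ _).trans ((strictAntiOn_zetaOf ha0 ha1).lt_iff_gt hz hc |>.1 hζ).le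
  refine (h.comp hz).congr' ?_
  filter_upwards [eventually_lt_atBot 0] with ζ hζ
  obtain ⟨z, hz, rfl⟩ := exists_zetaOf_eq ha0 ha1 hζ
  simp only [Function.comp_apply]
  rw [zOf_zetaOf ha0 ha1 hz]

/-! ### The perturbation term -/

/-- The function `ψ` in terms of `z`. -/
noncomputable def psiZ (a z : ℝ) : ℝ :=
  -(1 / 64) * (4 / phaseInt a z ^ 2 - 4 / ((z - a) * (z ^ 2 - 1)) - 5 * (z ^ 2 - 1) / (z - a) ^ 3 +
    4 / (z - a) + 4 * z / (z - a) ^ 2)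

lemma psi_zetaOf {a : ℝ} (ha0 : 0 ≤ a) (ha1 : a < 1) {z : ℝ} (hz : 1 < z) :
    psi a (zetaOf a z) = psiZ a z := by
  have h0 : 0 < z ^ 2 - 1 := by nlinarith
  have h3 : 0 < z - a := by linarith
  have h1 := phaseInt_pos ha0 ha1 hz
  rw [psi, zOf_zetaOf ha0 ha1 hz, iteratedDeriv_two_coefF a hz, (hasDerivAt_coefF a hz).deriv,
    coefF_eq a hz, coefG, zetaOf, psiZ]
  field_simp
  ring

/-- Near `z = 1` the poles of `4/ξ²` and `4/((z - a)(z² - 1))` cancel, because `ξ² ≈ 2 (1 - a)(z - 1)`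
within the bounds of `phaseInt_sq_bounds`. -/
lemma abs_psiZ_le {a : ℝ} (ha0 : 0 ≤ a) (ha1 : a < 1) {z : ℝ} (hz : 1 < z) :
    |psiZ a z| ≤ 1 / ((1 - a) ^ 3 * z) := by
  have hD : 0 < z ^ 2 - 1 := by nlinarith
  have hN : 0 < z - a := by linarith
  have hX := phaseInt_pos ha0 ha1 hz
  have hz0 : 0 < z := by linarith
  have hz1 : 0 < z - 1 := by linarith
  set c := 1 - a with hc
  have hc0 : 0 < c := by linarith
  have hc1 : c ≤ 1 := by linarith
  obtain ⟨hb1, hb2⟩ := phaseInt_sq_bounds ha0 ha1 hz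
  have hNz : c * z ≤ z - a := by rw [hc]; nlinarith
  have hcc : c ^ 3 ≤ c ^ 2 := pow_le_pow_of_le_one hc0.le hc1 (by norm_num)
  have hcc' : c ^ 3 ≤ c := by simpa using pow_le_pow_of_le_one hc0.le hc1 (show 1 ≤ 3 by norm_num)
  have t1 : 0 ≤ 4 / phaseInt a z ^ 2 - 4 / ((z - a) * (z ^ 2 - 1)) := by
    rw [sub_nonneg]
    gcongr
    have h4 : phaseInt a z ^ 2 * (z + 1) ≤ ((z - a) * (z ^ 2 - 1)) * (z + 1) := by
      refine hb2.trans ?_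
      have : 4 ≤ (z + 1) ^ 2 := by nlinarith
      have h5 : 0 < (z - 1) * (z - a) := mul_pos hz1 hN
      nlinarith
    exact le_of_mul_le_mul_right h4 (by linarith)
  have t1' : 4 / phaseInt a z ^ 2 - 4 / ((z - a) * (z ^ 2 - 1)) ≤ 4 / (c ^ 3 * z) := by
    have h4 : 4 / phaseInt a z ^ 2 ≤ 4 / (2 * c * (z - 1)) := by gcongr
    have h5 : 4 / (2 * c * (z - 1)) - 4 / ((z - a) * (z ^ 2 - 1)) =
        2 * (z + 2 - a) / (c * (z + 1) * (z - a)) := by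
      rw [show z ^ 2 - 1 = (z - 1) * (z + 1) by ring]
      have : 0 < z + 1 := by linarith
      field_simp
      rw [hc]
      ring
    have h6 : 2 * (z + 2 - a) / (c * (z + 1) * (z - a)) ≤ 4 / (c ^ 3 * z) := by
      have h7 : 2 * (z + 2 - a) / (c * (z + 1) * (z - a)) ≤
          2 * (2 * (z + 1)) / (c * (z + 1) * (c * z)) := by
        gcongr
        linarith
      refine h7.trans ?_
      have : 0 < z + 1 := by linarith
      rw [show 2 * (2 * (z + 1)) / (c * (z + 1) * (c * z)) = 4 / (c ^ 2 * z) by field_simp; norm_num]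
      gcongr
    linarith
  have t2 : 4 / (z - a) ≤ 4 / (c ^ 3 * z) := by
    gcongr
    nlinarith
  have t3 : 4 * z / (z - a) ^ 2 ≤ 4 / (c ^ 3 * z) := by
    calc 4 * z / (z - a) ^ 2 ≤ 4 * z / (c * z) ^ 2 := by gcongr
      _ = 4 / (c ^ 2 * z) := by field_simp
      _ ≤ _ := by gcongr
  have t4 : 5 * (z ^ 2 - 1) / (z - a) ^ 3 ≤ 5 / (c ^ 3 * z) := by
    calc 5 * (z ^ 2 - 1) / (z - a) ^ 3 ≤ 5 * z ^ 2 / (c * z) ^ 3 := by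
          gcongr
          linarith
      _ = 5 / (c ^ 3 * z) := by field_simp
  have t2' : 0 < 4 / (z - a) := by positivity
  have t3' : 0 < 4 * z / (z - a) ^ 2 := by positivity
  have t4' : 0 < 5 * (z ^ 2 - 1) / (z - a) ^ 3 := by positivity
  have e4 : 4 / (c ^ 3 * z) = 4 * (1 / (c ^ 3 * z)) := by ring
  have e5 : 5 / (c ^ 3 * z) = 5 * (1 / (c ^ 3 * z)) := by ring
  have e0 : 0 < 1 / (c ^ 3 * z) := by positivity
  rw [e4] at t1' t2 t3
  rw [e5] at t4
  rw [psiZ, abs_le]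
  constructor <;> linarith

lemma continuousOn_psiZ {a : ℝ} (ha0 : 0 ≤ a) (ha1 : a < 1) : ContinuousOn (psiZ a) (Ioi 1) := by
  have hX := continuousOn_phaseInt ha0 ha1
  have h1 : ∀ z ∈ Ioi (1 : ℝ), phaseInt a z ^ 2 ≠ 0 := fun z hz =>
    (pow_pos (phaseInt_pos ha0 ha1 hz) 2).ne'
  have h2 : ∀ z ∈ Ioi (1 : ℝ), z - a ≠ 0 := fun z hz => by
    have : (1 : ℝ) < z := hz
    linarith
  have h3 : ∀ z ∈ Ioi (1 : ℝ), (z - a) * (z ^ 2 - 1) ≠ 0 := fun z hz => by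
    have : (1 : ℝ) < z := hz
    exact mul_ne_zero (h2 z hz) (by nlinarith)
  have h4 : ∀ z ∈ Ioi (1 : ℝ), (z - a) ^ 2 ≠ 0 := fun z hz => pow_ne_zero _ (h2 z hz)
  have h5 : ∀ z ∈ Ioi (1 : ℝ), (z - a) ^ 3 ≠ 0 := fun z hz => pow_ne_zero _ (h2 z hz)
  unfold psiZ
  fun_prop (disch := assumption)

/-- The density of the variation in terms of `z`. -/
noncomputable def varDensity (a z : ℝ) : ℝ := 2 * sqrtF a z * |psiZ a z|

lemma varDensity_nonneg (a z : ℝ) : 0 ≤ varDensity a z :=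
  mul_nonneg (mul_nonneg zero_le_two (Real.sqrt_nonneg _)) (abs_nonneg _)

lemma continuousOn_varDensity {a : ℝ} (ha0 : 0 ≤ a) (ha1 : a < 1) :
    ContinuousOn (varDensity a) (Ioi 1) :=
  (continuousOn_const.mul (continuousOn_sqrtF ha1)).mul (continuousOn_psiZ ha0 ha1).abs

/-- The function `(z - 1)^(-1/2) / z`, with primitive `2 arctan √(z - 1)`, dominates the density of
the variation up to a constant. -/
lemma integrableOn_varDensity {a : ℝ} (ha0 : 0 ≤ a) (ha1 : a < 1) :
    IntegrableOn (varDensity a) (Ioi 1) := by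
  have hg : IntegrableOn (fun z : ℝ => 2 * (1 / (1 + √(z - 1) ^ 2) * (1 / (2 * √(z - 1)))))
      (Ioi 1) := by
    refine integrableOn_Ioi_deriv_of_nonneg (g := fun z => 2 * arctan √(z - 1)) (l := 2 * (π / 2))
      ?_ ?_ ?_ ?_
    · have : Continuous fun z : ℝ => 2 * arctan √(z - 1) := by fun_prop
      exact this.continuousWithinAt
    · intro z hz
      have hz' : (1 : ℝ) < z := hz
      have h1 := ((hasDerivAt_id z).sub_const 1).sqrt (by simp; linarith)
      exact h1.arctan.const_mul 2
    · intro z hz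
      positivity
    · refine Tendsto.const_mul _ ?_
      have h1 : Tendsto arctan atTop (𝓝 (π / 2)) :=
        tendsto_arctan_atTop.mono_right nhdsWithin_le_nhds
      exact h1.comp (Real.tendsto_sqrt_atTop.comp (tendsto_atTop_add_const_right _ _ tendsto_id))
  refine Integrable.mono' (hg.const_mul (2 / (1 - a) ^ 3))
    ((continuousOn_varDensity ha0 ha1).aestronglyMeasurable measurableSet_Ioi) ?_
  filter_upwards [ae_restrict_mem measurableSet_Ioi] with z hz
  have hz' : (1 : ℝ) < z := hz
  have h1 := abs_psiZ_le ha0 ha1 hz'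
  have h2 := sqrtF_le ha0 ha1 hz'
  rw [rpow_neg_half (by linarith)] at h2
  have h3 : 0 < 1 - a := by linarith
  have h4 : 0 < √(z - 1) := Real.sqrt_pos.2 (by linarith)
  rw [Real.norm_of_nonneg (varDensity_nonneg a z), varDensity, Real.sq_sqrt (by linarith)]
  calc 2 * sqrtF a z * |psiZ a z| ≤ 2 * (√(z - 1))⁻¹ * (1 / ((1 - a) ^ 3 * z)) := by gcongr
    _ = _ := by
      rw [show 1 + (z - 1) = z by ring]
      field_simp

lemma abs_deriv_smul_weight {a : ℝ} (ha0 : 0 ≤ a) (ha1 : a < 1) {z : ℝ} (hz : 1 < z) :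
    |-(2 * phaseInt a z * sqrtF a z)| • (|psi a (zetaOf a z)| / √|zetaOf a z|) =
      varDensity a z := by
  have h1 := phaseInt_pos ha0 ha1 hz
  rw [abs_deriv_zetaOf ha0 ha1 hz, psi_zetaOf ha0 ha1 hz, sqrt_abs_zetaOf ha0 ha1 hz, smul_eq_mul,
    varDensity]
  field_simp

lemma integrableOn_variation {a : ℝ} (ha0 : 0 ≤ a) (ha1 : a < 1) :
    IntegrableOn (fun v : ℝ => |psi a v| / √|v|) (Iio 0) := by
  rw [← image_zetaOf_Ioi ha0 ha1, integrableOn_image_iff_integrableOn_abs_deriv_smul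
    measurableSet_Ioi (fun z hz => (hasDerivAt_zetaOf ha0 ha1 hz).hasDerivWithinAt)
    (injOn_zetaOf ha0 ha1)]
  exact (integrableOn_varDensity ha0 ha1).congr_fun
    (fun z hz => (abs_deriv_smul_weight ha0 ha1 hz).symm) measurableSet_Ioi

lemma variation_zetaOf {a : ℝ} (ha0 : 0 ≤ a) (ha1 : a < 1) {z : ℝ} (hz : 1 < z) :
    variation a (zetaOf a z) = ∫ t in Ioo 1 z, varDensity a t := by
  rw [variation, ← image_zetaOf_Ioo ha0 ha1 hz, integral_image_eq_integral_abs_deriv_smul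
    measurableSet_Ioo (fun z hz => (hasDerivAt_zetaOf ha0 ha1 hz.1).hasDerivWithinAt)
    ((injOn_zetaOf ha0 ha1).mono fun t ht => ht.1)]
  exact setIntegral_congr_fun measurableSet_Ioo fun t ht => abs_deriv_smul_weight ha0 ha1 ht.1

lemma totalVariation_eq {a : ℝ} (ha0 : 0 ≤ a) (ha1 : a < 1) :
    totalVariation a = ∫ t in Ioi 1, varDensity a t := by
  rw [totalVariation, ← image_zetaOf_Ioi ha0 ha1, integral_image_eq_integral_abs_deriv_smul
    measurableSet_Ioi (fun z hz => (hasDerivAt_zetaOf ha0 ha1 hz).hasDerivWithinAt)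
    (injOn_zetaOf ha0 ha1)]
  exact setIntegral_congr_fun measurableSet_Ioi fun t ht => abs_deriv_smul_weight ha0 ha1 ht

/-! ### Comparison of a recessive solution with Bessel functions -/

/-- The ratio `√2 A(z) ξ / W` between a solution `A` and its transform, where `ξ = |ζ|^(1/2)`. -/
noncomputable def amp (a z : ℝ) : ℝ := √(phaseInt a z * sqrtF a z / (z - a))

/-- `(z² - 1)` times the logarithmic derivative of `amp`. -/
noncomputable def nu (a z : ℝ) : ℝ :=
  (z ^ 2 - 1) * sqrtF a z / (2 * phaseInt a z) - ((z ^ 2 - 1) / (z - a) + 2 * z) / 4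

lemma amp_pos {a : ℝ} (ha0 : 0 ≤ a) (ha1 : a < 1) {z : ℝ} (hz : 1 < z) : 0 < amp a z :=
  Real.sqrt_pos.2 (div_pos (mul_pos (phaseInt_pos ha0 ha1 hz) (sqrtF_pos ha1 hz)) (by linarith))

lemma amp_sq {a : ℝ} (ha0 : 0 ≤ a) (ha1 : a < 1) {z : ℝ} (hz : 1 < z) :
    amp a z ^ 2 = phaseInt a z * sqrtF a z / (z - a) :=
  Real.sq_sqrt (div_pos (mul_pos (phaseInt_pos ha0 ha1 hz) (sqrtF_pos ha1 hz)) (by linarith)).le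

lemma amp_sq_mul {a : ℝ} (ha0 : 0 ≤ a) (ha1 : a < 1) {z : ℝ} (hz : 1 < z) :
    amp a z ^ 2 * (z ^ 2 - 1) * sqrtF a z = phaseInt a z := by
  have hN : 0 < z - a := by linarith
  rw [amp_sq ha0 ha1 hz]
  have := sqrtF_sq_mul ha1 hz
  field_simp
  linear_combination (phaseInt a z) * this

lemma amp_sq_mul' {a : ℝ} (ha0 : 0 ≤ a) (ha1 : a < 1) {z : ℝ} (hz : 1 < z) :
    (z - a) * amp a z ^ 2 = phaseInt a z * sqrtF a z := by
  have hN : 0 < z - a := by linarith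
  rw [amp_sq ha0 ha1 hz]
  field_simp

lemma hasDerivAt_amp {a : ℝ} (ha0 : 0 ≤ a) (ha1 : a < 1) {z : ℝ} (hz : 1 < z) :
    HasDerivAt (amp a) (amp a z * (nu a z / (z ^ 2 - 1))) z := by
  have hN : 0 < z - a := by linarith
  have hD : 0 < z ^ 2 - 1 := by nlinarith
  have hX := phaseInt_pos ha0 ha1 hz
  have hs := sqrtF_pos ha1 hz
  have hm := amp_pos ha0 ha1 hz
  have h1 := (((hasDerivAt_phaseInt ha0 ha1 hz).mul (hasDerivAt_sqrtF ha1 hz)).div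
    ((hasDerivAt_id z).sub_const a) hN.ne').sqrt (div_pos (mul_pos hX hs) hN).ne'
  refine h1.congr_deriv ?_
  change _ / (2 * amp a z) = _
  rw [div_eq_iff (by positivity),
    show amp a z * (nu a z / (z ^ 2 - 1)) * (2 * amp a z) =
      amp a z ^ 2 * (2 * nu a z / (z ^ 2 - 1)) by ring, amp_sq ha0 ha1 hz, nu]
  simp only [Pi.mul_apply, id]
  field_simp
  ring

/-- The Riccati equation of `nu`; its inhomogeneity is the perturbation `ψ`. -/
lemma hasDerivAt_nu {a : ℝ} (ha0 : 0 ≤ a) (ha1 : a < 1) {z : ℝ} (hz : 1 < z) :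
    HasDerivAt (nu a) (4 * (z - a) * psiZ a z - nu a z ^ 2 / (z ^ 2 - 1)) z := by
  have hN : 0 < z - a := by linarith
  have hD : 0 < z ^ 2 - 1 := by nlinarith
  have hX := phaseInt_pos ha0 ha1 hz
  have hs := sqrtF_pos ha1 hz
  have hp := (hasDerivAt_pow 2 z).sub_const 1
  have h1 := ((hp.mul (hasDerivAt_sqrtF ha1 hz)).div ((hasDerivAt_phaseInt ha0 ha1 hz).const_mul 2)
    (by positivity)).sub (((hp.div ((hasDerivAt_id z).sub_const a) hN.ne').add
      ((hasDerivAt_id z).const_mul 2)).div_const 4)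
  refine h1.congr_deriv ?_
  have h2 := sqrtF_sq_mul ha1 hz
  simp only [Pi.mul_apply, id, nu, psiZ]
  push_cast
  have h3 : (z ^ 2 - 1) = (z - a) / sqrtF a z ^ 2 := by
    field_simp; linear_combination h2
  have h2' : sqrtF a z ^ 2 * (z * z - 1) = z - a := by linear_combination h2
  clear h1
  generalize z ^ 2 - 1 = D at *
  generalize sqrtF a z = s at *
  subst h3
  field_simp
  linear_combination (1024 * s ^ 2 * phaseInt a z ^ 2) * h2'

/-- A Bessel pair evaluated at `u ξ(z)`. -/
lemma IsBesselPair.hasDerivAt_comp {B b : ℝ → ℝ} (h : IsBesselPair B b) {u a : ℝ} (hu : 0 < u)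
    (ha0 : 0 ≤ a) (ha1 : a < 1) {z : ℝ} (hz : 1 < z) :
    HasDerivAt (fun z => B (u * phaseInt a z)) (b (u * phaseInt a z) / phaseInt a z * sqrtF a z) z ∧
    HasDerivAt (fun z => b (u * phaseInt a z))
      (-(u ^ 2 * phaseInt a z * B (u * phaseInt a z)) * sqrtF a z) z := by
  have hX := phaseInt_pos ha0 ha1 hz
  obtain ⟨h1, h2⟩ := h _ (mul_pos hu hX)
  have h3 := (hasDerivAt_phaseInt ha0 ha1 hz).const_mul u
  refine ⟨(h1.comp z h3).congr_deriv ?_, (h2.comp z h3).congr_deriv ?_⟩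
  · field_simp
  · ring

/-- The Wronskian of a solution `A` of the radial equation, with `G = (z² - 1) A'`, and of the
Liouville transform of a solution `B` of Bessel's equation, with `b = x B'`. -/
noncomputable def crossWronskian (u a : ℝ) (A G B b : ℝ → ℝ) (z : ℝ) : ℝ :=
  amp a z * B (u * phaseInt a z) * (G z - nu a z * A z) - b (u * phaseInt a z) * A z / amp a z

/-- `A` solves the radial equation with `b = 0`, and `G = (z² - 1) A'`. -/
def IsRadialPair (u a : ℝ) (A G : ℝ → ℝ) : Prop :=
  ∀ z : ℝ, 1 < z → HasDerivAt A (G z / (z ^ 2 - 1)) z ∧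
    HasDerivAt G (-(u ^ 2 * (z - a) * A z)) z

lemma isRadialSolution_iff {u a : ℝ} {A : ℝ → ℝ} :
    IsRadialSolution u a 0 A ↔ ∃ G, IsRadialPair u a A G := by
  constructor
  · rintro ⟨A', h⟩
    refine ⟨fun z => (z ^ 2 - 1) * A' z, fun z hz => ?_⟩
    have hD : 0 < z ^ 2 - 1 := by nlinarith
    obtain ⟨h1, h2⟩ := h z hz
    refine ⟨h1.congr_deriv (by field_simp), ?_⟩
    refine (((hasDerivAt_pow 2 z).sub_const 1).mul h2).congr_deriv ?_
    push_cast
    field_simp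
    ring
  · rintro ⟨G, h⟩
    refine ⟨fun z => G z / (z ^ 2 - 1), fun z hz => ?_⟩
    have hD : 0 < z ^ 2 - 1 := by nlinarith
    obtain ⟨h1, h2⟩ := h z hz
    refine ⟨h1, ?_⟩
    refine (h2.div ((hasDerivAt_pow 2 z).sub_const 1) hD.ne').congr_deriv ?_
    push_cast
    field_simp
    ring

/-- The unperturbed terms cancel: the derivative contains only the perturbation `ψ`. -/
lemma hasDerivAt_crossWronskian {u a : ℝ} (hu : 0 < u) (ha0 : 0 ≤ a) (ha1 : a < 1)
    {A G B b : ℝ → ℝ} (hA : IsRadialPair u a A G) (hB : IsBesselPair B b) {z : ℝ} (hz : 1 < z) :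
    HasDerivAt (crossWronskian u a A G B b)
      (-(4 * (z - a) * psiZ a z * amp a z * B (u * phaseInt a z) * A z)) z := by
  have hD : 0 < z ^ 2 - 1 := by nlinarith
  have hX := phaseInt_pos ha0 ha1 hz
  have hm := amp_pos ha0 ha1 hz
  have hs := amp_sq_mul ha0 ha1 hz
  have hN := amp_sq_mul' ha0 ha1 hz
  obtain ⟨hA1, hA2⟩ := hA z hz
  obtain ⟨hB1, hB2⟩ := hB.hasDerivAt_comp hu ha0 ha1 hz
  have hm' := hasDerivAt_amp ha0 ha1 hz
  have h := (((hm'.mul hB1).mul (hA2.sub ((hasDerivAt_nu ha0 ha1 hz).mul hA1))).sub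
    ((hB2.mul hA1).div hm' hm.ne'))
  refine h.congr_deriv ?_
  simp only [Pi.mul_apply, Pi.sub_apply]
  have hs' : sqrtF a z = phaseInt a z / (amp a z ^ 2 * (z ^ 2 - 1)) := by
    field_simp; linear_combination hs
  have hN' : z - a = phaseInt a z ^ 2 / (amp a z ^ 4 * (z ^ 2 - 1)) := by
    rw [hs'] at hN
    field_simp at hN ⊢
    linear_combination hN
  rw [hs', hN']
  generalize z ^ 2 - 1 = D at *
  field_simp
  ring

/-- The solution is recovered from its Wronskians with `J₀` and `Y₀`. -/
lemma crossWronskian_identity (u : ℝ) {a : ℝ} (A G : ℝ → ℝ) (z : ℝ) :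
    besselJ0 (u * phaseInt a z) * crossWronskian u a A G besselY0 thetaY z -
      besselY0 (u * phaseInt a z) * crossWronskian u a A G besselJ0 thetaJ z =
    -(2 / π * (A z / amp a z)) := by
  have h := bessel_wronskian (u * phaseInt a z)
  rw [← h, crossWronskian, crossWronskian]
  ring

/-! ### Behaviour at the singular point -/

lemma inv_amp_sq_bounds {a : ℝ} (ha0 : 0 ≤ a) (ha1 : a < 1) {z : ℝ} (hz : 1 < z) :
    1 ≤ (z ^ 2 - 1) * sqrtF a z / phaseInt a z ∧
      (z ^ 2 - 1) * sqrtF a z / phaseInt a z ≤ 1 + (z - 1) * ((z + 2) / (4 * (1 - a))) := by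
  have hN : 0 < z - a := by linarith
  have hD : 0 < z ^ 2 - 1 := by nlinarith
  have hX := phaseInt_pos ha0 ha1 hz
  have hs := sqrtF_pos ha1 hz
  have h2 := sqrtF_sq_mul ha1 hz
  have hc : 0 < 1 - a := by linarith
  have hz1 : 0 < z - 1 := by linarith
  obtain ⟨hb1, hb2⟩ := phaseInt_sq_bounds ha0 ha1 hz
  set r := (z ^ 2 - 1) * sqrtF a z / phaseInt a z with hr
  have hr0 : 0 < r := by positivity
  have hr2 : r ^ 2 * phaseInt a z ^ 2 = (z ^ 2 - 1) * (z - a) := by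
    rw [hr]; field_simp; linear_combination h2
  constructor
  · by_contra! h
    have h3 : r ^ 2 < 1 := by nlinarith
    have h4 : r ^ 2 * phaseInt a z ^ 2 < phaseInt a z ^ 2 := by nlinarith [pow_pos hX 2]
    rw [hr2] at h4
    have h5 : 0 < (z - 1) * (z - a) := mul_pos hz1 hN
    nlinarith [mul_pos h5 hz1]
  · have h3 : r ^ 2 * (2 * (1 - a) * (z - 1)) ≤ (z ^ 2 - 1) * (z - a) := by
      rw [← hr2]; gcongr
    have h4 : r ^ 2 * (2 * (1 - a)) ≤ (z + 1) * (z - a) := by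
      have : r ^ 2 * (2 * (1 - a)) * (z - 1) ≤ (z + 1) * (z - a) * (z - 1) := by
        linear_combination h3
      exact le_of_mul_le_mul_right this hz1
    set k := (z - 1) * ((z + 2) / (4 * (1 - a))) with hk
    have hk0 : 0 < k := by positivity
    have h5 : (z - 1) * (z + 2) = 4 * (1 - a) * k := by rw [hk]; field_simp
    have h6 : r ^ 2 ≤ (1 + k) ^ 2 := by
      have h7 : r ^ 2 * (2 * (1 - a)) ≤ (1 + 2 * k) * (2 * (1 - a)) := by
        refine h4.trans ?_
        nlinarith
      have := le_of_mul_le_mul_right h7 (by linarith)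
      nlinarith
    exact abs_le_of_sq_le_sq' h6 (by positivity) |>.2

lemma inv_amp_sq_eq {a : ℝ} (ha0 : 0 ≤ a) (ha1 : a < 1) {z : ℝ} (hz : 1 < z) :
    ((amp a z)⁻¹) ^ 2 = (z ^ 2 - 1) * sqrtF a z / phaseInt a z := by
  have hX := phaseInt_pos ha0 ha1 hz
  have hm := amp_pos ha0 ha1 hz
  have := amp_sq_mul ha0 ha1 hz
  field_simp
  linear_combination -this

lemma abs_nu_le {a : ℝ} (ha0 : 0 ≤ a) (ha1 : a < 1) {z : ℝ} (hz : 1 < z) (hz2 : z ≤ 2) :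
    |nu a z| ≤ (z - 1) * (2 / (1 - a)) := by
  obtain ⟨h1, h2⟩ := inv_amp_sq_bounds ha0 ha1 hz
  have hN : 0 < z - a := by linarith
  have hc : 0 < 1 - a := by linarith
  have hz1 : 0 < z - 1 := by linarith
  have hX := phaseInt_pos ha0 ha1 hz
  have e : nu a z = ((z ^ 2 - 1) * sqrtF a z / phaseInt a z) / 2 -
      ((z ^ 2 - 1) / (z - a) + 2 * z) / 4 := by rw [nu]; field_simp
  have h3 : 0 ≤ (z ^ 2 - 1) / (z - a) := div_nonneg (by nlinarith) hN.le
  have h4 : (z ^ 2 - 1) / (z - a) ≤ (z - 1) * (3 / (1 - a)) := by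
    rw [show (z ^ 2 - 1) / (z - a) = (z - 1) * ((z + 1) / (z - a)) by field_simp; ring]
    gcongr
    linarith
  have h5 : (z - 1) * ((z + 2) / (4 * (1 - a))) ≤ (z - 1) * (1 / (1 - a)) := by
    gcongr ?_ * ?_
    rw [div_le_div_iff₀ (by positivity) hc]
    nlinarith
  have h6 : z - 1 ≤ (z - 1) * (1 / (1 - a)) := by
    refine le_mul_of_one_le_right hz1.le ?_
    rw [le_div_iff₀ hc]; linarith
  have e1 : (z - 1) * (3 / (1 - a)) = 3 * ((z - 1) * (1 / (1 - a))) := by ring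
  have e2 : (z - 1) * (2 / (1 - a)) = 2 * ((z - 1) * (1 / (1 - a))) := by ring
  rw [e1] at h4
  rw [e2, e, abs_le]
  constructor <;> linarith

lemma tendsto_inv_amp {a : ℝ} (ha0 : 0 ≤ a) (ha1 : a < 1) :
    Tendsto (fun z => (amp a z)⁻¹) (𝓝[>] 1) (𝓝 1) := by
  have h1 : Tendsto (fun z : ℝ => 1 + (z - 1) * ((z + 2) / (4 * (1 - a)))) (𝓝[>] 1) (𝓝 1) := by
    have : Continuous fun z : ℝ => 1 + (z - 1) * ((z + 2) / (4 * (1 - a))) := by fun_prop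
    simpa using (this.tendsto 1).mono_left nhdsWithin_le_nhds
  have h2 : Tendsto (fun z => ((amp a z)⁻¹) ^ 2) (𝓝[>] 1) (𝓝 1) := by
    refine tendsto_of_tendsto_of_tendsto_of_le_of_le' tendsto_const_nhds h1 ?_ ?_
    · filter_upwards [self_mem_nhdsWithin] with z hz
      rw [inv_amp_sq_eq ha0 ha1 hz]
      exact (inv_amp_sq_bounds ha0 ha1 hz).1
    · filter_upwards [self_mem_nhdsWithin] with z hz
      rw [inv_amp_sq_eq ha0 ha1 hz]
      exact (inv_amp_sq_bounds ha0 ha1 hz).2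
  have h3 := (Real.continuous_sqrt.tendsto 1).comp h2
  refine (h3.congr' ?_).trans_eq (by simp)
  filter_upwards [self_mem_nhdsWithin] with z hz
  exact Real.sqrt_sq (inv_nonneg.2 (amp_pos ha0 ha1 hz).le)

lemma tendsto_amp {a : ℝ} (ha0 : 0 ≤ a) (ha1 : a < 1) :
    Tendsto (amp a) (𝓝[>] 1) (𝓝 1) := by
  simpa using (tendsto_inv_amp ha0 ha1).inv₀ one_ne_zero

/-- A value of `G = (z² - 1) A'` above the bound would force `A` to behave like a multiple of
`log (z - 1)`. -/
lemma radial_flux_le_of_bounded {u a : ℝ} (ha0 : 0 ≤ a) (ha1 : a < 1) {A G : ℝ → ℝ}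
    (hA : IsRadialPair u a A G) {δ : ℝ} (hδ1 : δ ≤ 1) (hb : ∀ z, 1 < z → z < 1 + δ → |A z| ≤ 1)
    {z₀ : ℝ} (hz₀ : 1 < z₀) (hz₀' : z₀ < 1 + δ) : G z₀ ≤ 2 * u ^ 2 * (z₀ - 1) := by
  by_contra! hlt
  set η := G z₀ - 2 * u ^ 2 * (z₀ - 1) with hη
  have hη0 : 0 < η := by linarith
  have hGt : ∀ t, 1 < t → t ≤ z₀ → η ≤ G t := fun t ht htz => by
    have hmono : AntitoneOn (fun t => G t - 2 * u ^ 2 * t) (Icc t z₀) := by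
      have hd : ∀ x ∈ Icc t z₀, HasDerivAt (fun t => G t - 2 * u ^ 2 * t)
          (-(u ^ 2 * (x - a) * A x) - 2 * u ^ 2) x := fun x hx =>
        ((hA x (ht.trans_le hx.1)).2.sub ((hasDerivAt_id x).const_mul (2 * u ^ 2))).congr_deriv
          (by ring)
      refine antitoneOn_of_deriv_nonpos (convex_Icc _ _)
        (fun x hx => (hd x hx).continuousAt.continuousWithinAt) ?_ ?_
      · exact fun x hx => (hd x (interior_subset hx)).differentiableAt.differentiableWithinAt
      · intro x hx
        have hx' := interior_subset hx
        rw [(hd x hx').deriv]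
        have h1 : 1 < x := ht.trans_le hx'.1
        have h2 := (abs_le.1 (hb x h1 (hx'.2.trans_lt hz₀'))).1
        have h3 : 0 ≤ u ^ 2 * (x - a) * (A x + 1) := by
          refine mul_nonneg (mul_nonneg (sq_nonneg u) ?_) (by linarith)
          linarith
        have h5 : u ^ 2 * (x - a) ≤ u ^ 2 * 2 := by
          have := hx'.2
          exact mul_le_mul_of_nonneg_left (by linarith) (sq_nonneg u)
        nlinarith
    have := hmono (left_mem_Icc.2 htz) (right_mem_Icc.2 htz) htz
    simp only at this
    nlinarith [sq_nonneg u]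
  -- `A' = G / (z² - 1) ≥ η / (3 (z - 1))`, because `z + 1 ≤ 3`
  have hlog : ∀ t, 1 < t → t ≤ z₀ → A t ≤ A z₀ + η / 3 * (Real.log (t - 1) - Real.log (z₀ - 1)) :=
      fun t ht htz => by
    have hmono : MonotoneOn (fun t => A t - η / 3 * Real.log (t - 1)) (Icc t z₀) := by
      have hd : ∀ x ∈ Icc t z₀, HasDerivAt (fun t => A t - η / 3 * Real.log (t - 1))
          (G x / (x ^ 2 - 1) - η / 3 * (1 / (x - 1))) x := fun x hx => by
        have h1 : 1 < x := ht.trans_le hx.1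
        exact (hA x h1).1.sub ((((hasDerivAt_id x).sub_const 1).log
          (by simp only [id]; linarith)).const_mul _)
      refine monotoneOn_of_deriv_nonneg (convex_Icc _ _)
        (fun x hx => (hd x hx).continuousAt.continuousWithinAt) ?_ ?_
      · exact fun x hx => (hd x (interior_subset hx)).differentiableAt.differentiableWithinAt
      · intro x hx
        have hx' := interior_subset hx
        rw [(hd x hx').deriv]
        have h1 : 1 < x := ht.trans_le hx'.1
        have h2 := hGt x h1 hx'.2
        have hx1 : 0 < x - 1 := by linarith
        rw [sub_nonneg, show x ^ 2 - 1 = (x - 1) * (x + 1) by ring, div_mul_div_comm, mul_one,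
          div_le_div_iff₀ (by positivity) (by nlinarith)]
        have h3 : x + 1 ≤ 3 := by have := hx'.2; linarith
        have h4 : η * (x + 1) ≤ G x * 3 := by nlinarith
        nlinarith [mul_le_mul_of_nonneg_right h4 hx1.le]
    have := hmono (left_mem_Icc.2 htz) (right_mem_Icc.2 htz) htz
    simp only at this
    linarith
  have htend : Tendsto (fun t : ℝ => A z₀ + η / 3 * (Real.log (t - 1) - Real.log (z₀ - 1)))
      (𝓝[>] 1) atBot := by
    refine tendsto_atBot_add_const_left _ _ (Tendsto.const_mul_atBot (by positivity)
      (tendsto_atBot_add_const_right _ _ (Real.tendsto_log_nhdsGT_zero.comp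
        (tendsto_nhdsWithin_iff.2 ⟨?_, ?_⟩))))
    · have : Continuous fun x : ℝ => x - 1 := by fun_prop
      simpa using (this.tendsto 1).mono_left nhdsWithin_le_nhds
    · filter_upwards [self_mem_nhdsWithin] with x hx
      exact sub_pos.2 (mem_Ioi.1 hx)
  have h2 : ∀ᶠ t : ℝ in 𝓝[>] 1, t < z₀ := nhdsWithin_le_nhds (Iio_mem_nhds hz₀)
  obtain ⟨t, ht1, htz, ht⟩ := ((htend.eventually (eventually_lt_atBot (-1))).and
    (h2.and self_mem_nhdsWithin)).exists
  have h5 := hlog t ht htz.le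
  have h6 := (abs_le.1 (hb t ht (htz.trans hz₀'))).1
  linarith

lemma IsRadialPair.neg {u a : ℝ} {A G : ℝ → ℝ} (hA : IsRadialPair u a A G) :
    IsRadialPair u a (fun z => -A z) (fun z => -G z) := fun z hz =>
  ⟨(hA z hz).1.neg.congr_deriv (by ring), (hA z hz).2.neg.congr_deriv (by ring)⟩

/-- A solution with a finite limit at the singular point `z = 1` has no logarithmic part, so that
`(z² - 1) A'` vanishes to first order. The bound `|A| ≤ 1` uses `1/√2 < 1`. -/
lemma recessive_near_one {u a : ℝ} (ha0 : 0 ≤ a) (ha1 : a < 1) {A G : ℝ → ℝ}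
    (hA : IsRadialPair u a A G) (hlim : Tendsto A (𝓝[>] 1) (𝓝 (1 / √2))) :
    ∃ δ : ℝ, 0 < δ ∧ δ ≤ 1 ∧ ∀ z, 1 < z → z < 1 + δ →
      |A z| ≤ 1 ∧ |G z| ≤ 2 * u ^ 2 * (z - 1) := by
  have h1 : |1 / √2| < 1 := by
    rw [abs_of_pos (by positivity), div_lt_one (by positivity), Real.lt_sqrt zero_le_one]
    norm_num
  have h2 := hlim.abs.eventually (gt_mem_nhds h1)
  obtain ⟨c, hc, h3⟩ := mem_nhdsGT_iff_exists_Ioo_subset.1 h2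
  have hc' : (1 : ℝ) < c := hc
  refine ⟨min (c - 1) 1, lt_min (by linarith) one_pos, min_le_right _ _, ?_⟩
  have hb : ∀ z, 1 < z → z < 1 + min (c - 1) 1 → |A z| ≤ 1 := fun z hz hz' => by
    have : z < c := by have := min_le_left (c - 1) 1; linarith
    exact (show |A z| < 1 from h3 ⟨hz, this⟩).le
  intro z hz hz'
  refine ⟨hb z hz hz', abs_le.2 ⟨?_, ?_⟩⟩
  · have := radial_flux_le_of_bounded ha0 ha1 hA.neg (min_le_right _ _)
      (fun z hz hz' => by rw [abs_neg]; exact hb z hz hz') hz hz'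
    linarith
  · exact radial_flux_le_of_bounded ha0 ha1 hA (min_le_right _ _) hb hz hz'

lemma abs_besselY0_le {x : ℝ} (hx : 0 < x) : |besselY0 x| ≤ √(2 / (π * x)) := by
  refine Real.abs_le_sqrt ?_
  nlinarith [bessel_sq_add_sq_le hx, sq_nonneg (besselJ0 x)]

lemma tendsto_mul_besselY0 : Tendsto (fun x => x * besselY0 x) (𝓝[>] 0) (𝓝 0) := by
  have h1 : Tendsto (fun x : ℝ => √(2 * x / π)) (𝓝[>] 0) (𝓝 0) := by
    have : Continuous fun x : ℝ => √(2 * x / π) := by fun_prop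
    simpa using (this.tendsto 0).mono_left nhdsWithin_le_nhds
  refine squeeze_zero_norm' ?_ h1
  filter_upwards [self_mem_nhdsWithin] with x hx
  have hx' : (0 : ℝ) < x := hx
  rw [norm_mul, Real.norm_of_nonneg hx'.le, Real.norm_eq_abs]
  calc x * |besselY0 x| ≤ x * √(2 / (π * x)) := by gcongr; exact abs_besselY0_le hx'
    _ = √(x ^ 2) * √(2 / (π * x)) := by rw [Real.sqrt_sq hx'.le]
    _ = √(2 * x / π) := by
      rw [← Real.sqrt_mul (sq_nonneg x)]
      congr 1
      field_simp

lemma tendsto_mul_phaseInt {u a : ℝ} (hu : 0 < u) (ha0 : 0 ≤ a) (ha1 : a < 1) :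
    Tendsto (fun z => u * phaseInt a z) (𝓝[>] 1) (𝓝[>] 0) := by
  refine tendsto_nhdsWithin_iff.2 ⟨?_, ?_⟩
  · simpa using (tendsto_phaseInt_one ha0 ha1).const_mul u
  · filter_upwards [self_mem_nhdsWithin] with z hz
    exact mul_pos hu (phaseInt_pos ha0 ha1 hz)

lemma tendsto_flux_sub {u a : ℝ} (ha0 : 0 ≤ a) (ha1 : a < 1) {A G : ℝ → ℝ}
    (hA : IsRadialPair u a A G) (hlim : Tendsto A (𝓝[>] 1) (𝓝 (1 / √2))) :
    ∃ K : ℝ, ∀ᶠ z in 𝓝[>] 1, |G z - nu a z * A z| ≤ K * phaseInt a z ^ 2 := by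
  obtain ⟨δ, hδ, hδ1, h⟩ := recessive_near_one ha0 ha1 hA hlim
  have hc : 0 < 1 - a := by linarith
  refine ⟨(2 * u ^ 2 + 2 / (1 - a)) / (2 * (1 - a)), ?_⟩
  have h2 : ∀ᶠ z : ℝ in 𝓝[>] 1, z < 1 + δ := nhdsWithin_le_nhds (Iio_mem_nhds (by linarith))
  filter_upwards [self_mem_nhdsWithin, h2] with z hz hz2
  have hz' : (1 : ℝ) < z := hz
  obtain ⟨h3, h4⟩ := h z hz hz2
  have h5 := abs_nu_le ha0 ha1 hz (by linarith)
  obtain ⟨hb1, -⟩ := phaseInt_sq_bounds ha0 ha1 hz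
  have h6 : |nu a z * A z| ≤ (z - 1) * (2 / (1 - a)) := by
    rw [abs_mul]
    calc |nu a z| * |A z| ≤ (z - 1) * (2 / (1 - a)) * 1 := by gcongr
      _ = _ := mul_one _
  calc |G z - nu a z * A z| ≤ |G z| + |nu a z * A z| := abs_sub _ _
    _ ≤ 2 * u ^ 2 * (z - 1) + (z - 1) * (2 / (1 - a)) := by gcongr
    _ = (2 * u ^ 2 + 2 / (1 - a)) / (2 * (1 - a)) * (2 * (1 - a) * (z - 1)) := by field_simp
    _ ≤ _ := by gcongr

lemma tendsto_crossWronskian_J {u a : ℝ} (hu : 0 < u) (ha0 : 0 ≤ a) (ha1 : a < 1) {A G : ℝ → ℝ}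
    (hA : IsRadialPair u a A G) (hlim : Tendsto A (𝓝[>] 1) (𝓝 (1 / √2))) :
    Tendsto (crossWronskian u a A G besselJ0 thetaJ) (𝓝[>] 1) (𝓝 0) := by
  have hx := tendsto_mul_phaseInt hu ha0 ha1
  have hJ := tendsto_besselJ0.comp hx
  have hθ : Tendsto (fun z => thetaJ (u * phaseInt a z)) (𝓝[>] 1) (𝓝 0) := by
    have := (continuous_thetaJ.tendsto 0).comp (hx.mono_right nhdsWithin_le_nhds)
    rwa [thetaJ_zero] at this
  have hm := tendsto_amp ha0 ha1
  have hd : Tendsto (fun z => G z - nu a z * A z) (𝓝[>] 1) (𝓝 0) := by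
    obtain ⟨K, hK⟩ := tendsto_flux_sub ha0 ha1 hA hlim
    refine squeeze_zero_norm' hK ?_
    simpa using ((tendsto_phaseInt_one ha0 ha1).pow 2).const_mul K
  have := ((hm.mul hJ).mul hd).sub ((hθ.mul hlim).div hm one_ne_zero)
  refine this.trans_eq (by simp)

/-- The limit comes from `x Y₀'(x) → 2/π`; the terms with the logarithm of `Y₀` are multiplied by
quantities of order `ξ²`. -/
lemma tendsto_crossWronskian_Y {u a : ℝ} (hu : 0 < u) (ha0 : 0 ≤ a) (ha1 : a < 1) {A G : ℝ → ℝ}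
    (hA : IsRadialPair u a A G) (hlim : Tendsto A (𝓝[>] 1) (𝓝 (1 / √2))) :
    Tendsto (crossWronskian u a A G besselY0 thetaY) (𝓝[>] 1) (𝓝 (-(2 / π * (1 / √2)))) := by
  have hx := tendsto_mul_phaseInt hu ha0 ha1
  have hθ := tendsto_thetaY.comp hx
  have hm := tendsto_amp ha0 ha1
  have hd : Tendsto (fun z => besselY0 (u * phaseInt a z) * (G z - nu a z * A z))
      (𝓝[>] 1) (𝓝 0) := by
    obtain ⟨K, hK⟩ := tendsto_flux_sub ha0 ha1 hA hlim
    have h1 := (tendsto_mul_besselY0.comp hx).abs.mul (tendsto_phaseInt_one ha0 ha1)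
    have h2 := h1.const_mul (K / u)
    rw [abs_zero, zero_mul, mul_zero] at h2
    refine squeeze_zero_norm' ?_ h2
    filter_upwards [hK, self_mem_nhdsWithin] with z hz hz1
    have hX := phaseInt_pos ha0 ha1 hz1
    rw [norm_mul, Real.norm_eq_abs, Real.norm_eq_abs, Function.comp_apply, abs_mul,
      abs_of_pos (mul_pos hu hX)]
    calc |besselY0 (u * phaseInt a z)| * |G z - nu a z * A z|
        ≤ |besselY0 (u * phaseInt a z)| * (K * phaseInt a z ^ 2) := by gcongr
      _ = _ := by field_simp
  have := (hm.mul hd).sub ((hθ.mul hlim).div hm one_ne_zero)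
  refine (this.congr fun z => ?_).trans_eq (by simp)
  simp only [crossWronskian, Function.comp_apply, Pi.div_apply]
  ring

/-! ### The variation as a function of `z` -/

/-- `𝒱_{ζ(z),0}`. -/
noncomputable def varInt (a z : ℝ) : ℝ := ∫ t in (1 : ℝ)..z, varDensity a t

lemma intervalIntegrable_varDensity {a : ℝ} (ha0 : 0 ≤ a) (ha1 : a < 1) {z : ℝ} (hz : 1 < z) :
    IntervalIntegrable (varDensity a) volume 1 z := by
  rw [intervalIntegrable_iff_integrableOn_Ioc_of_le hz.le]
  exact (integrableOn_varDensity ha0 ha1).mono_set Ioc_subset_Ioi_self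

lemma varInt_eq {a z : ℝ} (hz : 1 < z) : varInt a z = ∫ t in Ioo 1 z, varDensity a t := by
  rw [varInt, intervalIntegral.integral_of_le hz.le, integral_Ioc_eq_integral_Ioo]

lemma variation_zetaOf' {a : ℝ} (ha0 : 0 ≤ a) (ha1 : a < 1) {z : ℝ} (hz : 1 < z) :
    variation a (zetaOf a z) = varInt a z := by
  rw [variation_zetaOf ha0 ha1 hz, varInt_eq hz]

lemma hasDerivAt_varInt {a : ℝ} (ha0 : 0 ≤ a) (ha1 : a < 1) {z : ℝ} (hz : 1 < z) :
    HasDerivAt (varInt a) (varDensity a z) z :=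
  intervalIntegral.integral_hasDerivAt_right (intervalIntegrable_varDensity ha0 ha1 hz)
    ((continuousOn_varDensity ha0 ha1).stronglyMeasurableAtFilter isOpen_Ioi z hz)
    ((continuousOn_varDensity ha0 ha1).continuousAt (Ioi_mem_nhds hz))

lemma varInt_nonneg {a z : ℝ} (hz : 1 < z) : 0 ≤ varInt a z :=
  intervalIntegral.integral_nonneg hz.le fun t _ => varDensity_nonneg a t

lemma varInt_le {a : ℝ} (ha0 : 0 ≤ a) (ha1 : a < 1) {z : ℝ} (hz : 1 < z) :
    varInt a z ≤ totalVariation a := by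
  rw [totalVariation_eq ha0 ha1, varInt_eq hz]
  exact setIntegral_mono_set (integrableOn_varDensity ha0 ha1)
    (Eventually.of_forall fun t => varDensity_nonneg a t) Ioo_subset_Ioi_self.eventuallyLE

lemma tendsto_varInt_one {a : ℝ} (ha0 : 0 ≤ a) (ha1 : a < 1) :
    Tendsto (varInt a) (𝓝[>] 1) (𝓝 0) := by
  have hint : IntegrableOn (varDensity a) (Icc 1 2) := by
    rw [integrableOn_Icc_iff_integrableOn_Ioc]
    exact (integrableOn_varDensity ha0 ha1).mono_set Ioc_subset_Ioi_self
  have h := intervalIntegral.continuousOn_primitive_interval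
    (by rwa [uIcc_of_le one_le_two] : IntegrableOn (varDensity a) (uIcc 1 2))
  rw [uIcc_of_le one_le_two] at h
  have h1 := (h 1 (left_mem_Icc.2 one_le_two)).tendsto
  rw [intervalIntegral.integral_same] at h1
  refine h1.mono_left ?_
  rw [nhdsWithin_le_iff]
  exact mem_of_superset (Ioc_mem_nhdsGT one_lt_two) Ioc_subset_Icc_self

/-! ### Energy estimate and the Volterra equation -/

/-- The sum of the squares of the Wronskians with `J₀` and `Y₀`. It vanishes only with the solution
and changes by a bounded factor. -/
noncomputable def energy (u a : ℝ) (A G : ℝ → ℝ) (z : ℝ) : ℝ :=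
  crossWronskian u a A G besselJ0 thetaJ z ^ 2 + crossWronskian u a A G besselY0 thetaY z ^ 2

lemma energy_nonneg (u a : ℝ) (A G : ℝ → ℝ) (z : ℝ) : 0 ≤ energy u a A G z := by
  unfold energy; positivity

/-- The Cauchy-Schwarz inequality in `crossWronskian_identity`. -/
lemma sq_div_amp_le {u a : ℝ} (hu : 0 < u) (ha0 : 0 ≤ a) (ha1 : a < 1) (A G : ℝ → ℝ) {z : ℝ}
    (hz : 1 < z) : (A z / amp a z) ^ 2 ≤ π / (2 * u * phaseInt a z) * energy u a A G z := by
  have hX := phaseInt_pos ha0 ha1 hz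
  have h := crossWronskian_identity u (a := a) A G z
  have hb := bessel_sq_add_sq_le (mul_pos hu hX)
  set J := besselJ0 (u * phaseInt a z)
  set Y := besselY0 (u * phaseInt a z)
  set P := crossWronskian u a A G besselJ0 thetaJ z with hP
  set R := crossWronskian u a A G besselY0 thetaY z with hR
  have e : energy u a A G z = P ^ 2 + R ^ 2 := rfl
  have h1 : A z / amp a z = -(π / 2) * (J * R - Y * P) := by
    rw [h]; field_simp
  have h2 : (J * R - Y * P) ^ 2 ≤ (J ^ 2 + Y ^ 2) * (P ^ 2 + R ^ 2) := by
    nlinarith [sq_nonneg (J * P + Y * R)]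
  rw [h1, e, mul_pow]
  calc (-(π / 2)) ^ 2 * (J * R - Y * P) ^ 2
      ≤ (-(π / 2)) ^ 2 * ((2 / (π * (u * phaseInt a z))) * (P ^ 2 + R ^ 2)) := by
        gcongr
        exact h2.trans (by gcongr)
    _ = _ := by field_simp

lemma abs_deriv_energy_le {u a : ℝ} (hu : 0 < u) (ha0 : 0 ≤ a) (ha1 : a < 1) {A G : ℝ → ℝ}
    (hA : IsRadialPair u a A G) {z : ℝ} (hz : 1 < z) :
    ∃ F' : ℝ, HasDerivAt (energy u a A G) F' z ∧
      |F'| ≤ 4 / u * varDensity a z * energy u a A G z := by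
  have hX := phaseInt_pos ha0 ha1 hz
  have hs := sqrtF_pos ha1 hz
  have hm := amp_pos ha0 ha1 hz
  have hN : 0 < z - a := by linarith
  have hJ := hasDerivAt_crossWronskian hu ha0 ha1 hA isBesselPair_J hz
  have hY := hasDerivAt_crossWronskian hu ha0 ha1 hA isBesselPair_Y hz
  refine ⟨_, (hJ.pow 2).add (hY.pow 2), ?_⟩
  have h1 := sq_div_amp_le hu ha0 ha1 A G hz
  have hb := bessel_sq_add_sq_le (mul_pos hu hX)
  have hF := energy_nonneg u a A G z
  set J := besselJ0 (u * phaseInt a z)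
  set Y := besselY0 (u * phaseInt a z)
  set P := crossWronskian u a A G besselJ0 thetaJ z with hP
  set R := crossWronskian u a A G besselY0 thetaY z with hR
  have e : energy u a A G z = P ^ 2 + R ^ 2 := rfl
  have h2 : (J * P + Y * R) ^ 2 ≤ (2 / (π * (u * phaseInt a z))) * energy u a A G z := by
    rw [e]
    calc (J * P + Y * R) ^ 2 ≤ (J ^ 2 + Y ^ 2) * (P ^ 2 + R ^ 2) := by
          nlinarith [sq_nonneg (J * R - Y * P)]
      _ ≤ _ := by gcongr
  have h3 : |A z / amp a z * (J * P + Y * R)| ≤ energy u a A G z / (u * phaseInt a z) := by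
    refine abs_le_of_sq_le_sq ?_ (by positivity)
    rw [mul_pow]
    calc (A z / amp a z) ^ 2 * (J * P + Y * R) ^ 2 ≤ (π / (2 * u * phaseInt a z) * energy u a A G z) *
          ((2 / (π * (u * phaseInt a z))) * energy u a A G z) := by gcongr
      _ = _ := by field_simp
  have h4 := amp_sq_mul' ha0 ha1 hz
  have h5 : (2 : ℕ) * P ^ (2 - 1) * (-(4 * (z - a) * psiZ a z * amp a z * J * A z)) +
      (2 : ℕ) * R ^ (2 - 1) * (-(4 * (z - a) * psiZ a z * amp a z * Y * A z)) =
      -8 * ((z - a) * amp a z ^ 2) * psiZ a z * (A z / amp a z * (J * P + Y * R)) := by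
    push_cast
    field_simp
    ring
  rw [h5, h4, abs_mul, abs_mul, abs_mul, abs_of_pos (mul_pos hX hs)]
  rw [show |(-8 : ℝ)| = 8 by norm_num]
  calc 8 * (phaseInt a z * sqrtF a z) * |psiZ a z| * |A z / amp a z * (J * P + Y * R)|
      ≤ 8 * (phaseInt a z * sqrtF a z) * |psiZ a z| * (energy u a A G z / (u * phaseInt a z)) := by
        gcongr
    _ = _ := by rw [varDensity]; field_simp; ring

lemma tendsto_energy_one {u a : ℝ} (hu : 0 < u) (ha0 : 0 ≤ a) (ha1 : a < 1) {A G : ℝ → ℝ}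
    (hA : IsRadialPair u a A G) (hlim : Tendsto A (𝓝[>] 1) (𝓝 (1 / √2))) :
    Tendsto (energy u a A G) (𝓝[>] 1) (𝓝 (2 / π ^ 2)) := by
  have := ((tendsto_crossWronskian_J hu ha0 ha1 hA hlim).pow 2).add
    ((tendsto_crossWronskian_Y hu ha0 ha1 hA hlim).pow 2)
  refine this.trans_eq ?_
  congr 1
  rw [neg_sq, mul_pow, div_pow, div_pow, Real.sq_sqrt zero_le_two]
  field_simp
  norm_num

lemma hasDerivAt_energy_mul_exp {u a : ℝ} (ha0 : 0 ≤ a) (ha1 : a < 1) {A G : ℝ → ℝ} (c : ℝ)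
    {z F' : ℝ} (hz : 1 < z) (hF : HasDerivAt (energy u a A G) F' z) :
    HasDerivAt (fun z => energy u a A G z * exp (c * varInt a z))
      ((F' + c * varDensity a z * energy u a A G z) * exp (c * varInt a z)) z := by
  refine (hF.mul ((hasDerivAt_varInt ha0 ha1 hz).const_mul c).exp).congr_deriv ?_
  ring

lemma tendsto_energy_mul_exp {u a : ℝ} (hu : 0 < u) (ha0 : 0 ≤ a) (ha1 : a < 1) {A G : ℝ → ℝ}
    (hA : IsRadialPair u a A G) (hlim : Tendsto A (𝓝[>] 1) (𝓝 (1 / √2))) (c : ℝ) :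
    Tendsto (fun z => energy u a A G z * exp (c * varInt a z)) (𝓝[>] 1) (𝓝 (2 / π ^ 2)) := by
  have h := (Real.continuous_exp.tendsto _).comp ((tendsto_varInt_one ha0 ha1).const_mul c)
  refine ((tendsto_energy_one hu ha0 ha1 hA hlim).mul h).trans_eq (by simp)

/-- The energy changes by a factor of at most `exp (4 𝒱 / u)` from its value `2/π²` at `z = 1`. -/
lemma energy_bounds {u a : ℝ} (hu : 0 < u) (ha0 : 0 ≤ a) (ha1 : a < 1) {A G : ℝ → ℝ}
    (hA : IsRadialPair u a A G) (hlim : Tendsto A (𝓝[>] 1) (𝓝 (1 / √2))) {z : ℝ} (hz : 1 < z) :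
    energy u a A G z ≤ 2 / π ^ 2 * exp (4 / u * totalVariation a) ∧
      2 / π ^ 2 * exp (-(4 / u * totalVariation a)) ≤ energy u a A G z := by
  choose! F' hF' hF'le using fun z (hz : 1 < z) => abs_deriv_energy_le hu ha0 ha1 hA hz
  have hV := varInt_le ha0 ha1 hz
  have hu4 : 0 < 4 / u := by positivity
  have hnear : ∀ᶠ t : ℝ in 𝓝[>] 1, t ∈ Ioc 1 z := Ioc_mem_nhdsGT hz
  constructor
  · have hanti : AntitoneOn (fun z => energy u a A G z * exp (-(4 / u) * varInt a z)) (Ioi 1) := by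
      have hd := fun z (hz : 1 < z) => hasDerivAt_energy_mul_exp ha0 ha1 (-(4 / u)) hz (hF' z hz)
      refine antitoneOn_of_deriv_nonpos (convex_Ioi _)
        (fun x hx => (hd x hx).continuousAt.continuousWithinAt) ?_ ?_
      · exact fun x hx => (hd x (interior_subset hx)).differentiableAt.differentiableWithinAt
      · intro x hx
        rw [(hd x (interior_subset hx)).deriv]
        have := (abs_le.1 (hF'le x (interior_subset hx))).2
        exact mul_nonpos_of_nonpos_of_nonneg (by linarith) (exp_pos _).le
    have h1 : energy u a A G z * exp (-(4 / u) * varInt a z) ≤ 2 / π ^ 2 := by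
      refine ge_of_tendsto (tendsto_energy_mul_exp hu ha0 ha1 hA hlim (-(4 / u))) ?_
      filter_upwards [hnear] with t ht
      exact hanti ht.1 hz ht.2
    calc energy u a A G z
        = energy u a A G z * exp (-(4 / u) * varInt a z) * exp (4 / u * varInt a z) := by
          rw [mul_assoc, ← Real.exp_add]
          ring_nf
          simp
      _ ≤ 2 / π ^ 2 * exp (4 / u * totalVariation a) := by gcongr
  · have hmono : MonotoneOn (fun z => energy u a A G z * exp ((4 / u) * varInt a z)) (Ioi 1) := by
      have hd := fun z (hz : 1 < z) => hasDerivAt_energy_mul_exp ha0 ha1 (4 / u) hz (hF' z hz)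
      refine monotoneOn_of_deriv_nonneg (convex_Ioi _)
        (fun x hx => (hd x hx).continuousAt.continuousWithinAt) ?_ ?_
      · exact fun x hx => (hd x (interior_subset hx)).differentiableAt.differentiableWithinAt
      · intro x hx
        rw [(hd x (interior_subset hx)).deriv]
        have := (abs_le.1 (hF'le x (interior_subset hx))).1
        exact mul_nonneg (by linarith) (exp_pos _).le
    have h1 : 2 / π ^ 2 ≤ energy u a A G z * exp ((4 / u) * varInt a z) := by
      refine le_of_tendsto (tendsto_energy_mul_exp hu ha0 ha1 hA hlim (4 / u)) ?_
      filter_upwards [hnear] with t ht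
      exact hmono ht.1 hz ht.2
    calc 2 / π ^ 2 * exp (-(4 / u * totalVariation a))
        ≤ energy u a A G z * exp ((4 / u) * varInt a z) * exp (-(4 / u * varInt a z)) := by
          have := (show (0 : ℝ) ≤ 2 / π ^ 2 by positivity).trans h1
          gcongr
      _ = energy u a A G z := by
          rw [mul_assoc, ← Real.exp_add]
          simp

/-- The derivative of `crossWronskian`. -/
noncomputable def crossDensity (u a : ℝ) (A B : ℝ → ℝ) (z : ℝ) : ℝ :=
  -(4 * (z - a) * psiZ a z * amp a z * B (u * phaseInt a z) * A z)

lemma continuousOn_crossDensity {u a : ℝ} (hu : 0 < u) (ha0 : 0 ≤ a) (ha1 : a < 1) {A G B b : ℝ → ℝ}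
    (hA : IsRadialPair u a A G) (hB : IsBesselPair B b) :
    ContinuousOn (crossDensity u a A B) (Ioi 1) := by
  have h1 : ContinuousOn (amp a) (Ioi 1) := fun z hz =>
    (hasDerivAt_amp ha0 ha1 hz).continuousAt.continuousWithinAt
  have h2 : ContinuousOn (fun z => B (u * phaseInt a z)) (Ioi 1) := fun z hz =>
    (hB.hasDerivAt_comp hu ha0 ha1 hz).1.continuousAt.continuousWithinAt
  have h3 : ContinuousOn A (Ioi 1) := fun z hz => (hA z hz).1.continuousAt.continuousWithinAt
  have h4 := continuousOn_psiZ ha0 ha1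
  exact (((((continuousOn_const.mul (continuousOn_id.sub continuousOn_const)).mul h4).mul h1).mul
    h2).mul h3).neg

lemma abs_crossDensity_le {u a : ℝ} (hu : 0 < u) (ha0 : 0 ≤ a) (ha1 : a < 1) (A G : ℝ → ℝ)
    {B : ℝ → ℝ} (hBb : ∀ x, 0 < x → B x ^ 2 ≤ 2 / (π * x)) {z : ℝ} (hz : 1 < z) :
    |crossDensity u a A B z| ≤ 2 / u * √(energy u a A G z) * varDensity a z := by
  have hX := phaseInt_pos ha0 ha1 hz
  have hs := sqrtF_pos ha1 hz
  have hm := amp_pos ha0 ha1 hz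
  have h1 := sq_div_amp_le hu ha0 ha1 A G hz
  have hb := hBb _ (mul_pos hu hX)
  have hF := energy_nonneg u a A G z
  have h3 : |A z / amp a z * B (u * phaseInt a z)| ≤ √(energy u a A G z) / (u * phaseInt a z) := by
    refine abs_le_of_sq_le_sq ?_ (by positivity)
    rw [mul_pow, div_pow _ (u * phaseInt a z), Real.sq_sqrt hF]
    calc (A z / amp a z) ^ 2 * B (u * phaseInt a z) ^ 2
        ≤ (π / (2 * u * phaseInt a z) * energy u a A G z) * (2 / (π * (u * phaseInt a z))) := by
          gcongr
      _ = _ := by field_simp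
  have h4 := amp_sq_mul' ha0 ha1 hz
  have h5 : crossDensity u a A B z = -4 * ((z - a) * amp a z ^ 2) * psiZ a z *
      (A z / amp a z * B (u * phaseInt a z)) := by
    rw [crossDensity]; field_simp
  rw [h5, h4, abs_mul, abs_mul, abs_mul, abs_of_pos (mul_pos hX hs)]
  rw [show |(-4 : ℝ)| = 4 by norm_num]
  calc 4 * (phaseInt a z * sqrtF a z) * |psiZ a z| * |A z / amp a z * B (u * phaseInt a z)|
      ≤ 4 * (phaseInt a z * sqrtF a z) * |psiZ a z| * (√(energy u a A G z) / (u * phaseInt a z)) := by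
        gcongr
    _ = _ := by rw [varDensity]; field_simp; ring

lemma integrableOn_crossDensity {u a : ℝ} (hu : 0 < u) (ha0 : 0 ≤ a) (ha1 : a < 1)
    {A G B b : ℝ → ℝ} (hA : IsRadialPair u a A G) (hlim : Tendsto A (𝓝[>] 1) (𝓝 (1 / √2)))
    (hB : IsBesselPair B b) (hBb : ∀ x, 0 < x → B x ^ 2 ≤ 2 / (π * x)) :
    IntegrableOn (crossDensity u a A B) (Ioi 1) := by
  refine Integrable.mono' ((integrableOn_varDensity ha0 ha1).const_mul
    (2 / u * √(2 / π ^ 2 * exp (4 / u * totalVariation a))))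
    ((continuousOn_crossDensity hu ha0 ha1 hA hB).aestronglyMeasurable measurableSet_Ioi) ?_
  filter_upwards [ae_restrict_mem measurableSet_Ioi] with z hz
  refine (abs_crossDensity_le hu ha0 ha1 A G hBb hz).trans ?_
  have := (energy_bounds hu ha0 ha1 hA hlim hz).1
  have h2 := varDensity_nonneg a z
  gcongr

lemma crossWronskian_eq_integral {u a : ℝ} (hu : 0 < u) (ha0 : 0 ≤ a) (ha1 : a < 1)
    {A G B b : ℝ → ℝ} (hA : IsRadialPair u a A G) (hB : IsBesselPair B b) {l : ℝ}
    (hint : IntegrableOn (crossDensity u a A B) (Ioi 1))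
    (hl : Tendsto (crossWronskian u a A G B b) (𝓝[>] 1) (𝓝 l)) {z : ℝ} (hz : 1 < z) :
    crossWronskian u a A G B b z = l + ∫ t in Ioo 1 z, crossDensity u a A B t := by
  have hd := fun z (hz : 1 < z) => hasDerivAt_crossWronskian hu ha0 ha1 hA hB hz
  have h := intervalIntegral.integral_eq_sub_of_hasDerivAt_of_tendsto hz
    (fun t ht => hd t ht.1) ?_ hl
    ((hd z hz).continuousAt.tendsto.mono_left nhdsWithin_le_nhds)
  · rw [← integral_Ioc_eq_integral_Ioo, ← intervalIntegral.integral_of_le hz.le]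
    simp only [crossDensity]
    rw [h]; ring
  · rw [intervalIntegrable_iff_integrableOn_Ioc_of_le hz.le]
    exact hint.mono_set Ioc_subset_Ioi_self

lemma besselJ0_sq_le {x : ℝ} (hx : 0 < x) : besselJ0 x ^ 2 ≤ 2 / (π * x) := by
  nlinarith [bessel_sq_add_sq_le hx, sq_nonneg (besselY0 x)]

lemma besselY0_sq_le {x : ℝ} (hx : 0 < x) : besselY0 x ^ 2 ≤ 2 / (π * x) := by
  nlinarith [bessel_sq_add_sq_le hx, sq_nonneg (besselJ0 x)]

lemma bigW_zetaOf {a : ℝ} (ha0 : 0 ≤ a) (ha1 : a < 1) (A : ℝ → ℝ) {z : ℝ} (hz : 1 < z) :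
    bigW a A (zetaOf a z) = √2 * phaseInt a z * (A z / amp a z) := by
  have hX := phaseInt_pos ha0 ha1 hz
  have hs := sqrtF_pos ha1 hz
  have hm := amp_pos ha0 ha1 hz
  have hD : 0 < z ^ 2 - 1 := by nlinarith
  have hN : 0 < z - a := by linarith
  rw [bigW, zOf_zetaOf ha0 ha1 hz, zetaOf, abs_neg, abs_of_nonneg (sq_nonneg _)]
  have h1 : (4 * phaseInt a z ^ 2 * coefF a 0 z) ^ (1 / 4 : ℝ) = √(2 * phaseInt a z * sqrtF a z) := by
    have h2 : 4 * phaseInt a z ^ 2 * coefF a 0 z = (2 * phaseInt a z * sqrtF a z) ^ (2 : ℝ) := by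
      rw [Real.rpow_two, mul_pow, mul_pow, sqrtF_sq ha1 hz, coefF_eq a hz]
      ring
    rw [h2, ← Real.rpow_mul (by positivity), Real.sqrt_eq_rpow]
    norm_num
  have h3 : √(2 * phaseInt a z * sqrtF a z) * √(z ^ 2 - 1) = √2 * phaseInt a z / amp a z := by
    have h4 : 0 ≤ √2 * phaseInt a z / amp a z := by positivity
    rw [← Real.sqrt_mul (by positivity), ← Real.sqrt_sq h4]
    congr 1
    rw [div_pow, mul_pow, Real.sq_sqrt zero_le_two]
    have := amp_sq_mul ha0 ha1 hz
    field_simp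
    linear_combination this
  rw [h1, ← mul_assoc, h3]
  ring

lemma kernel_zetaOf {u a : ℝ} (ha0 : 0 ≤ a) (ha1 : a < 1) {z t : ℝ} (hz : 1 < z) (ht : 1 < t) :
    kernel u (zetaOf a z) (zetaOf a t) = π * phaseInt a z *
      (besselJ0 (u * phaseInt a z) * besselY0 (u * phaseInt a t) -
        besselY0 (u * phaseInt a z) * besselJ0 (u * phaseInt a t)) := by
  rw [kernel, sqrt_abs_zetaOf ha0 ha1 hz, sqrt_abs_zetaOf ha0 ha1 ht]

lemma eps_add (u a : ℝ) (A : ℝ → ℝ) (v : ℝ) :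
    eps u a A v + √|v| * besselJ0 (u * √|v|) = bigW a A v := by
  rw [eps]; ring

/-- The integrand of the Volterra equation in terms of `z`. -/
lemma volterra_integrand {u a : ℝ} (ha0 : 0 ≤ a) (ha1 : a < 1) (A : ℝ → ℝ) {z t : ℝ} (hz : 1 < z)
    (ht : 1 < t) :
    |-(2 * phaseInt a t * sqrtF a t)| • (kernel u (zetaOf a z) (zetaOf a t) *
      (psi a (zetaOf a t) / √|zetaOf a t|) * (eps u a A (zetaOf a t) +
        √|zetaOf a t| * besselJ0 (u * √|zetaOf a t|))) =
    -(π / √2) * phaseInt a z * (besselJ0 (u * phaseInt a z) * crossDensity u a A besselY0 t -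
      besselY0 (u * phaseInt a z) * crossDensity u a A besselJ0 t) := by
  have hX := phaseInt_pos ha0 ha1 ht
  have hm := amp_pos ha0 ha1 ht
  have h4 := amp_sq_mul' ha0 ha1 ht
  rw [eps_add, abs_deriv_zetaOf ha0 ha1 ht, kernel_zetaOf ha0 ha1 hz ht, psi_zetaOf ha0 ha1 ht,
    bigW_zetaOf ha0 ha1 A ht, sqrt_abs_zetaOf ha0 ha1 ht, smul_eq_mul, crossDensity, crossDensity]
  have h2 : √2 ^ 2 = 2 := Real.sq_sqrt zero_le_two
  have h5 : t - a = phaseInt a t * sqrtF a t / amp a t ^ 2 := by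
    field_simp; linear_combination h4
  rw [h5]
  field_simp
  rw [h2]
  ring

/-- The Volterra equation: integrate the derivatives of the Wronskians with `J₀` and `Y₀`, and
recover the solution from the Wronskians. -/
lemma volterra_equation {u a : ℝ} (hu : 0 < u) (ha0 : 0 ≤ a) (ha1 : a < 1) {A G : ℝ → ℝ}
    (hA : IsRadialPair u a A G) (hlim : Tendsto A (𝓝[>] 1) (𝓝 (1 / √2))) {ζ : ℝ} (hζ : ζ < 0) :
    IntegrableOn (fun v : ℝ => kernel u ζ v * (psi a v / √|v|) *
      (eps u a A v + √|v| * besselJ0 (u * √|v|))) (Ioo ζ 0) ∧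
    eps u a A ζ = ∫ v in Ioo ζ 0, kernel u ζ v * (psi a v / √|v|) *
      (eps u a A v + √|v| * besselJ0 (u * √|v|)) := by
  obtain ⟨z, hz, rfl⟩ := exists_zetaOf_eq ha0 ha1 hζ
  have hder : ∀ t ∈ Ioo 1 z, HasDerivWithinAt (zetaOf a) (-(2 * phaseInt a t * sqrtF a t))
      (Ioo 1 z) t := fun t ht => (hasDerivAt_zetaOf ha0 ha1 ht.1).hasDerivWithinAt
  have hinj : InjOn (zetaOf a) (Ioo 1 z) := (injOn_zetaOf ha0 ha1).mono fun t ht => ht.1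
  have hiJ := integrableOn_crossDensity hu ha0 ha1 hA hlim isBesselPair_J fun _ => besselJ0_sq_le
  have hiY := integrableOn_crossDensity hu ha0 ha1 hA hlim isBesselPair_Y fun _ => besselY0_sq_le
  have hiJ' := hiJ.mono_set (Ioo_subset_Ioi_self : Ioo 1 z ⊆ Ioi 1)
  have hiY' := hiY.mono_set (Ioo_subset_Ioi_self : Ioo 1 z ⊆ Ioi 1)
  constructor
  · rw [← image_zetaOf_Ioo ha0 ha1 hz, integrableOn_image_iff_integrableOn_abs_deriv_smul
      measurableSet_Ioo hder hinj]
    have : IntegrableOn (fun t => -(π / √2) * phaseInt a z * (besselJ0 (u * phaseInt a z) *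
        crossDensity u a A besselY0 t - besselY0 (u * phaseInt a z) *
          crossDensity u a A besselJ0 t)) (Ioo 1 z) :=
      ((hiY'.const_mul _).sub (hiJ'.const_mul _)).const_mul _
    exact this.congr_fun (fun t ht => (volterra_integrand ha0 ha1 A hz ht.1).symm) measurableSet_Ioo
  · rw [← image_zetaOf_Ioo ha0 ha1 hz, integral_image_eq_integral_abs_deriv_smul
      measurableSet_Ioo hder hinj, setIntegral_congr_fun measurableSet_Ioo
      fun t ht => volterra_integrand ha0 ha1 A hz ht.1, integral_const_mul,
      integral_sub (hiY'.const_mul _) (hiJ'.const_mul _), integral_const_mul, integral_const_mul]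
    have eJ := crossWronskian_eq_integral hu ha0 ha1 hA isBesselPair_J hiJ
      (tendsto_crossWronskian_J hu ha0 ha1 hA hlim) hz
    have eY := crossWronskian_eq_integral hu ha0 ha1 hA isBesselPair_Y hiY
      (tendsto_crossWronskian_Y hu ha0 ha1 hA hlim) hz
    have h := crossWronskian_identity u (a := a) A G z
    rw [eJ, eY] at h
    rw [eps, bigW_zetaOf ha0 ha1 A hz, sqrt_abs_zetaOf ha0 ha1 hz]
    have h2 : √2 ^ 2 = 2 := Real.sq_sqrt zero_le_two
    have hm := amp_pos ha0 ha1 hz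
    have h6 : A z / amp a z = π / √2 ^ 2 * (2 / π * (A z / amp a z)) := by
      rw [h2]; field_simp
    rw [h6, ← neg_eq_iff_eq_neg.2 h]
    generalize besselJ0 (u * phaseInt a z) = J
    generalize besselY0 (u * phaseInt a z) = Y
    field_simp
    linear_combination (-(phaseInt a z * J)) * h2

/-! ### Bounds for the error -/

lemma P0_pos {u v : ℝ} (hu : 0 < u) (hv : v < 0) : 0 < P0 u v := by
  have : 0 < u * √|v| := mul_pos hu (Real.sqrt_pos.2 (abs_pos.2 hv.ne))
  exact div_pos (modulusM0_pos this) (weightE0_pos this)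

lemma Q_pos {u v : ℝ} (hu : 0 < u) (hv : v < 0) : 0 < Q u v := by
  have h1 : 0 < √|v| := Real.sqrt_pos.2 (abs_pos.2 hv.ne)
  have : 0 < u * √|v| := mul_pos hu h1
  exact mul_pos (mul_pos (mul_pos pi_pos h1) (modulusM0_pos this)) (weightE0_pos this)

lemma P0_mul_Q_le {u v : ℝ} (hu : 0 < u) (hv : v < 0) : P0 u v * Q u v ≤ lambda00 / u := by
  have h1 : 0 < √|v| := Real.sqrt_pos.2 (abs_pos.2 hv.ne)
  have h2 : 0 < u * √|v| := mul_pos hu h1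
  have h3 := le_lambda00 h2
  have h4 := weightE0_pos h2
  rw [le_div_iff₀ hu, P0, Q]
  refine le_trans (le_of_eq ?_) h3
  field_simp

lemma Q_mul_abs_le {u v : ℝ} (hu : 0 < u) (hv : v < 0) :
    Q u v * |besselJ0 (u * √|v|)| ≤ lambda01 / u := by
  have h1 : 0 < √|v| := Real.sqrt_pos.2 (abs_pos.2 hv.ne)
  have h3 := le_lambda01 (mul_pos hu h1)
  rw [le_div_iff₀ hu, Q]
  refine le_trans (le_of_eq ?_) h3
  ring

lemma bddAbove_kappa0 {u : ℝ} (hu : 0 < u) (ζ : ℝ) :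
    BddAbove ((fun v => P0 u v * Q u v) '' Ico ζ 0) :=
  ⟨lambda00 / u, by rintro _ ⟨v, hv, rfl⟩; exact P0_mul_Q_le hu hv.2⟩

lemma bddAbove_kappa {u : ℝ} (hu : 0 < u) (ζ : ℝ) :
    BddAbove ((fun v => Q u v * |besselJ0 (u * √|v|)|) '' Ico ζ 0) :=
  ⟨lambda01 / u, by rintro _ ⟨v, hv, rfl⟩; exact Q_mul_abs_le hu hv.2⟩

lemma kappa0_le {u ζ : ℝ} (hu : 0 < u) (hζ : ζ < 0) : kappa0 u ζ ≤ lambda00 / u :=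
  csSup_le ((nonempty_Ico.2 hζ).image _) (by rintro _ ⟨v, hv, rfl⟩; exact P0_mul_Q_le hu hv.2)

lemma kappa_le {u ζ : ℝ} (hu : 0 < u) (hζ : ζ < 0) : kappa u ζ ≤ lambda01 / u :=
  csSup_le ((nonempty_Ico.2 hζ).image _) (by rintro _ ⟨v, hv, rfl⟩; exact Q_mul_abs_le hu hv.2)

lemma kappa0_pos {u ζ : ℝ} (hu : 0 < u) (hζ : ζ < 0) : 0 < kappa0 u ζ :=
  (mul_pos (P0_pos hu hζ) (Q_pos hu hζ)).trans_le
    (le_csSup (bddAbove_kappa0 hu ζ) ⟨ζ, ⟨le_rfl, hζ⟩, rfl⟩)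

lemma abs_besselJ0_le_P0 {x : ℝ} (hx : 0 < x) : |besselJ0 x| ≤ modulusM0 x / weightE0 x := by
  rcases le_or_gt x besselX0 with h | h
  · have h1 := besselJ0_pos hx.le h
    rw [modulus_div_weight_of_le hx h, abs_of_pos h1]
    exact le_mul_of_one_le_left h1.le (Real.one_le_sqrt.2 one_le_two)
  · rw [modulusM0_of_gt h, weightE0_of_gt h, div_one]
    refine Real.abs_le_sqrt ?_
    nlinarith [sq_nonneg (besselY0 x)]

/-- `M₀ / E₀` is bounded below on bounded intervals. -/
lemma exists_le_modulus_div_weight (R : ℝ) :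
    ∃ c : ℝ, 0 < c ∧ ∀ x, 0 < x → x ≤ R → c ≤ modulusM0 x / weightE0 x := by
  obtain ⟨x₁, hx₁, h1⟩ := isCompact_Icc.exists_isMinOn (nonempty_Icc.2 besselX0_pos.le)
    (continuous_besselJ0.continuousOn (s := Icc 0 besselX0))
  have hJ := besselJ0_pos hx₁.1 hx₁.2
  have hle : besselX0 ≤ max R besselX0 := le_max_right _ _
  have hcont : ContinuousOn (fun x => √(besselJ0 x ^ 2 + besselY0 x ^ 2))
      (Icc besselX0 (max R besselX0)) := by
    have hY : ContinuousOn besselY0 (Icc besselX0 (max R besselX0)) :=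
      isBesselPair_Y.continuousOn.mono fun t ht => besselX0_pos.trans_le ht.1
    exact ((continuous_besselJ0.continuousOn.pow 2).add (hY.pow 2)).sqrt
  obtain ⟨x₂, hx₂, h2⟩ := isCompact_Icc.exists_isMinOn (nonempty_Icc.2 hle) hcont
  refine ⟨min (besselJ0 x₁) (√(besselJ0 x₂ ^ 2 + besselY0 x₂ ^ 2)),
    lt_min hJ (Real.sqrt_pos.2 (bessel_sq_pos _)), fun x hx hxR => ?_⟩
  rcases le_or_gt x besselX0 with h | h
  · refine (min_le_left _ _).trans ((h1 (show x ∈ Icc 0 besselX0 from ⟨hx.le, h⟩)).trans ?_)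
    rw [modulus_div_weight_of_le hx h]
    exact le_mul_of_one_le_left (besselJ0_pos hx.le h).le (Real.one_le_sqrt.2 one_le_two)
  · refine (min_le_right _ _).trans ((h2 (show x ∈ Icc besselX0 (max R besselX0) from
      ⟨h.le, hxR.trans (le_max_left _ _)⟩)).trans ?_)
    rw [modulusM0_of_gt h, weightE0_of_gt h, div_one]

/-- The ratio `A / amp` is bounded on `(1, z]`; the Grönwall argument needs this. -/
lemma exists_abs_le {u a : ℝ} (ha0 : 0 ≤ a) (ha1 : a < 1) {A G : ℝ → ℝ}
    (hA : IsRadialPair u a A G) (hlim : Tendsto A (𝓝[>] 1) (𝓝 (1 / √2))) (z : ℝ) :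
    ∃ C : ℝ, 0 ≤ C ∧ ∀ t, 1 < t → t ≤ z → |A t / amp a t| ≤ C := by
  obtain ⟨δ, hδ, hδ1, h⟩ := recessive_near_one ha0 ha1 hA hlim
  have hcont : ContinuousOn A (Icc (1 + δ / 2) z) := fun t ht =>
    (hA t (by linarith [ht.1])).1.continuousAt.continuousWithinAt
  obtain ⟨C, hC⟩ := isCompact_Icc.exists_bound_of_continuousOn hcont
  have hc : 0 < 1 - a := by linarith
  have hA' : ∀ t, 1 < t → t ≤ z → |A t| ≤ max C 1 := fun t ht htz => by
    rcases lt_or_ge t (1 + δ) with h1 | h1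
    · exact (h t ht h1).1.trans (le_max_right _ _)
    · exact (hC t ⟨by linarith, htz⟩).trans (le_max_left _ _)
  have hC0 : 0 ≤ max C 1 := zero_le_one.trans (le_max_right _ _)
  refine ⟨max C 1 * √(1 + |z| * ((|z| + 2) / (4 * (1 - a)))), by positivity,
    fun t ht htz => ?_⟩
  have hm := amp_pos ha0 ha1 ht
  have h2 : (amp a t)⁻¹ ≤ √(1 + |z| * ((|z| + 2) / (4 * (1 - a)))) := by
    refine Real.le_sqrt_of_sq_le ?_
    rw [inv_amp_sq_eq ha0 ha1 ht]
    refine (inv_amp_sq_bounds ha0 ha1 ht).2.trans ?_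
    have := le_abs_self z
    gcongr
    · linarith
    · linarith
  rw [div_eq_mul_inv, abs_mul, abs_of_pos (inv_pos.2 hm)]
  exact mul_le_mul (hA' t ht htz) h2 (inv_nonneg.2 hm.le) hC0

lemma integral_exp_varInt {a : ℝ} (ha0 : 0 ≤ a) (ha1 : a < 1) {b : ℝ} (hb : 0 < b) {z : ℝ}
    (hz : 1 < z) : IntegrableOn (fun t => b * exp (b * varInt a t) * varDensity a t) (Ioo 1 z) ∧
    ∫ t in Ioo 1 z, b * exp (b * varInt a t) * varDensity a t = exp (b * varInt a z) - 1 := by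
  have hd : ∀ t, 1 < t → HasDerivAt (fun t => exp (b * varInt a t))
      (b * exp (b * varInt a t) * varDensity a t) t := fun t ht =>
    ((hasDerivAt_varInt ha0 ha1 ht).const_mul b).exp.congr_deriv (by ring)
  have hint : IntegrableOn (fun t => b * exp (b * varInt a t) * varDensity a t) (Ioi 1) := by
    refine Integrable.mono' ((integrableOn_varDensity ha0 ha1).const_mul
      (b * exp (b * totalVariation a))) (ContinuousOn.aestronglyMeasurable ?_ measurableSet_Ioi) ?_
    · refine ContinuousOn.mul (continuousOn_const.mul fun t ht => ?_)
        (continuousOn_varDensity ha0 ha1)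
      exact (hd t ht).continuousAt.continuousWithinAt
    · filter_upwards [ae_restrict_mem measurableSet_Ioi] with t ht
      have h1 := varInt_le ha0 ha1 ht
      have h2 := varDensity_nonneg a t
      rw [Real.norm_of_nonneg (by positivity)]
      gcongr
  refine ⟨hint.mono_set Ioo_subset_Ioi_self, ?_⟩
  have hl : Tendsto (fun t => exp (b * varInt a t)) (𝓝[>] 1) (𝓝 1) := by
    have := (Real.continuous_exp.tendsto _).comp ((tendsto_varInt_one ha0 ha1).const_mul b)
    refine this.trans_eq (by simp)
  have h := intervalIntegral.integral_eq_sub_of_hasDerivAt_of_tendsto hz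
    (fun t ht => hd t ht.1) ?_ hl ((hd z hz).continuousAt.tendsto.mono_left nhdsWithin_le_nhds)
  · rw [← integral_Ioc_eq_integral_Ioo, ← intervalIntegral.integral_of_le hz.le, h]
  · rw [intervalIntegrable_iff_integrableOn_Ioc_of_le hz.le]
    exact hint.mono_set Ioc_subset_Ioi_self

/-- A Grönwall inequality for a bounded function that need not be measurable. If `S` is the supremum
of the positive part of `e - (k / k₀)(exp (k₀ 𝒱) - 1)`, weighted by `exp (-2 k₀ 𝒱)`, then inserting
this bound in the hypothesis gives it with `S / 2` in place of `S`. -/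
lemma gronwall_varInt {a : ℝ} (ha0 : 0 ≤ a) (ha1 : a < 1) {k₀ k : ℝ} (hk₀ : 0 < k₀)
    {e : ℝ → ℝ} {z : ℝ} {C : ℝ} (hC : ∀ t, 1 < t → t ≤ z → e t ≤ C)
    (h : ∀ (g : ℝ → ℝ), (∀ t, 1 < t → t ≤ z → e t ≤ g t) → ∀ t, 1 < t → t ≤ z →
      IntegrableOn (fun s => (k₀ * g s + k) * varDensity a s) (Ioo 1 t) →
        e t ≤ ∫ s in Ioo 1 t, (k₀ * g s + k) * varDensity a s) (hz : 1 < z) :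
    e z ≤ k / k₀ * (exp (k₀ * varInt a z) - 1) := by
  set d : ℝ → ℝ := fun t => (e t - k / k₀ * (exp (k₀ * varInt a t) - 1)) *
    exp (-(2 * k₀ * varInt a t)) with hd
  set T : Set ℝ := insert 0 (d '' Ioc 1 z) with hT
  have hbdd : BddAbove T := by
    refine BddAbove.insert _ ⟨|C| + |k / k₀| * exp (k₀ * totalVariation a), ?_⟩
    rintro _ ⟨t, ht, rfl⟩
    have h1 : exp (-(2 * k₀ * varInt a t)) ≤ 1 := by
      rw [Real.exp_le_one_iff]
      have := varInt_nonneg (a := a) ht.1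
      nlinarith
    have h2 : e t ≤ |C| := (hC t ht.1 ht.2).trans (le_abs_self C)
    have h3 : -(k / k₀ * (exp (k₀ * varInt a t) - 1)) ≤
        |k / k₀| * exp (k₀ * totalVariation a) := by
      have h4 : 1 ≤ exp (k₀ * varInt a t) :=
        Real.one_le_exp (mul_nonneg hk₀.le (varInt_nonneg ht.1))
      have h5 : exp (k₀ * varInt a t) ≤ exp (k₀ * totalVariation a) := by
        have := varInt_le ha0 ha1 ht.1
        gcongr
      calc -(k / k₀ * (exp (k₀ * varInt a t) - 1)) = -(k / k₀) * (exp (k₀ * varInt a t) - 1) := by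
            ring
        _ ≤ |k / k₀| * (exp (k₀ * varInt a t) - 1) := by
            have := neg_le_abs (k / k₀)
            gcongr
        _ ≤ _ := by gcongr; linarith
    have h6 : 0 ≤ |C| + |k / k₀| * exp (k₀ * totalVariation a) := by positivity
    calc d t ≤ (|C| + |k / k₀| * exp (k₀ * totalVariation a)) * exp (-(2 * k₀ * varInt a t)) := by
          simp only [hd]
          gcongr
          linarith
      _ ≤ _ := mul_le_of_le_one_right h6 h1
  set S := sSup T with hS
  have hS0 : 0 ≤ S := le_csSup hbdd (mem_insert _ _)
  have hle : ∀ s, 0 ≤ s → (∀ t, 1 < t → t ≤ z → d t ≤ s) → ∀ t, 1 < t → t ≤ z →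
      e t ≤ k / k₀ * (exp (k₀ * varInt a t) - 1) + s * exp (2 * k₀ * varInt a t) := by
    intro s _ hs t ht htz
    have h1 := hs t ht htz
    simp only [hd] at h1
    rw [Real.exp_neg, ← div_eq_mul_inv, div_le_iff₀ (exp_pos _)] at h1
    linarith
  have h1 := hle S hS0 fun t ht htz => le_csSup hbdd (mem_insert_of_mem _ ⟨t, ⟨ht, htz⟩, rfl⟩)
  have h2 : ∀ t, 1 < t → t ≤ z → d t ≤ S / 2 := fun t ht htz => by
    obtain ⟨i1, e1⟩ := integral_exp_varInt ha0 ha1 hk₀ ht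
    obtain ⟨i2, e2⟩ := integral_exp_varInt ha0 ha1 (mul_pos two_pos hk₀) ht
    have hfun : (fun s => (k₀ * (k / k₀ * (exp (k₀ * varInt a s) - 1) +
        S * exp (2 * k₀ * varInt a s)) + k) * varDensity a s) = fun s =>
        k / k₀ * (k₀ * exp (k₀ * varInt a s) * varDensity a s) +
        S / 2 * (2 * k₀ * exp (2 * k₀ * varInt a s) * varDensity a s) := by
      funext s
      field_simp
      ring
    have h3 := h _ h1 t ht htz
    rw [hfun] at h3
    have i3 : IntegrableOn (fun s => k / k₀ * (k₀ * exp (k₀ * varInt a s) * varDensity a s) +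
        S / 2 * (2 * k₀ * exp (2 * k₀ * varInt a s) * varDensity a s)) (Ioo 1 t) :=
      (i1.const_mul _).add (i2.const_mul _)
    have h4 := h3 i3
    rw [integral_add (i1.const_mul _) (i2.const_mul _), integral_const_mul, integral_const_mul, e1,
      e2] at h4
    simp only [hd]
    rw [Real.exp_neg, ← div_eq_mul_inv, div_le_iff₀ (exp_pos _)]
    linarith
  have h3 : S ≤ S / 2 := by
    refine csSup_le (insert_nonempty _ _) ?_
    rintro _ (rfl | ⟨t, ht, rfl⟩)
    · linarith
    · exact h2 t ht.1 ht.2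
  have h4 : S = 0 := by linarith
  have h5 := h1 z hz le_rfl
  rw [h4] at h5
  linarith

/-- The Volterra integrand in terms of `z`, with the kernel bounded by `P₀(ζ) Q(v)` and `|J₀|`, `|ε|`
separated. -/
lemma abs_volterra_integrand_le {u a : ℝ} (hu : 0 < u) (ha0 : 0 ≤ a) (ha1 : a < 1) (A : ℝ → ℝ)
    {z t : ℝ} (ht : 1 < t) (htz : t < z) :
    |(|-(2 * phaseInt a t * sqrtF a t)| • (kernel u (zetaOf a z) (zetaOf a t) *
      (psi a (zetaOf a t) / √|zetaOf a t|) * (eps u a A (zetaOf a t) +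
        √|zetaOf a t| * besselJ0 (u * √|zetaOf a t|))))| ≤
    P0 u (zetaOf a z) * phaseInt a z *
      ((P0 u (zetaOf a t) * Q u (zetaOf a t) *
          (|eps u a A (zetaOf a t)| / (P0 u (zetaOf a t) * phaseInt a t)) +
        Q u (zetaOf a t) * |besselJ0 (u * √|zetaOf a t|)|) * varDensity a t) := by
  have hz := ht.trans htz
  have hX := phaseInt_pos ha0 ha1 ht
  have hXz := phaseInt_pos ha0 ha1 hz
  have hs := sqrtF_pos ha1 ht
  have hζ := zetaOf_neg ha0 ha1 ht
  have hP := P0_pos hu hζ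
  have hQ := Q_pos hu hζ
  have hXX := strictMonoOn_phaseInt ha0 ha1 ht hz htz
  have hk := bessel_kernel_le (mul_pos hu hX) (mul_le_mul_of_nonneg_left hXX.le hu.le)
  rw [abs_deriv_zetaOf ha0 ha1 ht, kernel_zetaOf ha0 ha1 hz ht, psi_zetaOf ha0 ha1 ht,
    smul_eq_mul]
  have eP : P0 u (zetaOf a z) =
      modulusM0 (u * phaseInt a z) / weightE0 (u * phaseInt a z) := by
    rw [P0, sqrt_abs_zetaOf ha0 ha1 hz]
  have eQ : Q u (zetaOf a t) = π * phaseInt a t *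
      (modulusM0 (u * phaseInt a t) * weightE0 (u * phaseInt a t)) := by
    rw [Q, sqrt_abs_zetaOf ha0 ha1 ht]; ring
  rw [sqrt_abs_zetaOf ha0 ha1 ht]
  have h1 : |eps u a A (zetaOf a t) + phaseInt a t * besselJ0 (u * phaseInt a t)| ≤
      |eps u a A (zetaOf a t)| + phaseInt a t * |besselJ0 (u * phaseInt a t)| := by
    refine (abs_add_le _ _).trans ?_
    rw [abs_mul, abs_of_pos hX]
  simp only [abs_mul, abs_div, abs_of_pos hX, abs_of_pos hs, abs_of_pos hXz, abs_of_pos pi_pos,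
    abs_two]
  calc _ ≤ 2 * phaseInt a t * sqrtF a t * (π * phaseInt a z *
        (modulusM0 (u * phaseInt a z) / weightE0 (u * phaseInt a z) *
          (modulusM0 (u * phaseInt a t) * weightE0 (u * phaseInt a t))) *
        (|psiZ a t| / phaseInt a t) *
        (|eps u a A (zetaOf a t)| + phaseInt a t * |besselJ0 (u * phaseInt a t)|)) := by
        gcongr
        exact mul_nonneg (mul_nonneg (by positivity) ((abs_nonneg _).trans hk)) (by positivity)
    _ = _ := by
      rw [← eP, eQ, varDensity]
      field_simp

/-- The error bound for any constants `k₀`, `k` that dominate `P₀ Q` and `Q |J₀|`; the two bounds of the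
theorem arise from `(κ₀, κ)` and from `(λ₀₀/u, λ₀₁/u)`. -/
lemma abs_eps_le {u a : ℝ} (hu : 0 < u) (ha0 : 0 ≤ a) (ha1 : a < 1) {A G : ℝ → ℝ}
    (hA : IsRadialPair u a A G) (hlim : Tendsto A (𝓝[>] 1) (𝓝 (1 / √2))) {ζ : ℝ} (hζ : ζ < 0)
    {k₀ k : ℝ} (hk₀ : 0 < k₀) (hk₀' : ∀ v ∈ Ico ζ 0, P0 u v * Q u v ≤ k₀)
    (hk' : ∀ v ∈ Ico ζ 0, Q u v * |besselJ0 (u * √|v|)| ≤ k) :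
    |eps u a A ζ| ≤ P0 u ζ * (√|ζ| * (k / k₀) * (exp (k₀ * variation a ζ) - 1)) := by
  obtain ⟨z, hz, rfl⟩ := exists_zetaOf_eq ha0 ha1 hζ
  have hmem : ∀ t, 1 < t → t ≤ z → zetaOf a t ∈ Ico (zetaOf a z) 0 := fun t ht htz =>
    ⟨(strictAntiOn_zetaOf ha0 ha1).antitoneOn ht hz htz, zetaOf_neg ha0 ha1 ht⟩
  set e : ℝ → ℝ := fun t => |eps u a A (zetaOf a t)| / (P0 u (zetaOf a t) * phaseInt a t) with he
  have hkey : e z ≤ k / k₀ * (exp (k₀ * varInt a z) - 1) := by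
    obtain ⟨c, hc, hcP⟩ := exists_le_modulus_div_weight (u * phaseInt a z)
    obtain ⟨C, hC0, hC⟩ := exists_abs_le ha0 ha1 hA hlim z
    refine gronwall_varInt ha0 ha1 hk₀ (C := √2 * C / c + 1) ?_ ?_ hz
    · intro t ht htz
      have hX := phaseInt_pos ha0 ha1 ht
      have hx := mul_pos hu hX
      have hP := P0_pos hu (zetaOf_neg ha0 ha1 ht)
      have eP : P0 u (zetaOf a t) =
          modulusM0 (u * phaseInt a t) / weightE0 (u * phaseInt a t) := by
        rw [P0, sqrt_abs_zetaOf ha0 ha1 ht]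
      have h1 := hC t ht htz
      have h2 : c ≤ P0 u (zetaOf a t) := by
        rw [eP]
        exact hcP _ hx (mul_le_mul_of_nonneg_left
          ((strictMonoOn_phaseInt ha0 ha1).monotoneOn ht hz htz) hu.le)
      have h3 : |besselJ0 (u * phaseInt a t)| ≤ P0 u (zetaOf a t) := by
        rw [eP]; exact abs_besselJ0_le_P0 hx
      have h4 : |eps u a A (zetaOf a t)| ≤ phaseInt a t * (√2 * C + P0 u (zetaOf a t)) := by
        rw [eps, bigW_zetaOf ha0 ha1 A ht, sqrt_abs_zetaOf ha0 ha1 ht]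
        refine (abs_sub _ _).trans ?_
        rw [abs_mul, abs_mul, abs_mul, abs_of_pos hX, abs_of_pos (by positivity : 0 < √2)]
        calc √2 * phaseInt a t * |A t / amp a t| + phaseInt a t * |besselJ0 (u * phaseInt a t)|
            ≤ √2 * phaseInt a t * C + phaseInt a t * P0 u (zetaOf a t) := by gcongr
          _ = _ := by ring
      have h5 : √2 * C ≤ √2 * C / c * P0 u (zetaOf a t) := by
        rw [div_mul_eq_mul_div, le_div_iff₀ hc]
        gcongr
      simp only [he]
      rw [div_le_iff₀ (by positivity)]
      nlinarith
    · intro g hg t ht htz hint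
      have hζt := zetaOf_neg ha0 ha1 ht
      have hX := phaseInt_pos ha0 ha1 ht
      have hP := P0_pos hu hζt
      simp only [he]
      rw [div_le_iff₀ (by positivity), (volterra_equation hu ha0 ha1 hA hlim hζt).2,
        ← image_zetaOf_Ioo ha0 ha1 ht, integral_image_eq_integral_abs_deriv_smul
        measurableSet_Ioo (fun s hs => (hasDerivAt_zetaOf ha0 ha1 hs.1).hasDerivWithinAt)
        ((injOn_zetaOf ha0 ha1).mono fun s hs => hs.1), mul_comm, ← integral_const_mul,
        ← Real.norm_eq_abs]
      refine norm_integral_le_of_norm_le (hint.const_mul _) ?_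
      filter_upwards [ae_restrict_mem measurableSet_Ioo] with s hs
      refine (abs_volterra_integrand_le hu ha0 ha1 A hs.1 hs.2).trans ?_
      have hsz := hs.2.le.trans htz
      have h1 := hg s hs.1 hsz
      have h2 := hmem s hs.1 hsz
      have h3 := varDensity_nonneg a s
      have h4 := hk₀' _ h2
      have h5 := hk' _ h2
      have h6 : 0 ≤ e s := div_nonneg (abs_nonneg _)
        (mul_pos (P0_pos hu h2.2) (phaseInt_pos ha0 ha1 hs.1)).le
      gcongr
  rw [he] at hkey
  have hX := phaseInt_pos ha0 ha1 hz
  have hP := P0_pos hu hζ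
  rw [div_le_iff₀ (by positivity)] at hkey
  rw [variation_zetaOf' ha0 ha1 hz, sqrt_abs_zetaOf ha0 ha1 hz]
  calc _ ≤ _ := hkey
    _ = _ := by ring

/-! ### Existence of a recessive solution -/

/-- The Picard iterates of the integral form of the radial equation at the regular singular point
`z = 1`, without the alternating signs. -/
noncomputable def picardIter (u a : ℝ) : ℕ → ℝ → ℝ
  | 0 => fun _ => 1
  | n + 1 => fun z =>
      ∫ s in (1 : ℝ)..z, (∫ t in (1 : ℝ)..s, u ^ 2 * (t - a) * picardIter u a n t) / (s ^ 2 - 1)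

/-- The inner integral of `picardIter`. -/
noncomputable def picardFlux (u a : ℝ) (n : ℕ) (s : ℝ) : ℝ :=
  ∫ t in (1 : ℝ)..s, u ^ 2 * (t - a) * picardIter u a n t

/-- `f` is continuous on `z > 1` and lies between `0` and `(u² (z - 1))ⁿ / (n!)²`, the `n`-th term of
a Bessel series. -/
def IsIterateBounded (u : ℝ) (n : ℕ) (f : ℝ → ℝ) : Prop :=
  ContinuousOn f (Ioi 1) ∧ ∀ t, 1 < t → 0 ≤ f t ∧ f t ≤ (u ^ 2 * (t - 1)) ^ n / (n.factorial : ℝ) ^ 2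

lemma integral_pow_sub_one (c z : ℝ) (n : ℕ) :
    ∫ t in (1 : ℝ)..z, c * (t - 1) ^ n = c * ((z - 1) ^ (n + 1) / (n + 1)) := by
  rw [intervalIntegral.integral_const_mul,
    intervalIntegral.integral_comp_sub_right (fun t => t ^ n) 1, integral_pow]
  simp

lemma intervalIntegrable_of_le_pow {f : ℝ → ℝ} (hf : ContinuousOn f (Ioi 1)) {z c : ℝ} {n : ℕ}
    (hz : 1 < z) (hb : ∀ t, 1 < t → t ≤ z → 0 ≤ f t ∧ f t ≤ c * (t - 1) ^ n) :
    IntervalIntegrable f volume 1 z := by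
  have h : IntervalIntegrable (fun t : ℝ => c * (t - 1) ^ n) volume 1 z :=
    Continuous.intervalIntegrable (by fun_prop) _ _
  rw [intervalIntegrable_iff_integrableOn_Ioc_of_le hz.le] at h ⊢
  refine Integrable.mono' h ((hf.mono fun t ht => ht.1).aestronglyMeasurable measurableSet_Ioc) ?_
  filter_upwards [ae_restrict_mem measurableSet_Ioc] with t ht
  rw [Real.norm_of_nonneg (hb t ht.1 ht.2).1]
  exact (hb t ht.1 ht.2).2

lemma integral_bounds_of_le_pow {f : ℝ → ℝ} (hf : ContinuousOn f (Ioi 1)) {z c : ℝ} {n : ℕ}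
    (hz : 1 < z) (hb : ∀ t, 1 < t → t ≤ z → 0 ≤ f t ∧ f t ≤ c * (t - 1) ^ n) :
    0 ≤ ∫ t in (1 : ℝ)..z, f t ∧ ∫ t in (1 : ℝ)..z, f t ≤ c * ((z - 1) ^ (n + 1) / (n + 1)) := by
  have hi := intervalIntegrable_of_le_pow hf hz hb
  have h : IntervalIntegrable (fun t : ℝ => c * (t - 1) ^ n) volume 1 z :=
    Continuous.intervalIntegrable (by fun_prop) _ _
  have h0 : IntervalIntegrable (fun _ : ℝ => (0 : ℝ)) volume 1 z := by simp
  constructor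
  · have := intervalIntegral.integral_mono_on_of_le_Ioo hz.le h0 hi
      fun t ht => (hb t ht.1 ht.2.le).1
    simpa using this
  · rw [← integral_pow_sub_one]
    exact intervalIntegral.integral_mono_on_of_le_Ioo hz.le hi h
      fun t ht => (hb t ht.1 ht.2.le).2

lemma hasDerivAt_integral_of_le_pow {f : ℝ → ℝ} (hf : ContinuousOn f (Ioi 1)) {z c : ℝ} {n : ℕ}
    (hz : 1 < z) (hb : ∀ t, 1 < t → t ≤ z → 0 ≤ f t ∧ f t ≤ c * (t - 1) ^ n) :
    HasDerivAt (fun z => ∫ t in (1 : ℝ)..z, f t) (f z) z :=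
  intervalIntegral.integral_hasDerivAt_right (intervalIntegrable_of_le_pow hf hz hb)
    (hf.stronglyMeasurableAtFilter isOpen_Ioi z hz) (hf.continuousAt (Ioi_mem_nhds hz))

section

variable {u a : ℝ} {n : ℕ}

lemma picardFlux_integrand_bound (ha1 : a < 1)
    (h : IsIterateBounded u n (picardIter u a n)) {s t : ℝ} (ht : 1 < t) (hts : t ≤ s) :
    0 ≤ u ^ 2 * (t - a) * picardIter u a n t ∧ u ^ 2 * (t - a) * picardIter u a n t ≤
      (u ^ 2 * (s - a) * (u ^ 2) ^ n / (n.factorial : ℝ) ^ 2) * (t - 1) ^ n := by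
  obtain ⟨h0, h1⟩ := h.2 t ht
  have hta : 0 ≤ t - a := by linarith
  refine ⟨by positivity, ?_⟩
  calc u ^ 2 * (t - a) * picardIter u a n t
      ≤ u ^ 2 * (s - a) * ((u ^ 2 * (t - 1)) ^ n / (n.factorial : ℝ) ^ 2) := by
        have : 0 ≤ s - a := by linarith
        gcongr
    _ = _ := by rw [mul_pow]; ring

lemma hasDerivAt_picardFlux (ha1 : a < 1)
    (h : IsIterateBounded u n (picardIter u a n)) {s : ℝ} (hs : 1 < s) :
    HasDerivAt (picardFlux u a n) (u ^ 2 * (s - a) * picardIter u a n s) s := by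
  exact hasDerivAt_integral_of_le_pow (f := fun t => u ^ 2 * (t - a) * picardIter u a n t)
    (ContinuousOn.mul (by fun_prop) h.1) hs
    fun _ ht hts => picardFlux_integrand_bound ha1 h ht hts

lemma picardFlux_bounds (ha1 : a < 1)
    (h : IsIterateBounded u n (picardIter u a n)) {s : ℝ} (hs : 1 < s) :
    0 ≤ picardFlux u a n s ∧ picardFlux u a n s ≤
      (u ^ 2 * (s - a) * (u ^ 2) ^ n / (n.factorial : ℝ) ^ 2) * ((s - 1) ^ (n + 1) / (n + 1)) :=
  integral_bounds_of_le_pow (f := fun t => u ^ 2 * (t - a) * picardIter u a n t)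
    (ContinuousOn.mul (by fun_prop) h.1) hs
    fun _ ht hts => picardFlux_integrand_bound ha1 h ht hts

lemma picardIter_integrand_bound (ha0 : 0 ≤ a) (ha1 : a < 1)
    (h : IsIterateBounded u n (picardIter u a n)) {s : ℝ} (hs : 1 < s) :
    0 ≤ picardFlux u a n s / (s ^ 2 - 1) ∧ picardFlux u a n s / (s ^ 2 - 1) ≤
      ((u ^ 2) ^ (n + 1) / ((n.factorial : ℝ) ^ 2 * (n + 1))) * (s - 1) ^ n := by
  obtain ⟨h0, h1⟩ := picardFlux_bounds ha1 h hs
  have hD : 0 < s ^ 2 - 1 := by nlinarith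
  have hs1 : 0 < s - 1 := by linarith
  refine ⟨by positivity, ?_⟩
  rw [div_le_iff₀ hD]
  refine h1.trans ?_
  calc _ = ((u ^ 2) ^ (n + 1) / ((n.factorial : ℝ) ^ 2 * (n + 1))) * (s - 1) ^ n *
        ((s - 1) * (s - a)) := by field_simp; ring
    _ ≤ _ := by
      gcongr
      nlinarith

lemma continuousOn_picardIter_integrand (ha1 : a < 1)
    (h : IsIterateBounded u n (picardIter u a n)) :
    ContinuousOn (fun s => picardFlux u a n s / (s ^ 2 - 1)) (Ioi 1) := by
  refine ContinuousOn.div (fun s hs =>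
    (hasDerivAt_picardFlux ha1 h hs).continuousAt.continuousWithinAt) (by fun_prop) ?_
  intro s hs
  have : (1 : ℝ) < s := hs
  nlinarith

lemma hasDerivAt_picardIter (ha0 : 0 ≤ a) (ha1 : a < 1)
    (h : IsIterateBounded u n (picardIter u a n)) {z : ℝ} (hz : 1 < z) :
    HasDerivAt (picardIter u a (n + 1)) (picardFlux u a n z / (z ^ 2 - 1)) z := by
  exact hasDerivAt_integral_of_le_pow (continuousOn_picardIter_integrand ha1 h) hz
    fun _ ht _ => picardIter_integrand_bound ha0 ha1 h ht

lemma isIterateBounded_picardIter (ha0 : 0 ≤ a) (ha1 : a < 1) (n : ℕ) :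
    IsIterateBounded u n (picardIter u a n) := by
  induction n with
  | zero => exact ⟨continuousOn_const, fun t _ => by simp [picardIter]⟩
  | succ n ih =>
    refine ⟨fun z hz => (hasDerivAt_picardIter ha0 ha1 ih hz).continuousAt.continuousWithinAt,
      fun t ht => ?_⟩
    obtain ⟨h0, h1⟩ := integral_bounds_of_le_pow (continuousOn_picardIter_integrand ha1 ih) ht
      fun s hs _ => picardIter_integrand_bound ha0 ha1 ih hs
    refine ⟨h0, h1.trans_eq ?_⟩
    rw [Nat.factorial_succ, mul_pow]
    push_cast
    field_simp

end

lemma picardIter_le {u a : ℝ} (ha0 : 0 ≤ a) (ha1 : a < 1) (n : ℕ) {z R : ℝ} (hz : 1 < z)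
    (hzR : z ≤ R) : |picardIter u a n z| ≤ (u ^ 2 * (R - 1)) ^ n / (n.factorial : ℝ) := by
  obtain ⟨h0, h1⟩ := (isIterateBounded_picardIter ha0 ha1 n).2 z hz
  have hz1 : 0 < z - 1 := by linarith
  have hR1 : 0 < R - 1 := by linarith
  have h2 : (1 : ℝ) ≤ n.factorial := by exact_mod_cast n.factorial_pos
  rw [abs_of_nonneg h0]
  refine h1.trans ?_
  gcongr
  exact le_self_pow₀ h2 two_ne_zero

/-- The function `Σ (-1)ⁿ picardIter n`, with its first term split off. -/
noncomputable def picardSum (u a z : ℝ) : ℝ := 1 - ∑' n : ℕ, (-1) ^ n * picardIter u a (n + 1) z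

/-- `(z² - 1)` times the derivative of `picardSum`. -/
noncomputable def picardSumFlux (u a z : ℝ) : ℝ := -∑' n : ℕ, (-1) ^ n * picardFlux u a n z

lemma summable_picardIter {u a : ℝ} (ha0 : 0 ≤ a) (ha1 : a < 1) {z : ℝ} (hz : 1 < z) :
    Summable fun n : ℕ => (-1) ^ n * picardIter u a n z := by
  refine Summable.of_norm_bounded (Real.summable_pow_div_factorial (u ^ 2 * (z - 1))) fun n => ?_
  rw [norm_mul, norm_pow, norm_neg, norm_one, one_pow, one_mul, Real.norm_eq_abs]
  exact picardIter_le ha0 ha1 n hz le_rfl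

lemma summable_picardIter_succ {u a : ℝ} (ha0 : 0 ≤ a) (ha1 : a < 1) {z : ℝ} (hz : 1 < z) :
    Summable fun n : ℕ => (-1) ^ n * picardIter u a (n + 1) z := by
  have := ((summable_nat_add_iff 1).2 (summable_picardIter (u := u) ha0 ha1 hz)).neg
  refine this.congr fun n => ?_
  rw [pow_succ]; ring

lemma picardSum_eq {u a : ℝ} (ha0 : 0 ≤ a) (ha1 : a < 1) {z : ℝ} (hz : 1 < z) :
    picardSum u a z = ∑' n : ℕ, (-1) ^ n * picardIter u a n z := by
  rw [(summable_picardIter ha0 ha1 hz).tsum_eq_zero_add, picardSum, sub_eq_add_neg, ← tsum_neg]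
  congr 1
  · simp [picardIter]
  · refine tsum_congr fun n => ?_
    rw [pow_succ]; ring

lemma abs_picardFlux_le {u a : ℝ} (ha0 : 0 ≤ a) (ha1 : a < 1) (n : ℕ) {z R : ℝ} (hz : 1 < z)
    (hzR : z ≤ R) : |(-1) ^ n * picardFlux u a n z| ≤
      u ^ 2 * R * (R - 1) * ((u ^ 2 * (R - 1)) ^ n / (n.factorial : ℝ)) := by
  obtain ⟨h0, h1⟩ := picardFlux_bounds ha1 (isIterateBounded_picardIter (u := u) ha0 ha1 n) hz
  have hz1 : 0 < z - 1 := by linarith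
  have hR1 : 0 < R - 1 := by linarith
  have hza : 0 < z - a := by linarith
  have hR : 0 < R := by linarith
  have h2 : (1 : ℝ) ≤ n.factorial := by exact_mod_cast n.factorial_pos
  rw [abs_mul, abs_pow, abs_neg, abs_one, one_pow, one_mul, abs_of_nonneg h0]
  refine h1.trans ?_
  calc (u ^ 2 * (z - a) * (u ^ 2) ^ n / (n.factorial : ℝ) ^ 2) * ((z - 1) ^ (n + 1) / (n + 1))
      ≤ (u ^ 2 * R * (u ^ 2) ^ n / (n.factorial : ℝ)) * ((R - 1) ^ (n + 1) / 1) := by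
        gcongr
        · linarith
        · exact le_self_pow₀ h2 two_ne_zero
        · exact le_add_of_nonneg_left (Nat.cast_nonneg n)
    _ = _ := by rw [mul_pow, pow_succ]; ring

lemma isRadialPair_picardSum {u a : ℝ} (ha0 : 0 ≤ a) (ha1 : a < 1) :
    IsRadialPair u a (picardSum u a) (picardSumFlux u a) := by
  intro z hz
  have hD : 0 < z ^ 2 - 1 := by nlinarith
  have hmem : z ∈ Ioo 1 (z + 1) := ⟨hz, by linarith⟩
  have hsum := Real.summable_pow_div_factorial (u ^ 2 * (z + 1 - 1))
  constructor
  · -- near `z` the derivatives are bounded, by bounds that do not degenerate as `y → 1`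
    have h := hasDerivAt_tsum_of_isPreconnected (𝕜 := ℝ) (F := ℝ)
      (g := fun n y => (-1) ^ n * picardIter u a (n + 1) y)
      (g' := fun n y => (-1) ^ n * (picardFlux u a n y / (y ^ 2 - 1))) (y₀ := z)
      (hsum.mul_left (u ^ 2)) isOpen_Ioo isPreconnected_Ioo
      (fun n y hy => (hasDerivAt_picardIter ha0 ha1 (isIterateBounded_picardIter ha0 ha1 n) hy.1).const_mul _)
      (fun n y hy => ?_) hmem (summable_picardIter_succ ha0 ha1 hz) hmem
    · refine (h.const_sub 1).congr_deriv ?_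
      rw [picardSumFlux, neg_div, ← tsum_div_const]
      congr 1
      exact tsum_congr fun n => by ring
    · obtain ⟨h0, h1⟩ := picardIter_integrand_bound ha0 ha1 (isIterateBounded_picardIter (u := u) ha0 ha1 n) hy.1
      have hy1 : 0 < y - 1 := sub_pos.2 hy.1
      have h2 : (1 : ℝ) ≤ n.factorial := by exact_mod_cast n.factorial_pos
      rw [norm_mul, norm_pow, norm_neg, norm_one, one_pow, one_mul, Real.norm_of_nonneg h0]
      refine h1.trans ?_
      calc ((u ^ 2) ^ (n + 1) / ((n.factorial : ℝ) ^ 2 * (n + 1))) * (y - 1) ^ n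
          ≤ ((u ^ 2) ^ (n + 1) / ((n.factorial : ℝ) * 1)) * (z + 1 - 1) ^ n := by
            gcongr
            · exact le_self_pow₀ h2 two_ne_zero
            · exact le_add_of_nonneg_left (Nat.cast_nonneg n)
            · exact hy.2.le
        _ = _ := by rw [mul_pow, pow_succ]; ring
  · have h := hasDerivAt_tsum_of_isPreconnected (𝕜 := ℝ) (F := ℝ)
      (g := fun n y => (-1) ^ n * picardFlux u a n y)
      (g' := fun n y => (-1) ^ n * (u ^ 2 * (y - a) * picardIter u a n y)) (y₀ := z)
      (hsum.mul_left (u ^ 2 * (z + 1))) isOpen_Ioo isPreconnected_Ioo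
      (fun n y hy => (hasDerivAt_picardFlux ha1 (isIterateBounded_picardIter ha0 ha1 n) hy.1).const_mul _)
      (fun n y hy => ?_) hmem ?_ hmem
    · refine h.neg.congr_deriv ?_
      rw [picardSum_eq ha0 ha1 hz, ← tsum_mul_left]
      congr 1
      exact tsum_congr fun n => by ring
    · have hya : 0 < y - a := by linarith [hy.1]
      rw [norm_mul, norm_pow, norm_neg, norm_one, one_pow, one_mul, norm_mul, norm_mul,
        Real.norm_of_nonneg (sq_nonneg u), Real.norm_of_nonneg hya.le, Real.norm_eq_abs]
      have := picardIter_le (u := u) ha0 ha1 n hy.1 hy.2.le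
      have h3 : y - a ≤ z + 1 := by linarith [hy.2]
      gcongr
    · refine Summable.of_norm_bounded
        ((Real.summable_pow_div_factorial (u ^ 2 * (z - 1))).mul_left (u ^ 2 * z * (z - 1)))
        fun n => abs_picardFlux_le ha0 ha1 n hz le_rfl

lemma tendsto_picardSum {u a : ℝ} (ha0 : 0 ≤ a) (ha1 : a < 1) :
    Tendsto (picardSum u a) (𝓝[>] 1) (𝓝 1) := by
  have h1 : Tendsto (fun z : ℝ => u ^ 2 * (z - 1) * exp (u ^ 2 * (z - 1))) (𝓝[>] 1) (𝓝 0) := by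
    have : Continuous fun z : ℝ => u ^ 2 * (z - 1) * exp (u ^ 2 * (z - 1)) := by fun_prop
    simpa using (this.tendsto 1).mono_left nhdsWithin_le_nhds
  have h2 : Tendsto (fun z => ∑' n : ℕ, (-1) ^ n * picardIter u a (n + 1) z) (𝓝[>] 1) (𝓝 0) := by
    refine squeeze_zero_norm' ?_ h1
    filter_upwards [self_mem_nhdsWithin] with z hz
    have hz' : (1 : ℝ) < z := hz
    have hz1 : 0 ≤ u ^ 2 * (z - 1) := mul_nonneg (sq_nonneg u) (by linarith)
    have hs := NormedSpace.expSeries_div_hasSum_exp (u ^ 2 * (z - 1))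
    rw [← Real.exp_eq_exp_ℝ] at hs
    replace hs := hs.mul_left (u ^ 2 * (z - 1))
    refine tsum_of_norm_bounded hs fun n => ?_
    rw [norm_mul, norm_pow, norm_neg, norm_one, one_pow, one_mul, Real.norm_eq_abs]
    refine (picardIter_le ha0 ha1 (n + 1) hz' le_rfl).trans ?_
    rw [pow_succ', mul_div_assoc]
    gcongr
    exact n.le_succ
  have := h2.const_sub 1
  rwa [sub_zero] at this

theorem exists_isRecessive {u a : ℝ} (ha0 : 0 ≤ a) (ha1 : a < 1) :
    ∃ A : ℝ → ℝ, IsRecessive u a A := by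
  refine ⟨fun z => 1 / √2 * picardSum u a z, isRadialSolution_iff.2
    ⟨fun z => 1 / √2 * picardSumFlux u a z, fun z hz => ?_⟩, ?_⟩
  · obtain ⟨h1, h2⟩ := isRadialPair_picardSum (u := u) ha0 ha1 z hz
    exact ⟨(h1.const_mul _).congr_deriv (by ring), (h2.const_mul _).congr_deriv (by ring)⟩
  · simpa using (tendsto_picardSum (u := u) ha0 ha1).const_mul (1 / √2)

/-! ### Amplitude and phase at infinity -/

/-- `W / (2|ζ|^(1/2) / (π u))^(1/2)` as a function of `z`. -/
noncomputable def normalizedW (u a : ℝ) (A : ℝ → ℝ) (z : ℝ) : ℝ :=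
  √(π * (u * phaseInt a z)) * (A z / amp a z)

lemma div_sqrt_zetaOf {u a : ℝ} (hu : 0 < u) (ha0 : 0 ≤ a) (ha1 : a < 1) (y : ℝ) {z : ℝ}
    (hz : 1 < z) : √2 * phaseInt a z * y / √(2 * √|zetaOf a z| / (π * u)) =
      √(π * (u * phaseInt a z)) * y := by
  have hX := phaseInt_pos ha0 ha1 hz
  have h : √(2 * phaseInt a z / (π * u)) * √(π * (u * phaseInt a z)) = √2 * phaseInt a z := by
    rw [← Real.sqrt_mul (by positivity), show 2 * phaseInt a z / (π * u) * (π * (u * phaseInt a z)) =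
      2 * phaseInt a z ^ 2 by field_simp, Real.sqrt_mul zero_le_two, Real.sqrt_sq hX.le]
  rw [sqrt_abs_zetaOf ha0 ha1 hz, ← h]
  have : 0 < √(2 * phaseInt a z / (π * u)) := by positivity
  field_simp

lemma hasPhase_iff {u a : ℝ} (hu : 0 < u) (ha0 : 0 ≤ a) (ha1 : a < 1) (A : ℝ → ℝ) (ρ δ : ℝ) :
    HasPhase u a A ρ δ ↔ Tendsto (fun z => normalizedW u a A z -
      (1 + ρ) * sin (u * phaseInt a z + π / 4 + δ)) atTop (𝓝 0) := by
  rw [HasPhase, tendsto_atBot_iff_zetaOf ha0 ha1]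
  refine tendsto_congr' ?_
  filter_upwards [eventually_gt_atTop 1] with z hz
  rw [bigW_zetaOf ha0 ha1 A hz, div_sqrt_zetaOf hu ha0 ha1 _ hz, sqrt_abs_zetaOf ha0 ha1 hz,
    normalizedW]

/-- Polar coordinates with a signed radius, which leaves a half-turn for the angle. -/
lemma exists_polar (s c : ℝ) (h : s ≠ 0 ∨ c ≠ 0) : ∃ r δ : ℝ, r ≠ 0 ∧ -(π / 2) < δ ∧ δ ≤ π / 2 ∧
    r * cos δ = s ∧ r * sin δ = c := by
  by_cases hs : s = 0
  · have hc : c ≠ 0 := h.resolve_left (not_not.2 hs)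
    exact ⟨c, π / 2, hc, by linarith [pi_pos], le_rfl, by simp [hs], by simp⟩
  · have h1 := cos_arctan_pos (c / s)
    refine ⟨s / cos (arctan (c / s)), arctan (c / s), div_ne_zero hs h1.ne',
      neg_pi_div_two_lt_arctan _, (arctan_lt_pi_div_two _).le, by field_simp, ?_⟩
    rw [div_mul_eq_mul_div, mul_div_assoc, ← tan_eq_sin_div_cos, tan_arctan]
    field_simp

lemma sqrt_two_mul_sin_add_pi_div_four (x : ℝ) : √2 * sin (x + π / 4) = cos x + sin x := by
  have h2 : √2 ^ 2 = 2 := Real.sq_sqrt zero_le_two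
  rw [sin_add, cos_pi_div_four, sin_pi_div_four]
  linear_combination (cos x + sin x) / 2 * h2

lemma sqrt_two_mul_cos_add_pi_div_four (x : ℝ) : √2 * cos (x + π / 4) = cos x - sin x := by
  have h2 : √2 ^ 2 = 2 := Real.sq_sqrt zero_le_two
  rw [cos_add, cos_pi_div_four, sin_pi_div_four]
  linear_combination (cos x - sin x) / 2 * h2

lemma tendsto_mul_phaseInt_atTop {u a : ℝ} (hu : 0 < u) (ha0 : 0 ≤ a) (ha1 : a < 1) :
    Tendsto (fun z => u * phaseInt a z) atTop atTop :=
  (tendsto_phaseInt_atTop ha0 ha1).const_mul_atTop hu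

lemma tendsto_besselJ0_phase {u a : ℝ} (hu : 0 < u) (ha0 : 0 ≤ a) (ha1 : a < 1) :
    Tendsto (fun z => √(π * (u * phaseInt a z)) * besselJ0 (u * phaseInt a z) -
      √2 * sin (u * phaseInt a z + π / 4)) atTop (𝓝 0) := by
  refine (tendsto_sqrt_mul_besselJ0.comp (tendsto_mul_phaseInt_atTop hu ha0 ha1)).congr fun z => ?_
  rw [Function.comp_apply, sqrt_two_mul_sin_add_pi_div_four]

lemma tendsto_besselY0_phase {u a : ℝ} (hu : 0 < u) (ha0 : 0 ≤ a) (ha1 : a < 1) :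
    Tendsto (fun z => √(π * (u * phaseInt a z)) * besselY0 (u * phaseInt a z) +
      √2 * cos (u * phaseInt a z + π / 4)) atTop (𝓝 0) := by
  refine (tendsto_sqrt_mul_besselY0.comp (tendsto_mul_phaseInt_atTop hu ha0 ha1)).congr fun z => ?_
  rw [Function.comp_apply, sqrt_two_mul_cos_add_pi_div_four]
  ring

/-- If `F - S → 0` with bounded `S`, and `c → l`, then `F c - S l → 0`. -/
lemma tendsto_mul_sub_of_bounded {F S c : ℝ → ℝ} {l M : ℝ} (hS : ∀ z, |S z| ≤ M)
    (hF : Tendsto (fun z => F z - S z) atTop (𝓝 0)) (hc : Tendsto c atTop (𝓝 l)) :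
    Tendsto (fun z => F z * c z - S z * l) atTop (𝓝 0) := by
  have h1 : Tendsto (fun z => (c z - l) * S z) atTop (𝓝 0) := by
    have h0 : Tendsto (fun z => c z - l) atTop (𝓝 0) := by simpa using hc.sub_const l
    exact h0.zero_mul_isBoundedUnder_le ⟨M, eventually_map.2 (Eventually.of_forall hS)⟩
  have h2 := (hF.mul hc).add h1
  rw [zero_mul, add_zero] at h2
  exact h2.congr fun z => by ring

/-- The Wronskians with `J₀` and `Y₀` converge at infinity, not both to zero. -/
lemma exists_tendsto_crossWronskian {u a : ℝ} (hu : 0 < u) (ha0 : 0 ≤ a) (ha1 : a < 1)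
    {A G : ℝ → ℝ} (hA : IsRadialPair u a A G) (hlim : Tendsto A (𝓝[>] 1) (𝓝 (1 / √2))) :
    ∃ p r : ℝ, (r ≠ 0 ∨ p ≠ 0) ∧
      Tendsto (crossWronskian u a A G besselJ0 thetaJ) atTop (𝓝 p) ∧
      Tendsto (crossWronskian u a A G besselY0 thetaY) atTop (𝓝 r) := by
  have hJ := tendsto_limUnder_of_hasDerivAt_of_integrableOn_Ioi
    (fun z hz => hasDerivAt_crossWronskian hu ha0 ha1 hA isBesselPair_J hz)
    (integrableOn_crossDensity hu ha0 ha1 hA hlim isBesselPair_J fun _ => besselJ0_sq_le)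
  have hY := tendsto_limUnder_of_hasDerivAt_of_integrableOn_Ioi
    (fun z hz => hasDerivAt_crossWronskian hu ha0 ha1 hA isBesselPair_Y hz)
    (integrableOn_crossDensity hu ha0 ha1 hA hlim isBesselPair_Y fun _ => besselY0_sq_le)
  refine ⟨_, _, ?_, hJ, hY⟩
  have hE : Tendsto (energy u a A G) atTop _ := (hJ.pow 2).add (hY.pow 2)
  have h := ge_of_tendsto hE (b := 2 / π ^ 2 * exp (-(4 / u * totalVariation a))) (by
    filter_upwards [eventually_gt_atTop 1] with z hz
    exact (energy_bounds hu ha0 ha1 hA hlim hz).2)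
  by_contra! h0
  rw [h0.1, h0.2] at h
  have : 0 < 2 / π ^ 2 * exp (-(4 / u * totalVariation a)) := by positivity
  linarith

theorem exists_hasPhase {u a : ℝ} (hu : 0 < u) (ha0 : 0 ≤ a) (ha1 : a < 1)
    {A G : ℝ → ℝ} (hA : IsRadialPair u a A G) (hlim : Tendsto A (𝓝[>] 1) (𝓝 (1 / √2))) :
    ∃ ρ δ : ℝ, 1 + ρ ≠ 0 ∧ -(π / 2) < δ ∧ δ ≤ π / 2 ∧ HasPhase u a A ρ δ := by
  obtain ⟨p, r, hne, hp, hr⟩ := exists_tendsto_crossWronskian hu ha0 ha1 hA hlim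
  have hk : -(π / √2) ≠ 0 := neg_ne_zero.2 (by positivity)
  obtain ⟨C, δ, hC, hδ1, hδ2, hs, hc⟩ := exists_polar (-(π / √2) * r) (-(π / √2) * p)
    (hne.imp (mul_ne_zero hk) (mul_ne_zero hk))
  refine ⟨C - 1, δ, by rwa [add_sub_cancel], hδ1, hδ2, ?_⟩
  rw [hasPhase_iff hu ha0 ha1, add_sub_cancel]
  have hM : ∀ y : ℝ, |y| ≤ 1 → |√2 * y| ≤ √2 := fun y hy => by
    rw [abs_mul, abs_of_nonneg (Real.sqrt_nonneg 2)]
    exact mul_le_of_le_one_right (Real.sqrt_nonneg 2) hy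
  have h1 := tendsto_mul_sub_of_bounded (fun z => hM _ (abs_sin_le_one (u * phaseInt a z + π / 4)))
    (tendsto_besselJ0_phase hu ha0 ha1) hr
  have hY0 : Tendsto (fun z => √(π * (u * phaseInt a z)) * besselY0 (u * phaseInt a z) -
      -(√2 * cos (u * phaseInt a z + π / 4))) atTop (𝓝 0) := by
    simpa only [sub_neg_eq_add] using tendsto_besselY0_phase hu ha0 ha1
  have h2 := tendsto_mul_sub_of_bounded (fun z => by
    rw [abs_neg]; exact hM _ (abs_cos_le_one (u * phaseInt a z + π / 4))) hY0 hp
  have h3 := (h1.sub h2).const_mul (-(π / 2))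
  rw [sub_zero, mul_zero] at h3
  refine h3.congr fun z => ?_
  have h := crossWronskian_identity u (a := a) A G z
  -- the Wronskian representation of `A`, with the phases `sin (x + π/4)` and `cos (x + π/4)`
  have e : A z / amp a z = -(π / 2) * -(2 / π * (A z / amp a z)) := by field_simp
  have hk2 : π / √2 = π / 2 * √2 := by
    have h2 : √2 ^ 2 = 2 := Real.sq_sqrt zero_le_two
    field_simp
    exact h2.symm
  rw [normalizedW, e, ← h, sin_add (u * phaseInt a z + π / 4) δ]
  rw [hk2] at hs hc
  linear_combination sin (u * phaseInt a z + π / 4) * hs + cos (u * phaseInt a z + π / 4) * hc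

/-! ### The phase in terms of `z` -/

/-- `√f - z^(-1/2) = O(z^(-3/2))` at infinity. -/
lemma exists_tendsto_phaseInt_sub {a : ℝ} (ha0 : 0 ≤ a) (ha1 : a < 1) :
    ∃ L : ℝ, Tendsto (fun z : ℝ => phaseInt a z - 2 * √z) atTop (𝓝 L) := by
  refine ⟨_, tendsto_limUnder_of_hasDerivAt_of_integrableOn_Ioi (a := 2)
    (f' := fun z => sqrtF a z - 2 * (1 / (2 * √z))) (fun z hz => ?_) ?_⟩
  · have hz2 : (2 : ℝ) < z := hz
    exact (hasDerivAt_phaseInt ha0 ha1 (by linarith)).sub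
      ((Real.hasDerivAt_sqrt (by linarith)).const_mul 2)
  · have hint : IntegrableOn (fun z : ℝ => 2 * z ^ (-(3 / 2) : ℝ)) (Ioi 2) :=
      (integrableOn_Ioi_rpow_of_lt (by norm_num) two_pos).const_mul 2
    refine Integrable.mono' hint (ContinuousOn.aestronglyMeasurable (ContinuousOn.sub
      ((continuousOn_sqrtF ha1).mono (Ioi_subset_Ioi one_le_two)) ?_) measurableSet_Ioi) ?_
    · intro z hz
      have hz0 : (0 : ℝ) < z := two_pos.trans hz
      exact ContinuousAt.continuousWithinAt (by fun_prop (disch := positivity))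
    · filter_upwards [ae_restrict_mem measurableSet_Ioi] with z hz
      have hz2 : (2 : ℝ) < z := hz
      have hz0 : 0 < z := by linarith
      have hD : 0 < z ^ 2 - 1 := by nlinarith
      have hs := sqrtF_pos ha1 (by linarith : 1 < z)
      have hs2 := sqrtF_sq ha1 (by linarith : 1 < z)
      have hq : 0 < √z := Real.sqrt_pos.2 hz0
      have hq2 : √z ^ 2 = z := Real.sq_sqrt hz0.le
      -- rationalize: `√f - 1/√z = (f - 1/z) / (√f + 1/√z)`
      have e : sqrtF a z - 2 * (1 / (2 * √z)) =
          ((1 - a * z) / (z * (z ^ 2 - 1))) / (sqrtF a z + 1 / √z) := by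
        have h1 : (sqrtF a z - 1 / √z) * (sqrtF a z + 1 / √z) =
            (1 - a * z) / (z * (z ^ 2 - 1)) := by
          have : (sqrtF a z - 1 / √z) * (sqrtF a z + 1 / √z) = sqrtF a z ^ 2 - 1 / √z ^ 2 := by
            ring
          rw [this, hs2, hq2]
          field_simp
          ring
        rw [← h1]
        field_simp
      have h3 : z ^ (-(3 / 2) : ℝ) = 1 / (z * √z) := by
        rw [Real.rpow_neg hz0.le, show (3 / 2 : ℝ) = 1 + 1 / 2 by norm_num, Real.rpow_add hz0,
          Real.rpow_one, Real.sqrt_eq_rpow]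
        exact (one_div _).symm
      rw [e, h3, Real.norm_eq_abs, abs_div, abs_div, abs_of_pos (by positivity : 0 < z * (z ^ 2 - 1)),
        abs_of_pos (by positivity : 0 < sqrtF a z + 1 / √z)]
      have h4 : |1 - a * z| ≤ z + 1 := abs_le.2 ⟨by nlinarith, by nlinarith⟩
      calc |1 - a * z| / (z * (z ^ 2 - 1)) / (sqrtF a z + 1 / √z)
          ≤ (z + 1) / (z * (z ^ 2 - 1)) / (0 + 1 / √z) := by gcongr
        _ = (1 / (z - 1)) * (√z / z) := by
          rw [show z ^ 2 - 1 = (z - 1) * (z + 1) by ring]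
          have : 0 < z - 1 := by linarith
          field_simp
          ring
        _ ≤ (2 / z) * (√z / z) := by
          gcongr ?_ * _
          rw [div_le_div_iff₀ (by linarith) hz0]
          linarith
        _ = 2 * (1 / (z * √z)) := by
          field_simp
          exact hq2

/-- `normalizedW` is `A` times `√(π u) (z² - 1)^(1/2) f^(1/4)`. -/
lemma normalizedW_eq {u a : ℝ} (hu : 0 < u) (ha0 : 0 ≤ a) (ha1 : a < 1) (A : ℝ → ℝ) {z : ℝ}
    (hz : 1 < z) :
    normalizedW u a A z =
      √(√((1 - a / z) * (1 - 1 / z ^ 2))) * (√(π * u) * (z ^ (3 / 4 : ℝ) * A z)) := by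
  have hX := phaseInt_pos ha0 ha1 hz
  have hm := amp_pos ha0 ha1 hz
  have hs := sqrtF_pos ha1 hz
  have hz0 : 0 < z := by linarith
  have hD : 0 < z ^ 2 - 1 := by nlinarith
  have h1 : (z ^ 2 - 1) * sqrtF a z = √((z - a) * (z ^ 2 - 1)) := by
    rw [← Real.sqrt_sq (by positivity : 0 ≤ (z ^ 2 - 1) * sqrtF a z)]
    congr 1
    linear_combination (z ^ 2 - 1) * sqrtF_sq_mul ha1 hz
  have h2 : √(phaseInt a z) / amp a z = √((z ^ 2 - 1) * sqrtF a z) := by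
    rw [← amp_sq_mul ha0 ha1 hz, mul_assoc, Real.sqrt_mul (sq_nonneg _), Real.sqrt_sq hm.le]
    field_simp
  have h3 : z ^ (3 / 4 : ℝ) = √√(z ^ 3) := by
    rw [Real.sqrt_eq_rpow, Real.sqrt_eq_rpow, ← Real.rpow_natCast, ← Real.rpow_mul hz0.le,
      ← Real.rpow_mul hz0.le]
    norm_num
  have h4 : √√((1 - a / z) * (1 - 1 / z ^ 2)) * z ^ (3 / 4 : ℝ) = √((z ^ 2 - 1) * sqrtF a z) := by
    rw [h3, h1, ← Real.sqrt_mul (Real.sqrt_nonneg _), ← Real.sqrt_mul' _ (by positivity)]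
    congr 2
    field_simp
  rw [normalizedW, ← mul_assoc π u, Real.sqrt_mul (by positivity)]
  linear_combination (√(π * u) * A z) * (h2 - h4)

lemma tendsto_sqrt_factor (a : ℝ) :
    Tendsto (fun z : ℝ => √(√((1 - a / z) * (1 - 1 / z ^ 2)))) atTop (𝓝 1) := by
  have h1 : Tendsto (fun z : ℝ => a / z) atTop (𝓝 0) := tendsto_id.const_div_atTop a
  have h2 : Tendsto (fun z : ℝ => 1 / z ^ 2) atTop (𝓝 0) :=
    (tendsto_pow_atTop two_ne_zero).const_div_atTop 1
  simpa using ((h1.const_sub 1).mul (h2.const_sub 1)).sqrt.sqrt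

lemma tendsto_sin_sub_sin {F G : ℝ → ℝ} (h : Tendsto (fun z => F z - G z) atTop (𝓝 0)) :
    Tendsto (fun z => sin (F z) - sin (G z)) atTop (𝓝 0) := by
  have h1 := h.abs
  rw [abs_zero] at h1
  exact squeeze_zero_norm (fun z => abs_sin_sub_sin_le _ _) h1

theorem hasPhase_iff_tendsto {u a : ℝ} (hu : 0 < u) (ha0 : 0 ≤ a) (ha1 : a < 1) (A : ℝ → ℝ) {L : ℝ}
    (hL : Tendsto (fun z : ℝ => phaseInt a z - 2 * √z) atTop (𝓝 L)) (ρ δ : ℝ) :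
    HasPhase u a A ρ δ ↔ Tendsto (fun z : ℝ => z ^ (3 / 4 : ℝ) * A z -
      (1 + ρ) / √(π * u) * sin (2 * u * √z + (u * L + π / 4 + δ))) atTop (𝓝 0) := by
  have hk : 0 < √(π * u) := by positivity
  set S : ℝ → ℝ := fun z => (1 + ρ) * sin (2 * u * √z + (u * L + π / 4 + δ)) with hS
  set T : ℝ → ℝ := fun z => √(π * u) * (z ^ (3 / 4 : ℝ) * A z) with hT
  set q : ℝ → ℝ := fun z => √(√((1 - a / z) * (1 - 1 / z ^ 2))) with hq
  have hq1 : Tendsto q atTop (𝓝 1) := tendsto_sqrt_factor a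
  have hSb : ∀ z, |S z| ≤ |1 + ρ| := fun z => by
    rw [hS, abs_mul]
    exact mul_le_of_le_one_right (abs_nonneg _) (abs_sin_le_one _)
  have hsin : Tendsto (fun z => (1 + ρ) * sin (u * phaseInt a z + π / 4 + δ) - S z) atTop (𝓝 0) := by
    have h0 : Tendsto (fun z => (u * phaseInt a z + π / 4 + δ) -
        (2 * u * √z + (u * L + π / 4 + δ))) atTop (𝓝 0) := by
      have := (hL.sub_const L).const_mul u
      rw [sub_self, mul_zero] at this
      exact this.congr fun z => by ring
    have := (tendsto_sin_sub_sin h0).const_mul (1 + ρ)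
    rw [mul_zero] at this
    exact this.congr fun z => by simp only [hS]; ring
  have hW : (fun z => normalizedW u a A z) =ᶠ[atTop] fun z => q z * T z := by
    filter_upwards [eventually_gt_atTop 1] with z hz
    exact normalizedW_eq hu ha0 ha1 A hz
  calc HasPhase u a A ρ δ ↔ Tendsto (fun z => q z * T z - S z) atTop (𝓝 0) := by
        rw [hasPhase_iff hu ha0 ha1]
        constructor
        · intro h
          have h1 := h.add hsin
          rw [add_zero] at h1
          refine h1.congr' ?_
          filter_upwards [hW] with z hz
          rw [hz]; ring
        · intro h
          have h1 := h.sub hsin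
          rw [sub_zero] at h1
          refine h1.congr' ?_
          filter_upwards [hW] with z hz
          rw [hz]; ring
    _ ↔ Tendsto (fun z => T z - S z) atTop (𝓝 0) := by
        constructor
        · intro h
          have h1 := tendsto_mul_sub_of_bounded hSb h (hq1.inv₀ one_ne_zero)
          refine h1.congr' ?_
          filter_upwards [hq1.eventually_ne one_ne_zero] with z hz
          rw [inv_one, mul_one]
          field_simp
        · intro h
          exact (tendsto_mul_sub_of_bounded hSb h hq1).congr fun z => by ring
    _ ↔ _ := by
        constructor
        · intro h
          have h1 := h.div_const √(π * u)
          rw [zero_div] at h1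
          refine h1.congr fun z => ?_
          simp only [hS, hT]
          field_simp
        · intro h
          have h1 := h.const_mul √(π * u)
          rw [mul_zero] at h1
          refine h1.congr fun z => ?_
          simp only [hS, hT]
          field_simp

/-! ### The bound for the phase error -/

lemma frequently_phaseInt_eq {u a : ℝ} (hu : 0 < u) (ha0 : 0 ≤ a) (ha1 : a < 1) (y : ℝ) :
    ∃ᶠ z in atTop, ∃ k : ℕ, u * phaseInt a z + π / 4 = y + k * (2 * π) := by
  rw [frequently_atTop]
  intro N
  have hN : 1 < max N 2 := lt_of_lt_of_le one_lt_two (le_max_right _ _)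
  have hX := phaseInt_pos ha0 ha1 hN
  have hseq : Tendsto (fun n : ℕ => y - π / 4 + n * (2 * π)) atTop atTop :=
    tendsto_atTop_add_const_left _ _
      (tendsto_natCast_atTop_atTop.atTop_mul_const (by positivity))
  obtain ⟨k, hk⟩ := (hseq.eventually (eventually_gt_atTop (u * phaseInt a (max N 2)))).exists
  have hk' : phaseInt a (max N 2) < (y - π / 4 + k * (2 * π)) / u := by
    rw [lt_div_iff₀ hu, mul_comm]; exact hk
  obtain ⟨z, hz, hzx⟩ := exists_phaseInt_eq ha0 ha1 (hX.trans hk')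
  have hlt : max N 2 < z := by
    rw [← hzx] at hk'
    exact (strictMonoOn_phaseInt ha0 ha1).lt_iff_lt hN hz |>.1 hk'
  refine ⟨z, (le_max_left _ _).trans hlt.le, k, ?_⟩
  rw [hzx]
  field_simp
  ring

lemma tendsto_modulus_phase {u a : ℝ} (hu : 0 < u) (ha0 : 0 ≤ a) (ha1 : a < 1) :
    Tendsto (fun z => √(π * (u * phaseInt a z)) * (modulusM0 (u * phaseInt a z) / √2)) atTop
      (𝓝 1) := by
  have h := (((tendsto_mul_modulusM0_sq.comp (tendsto_mul_phaseInt_atTop hu ha0 ha1)).div_const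
    2)).sqrt
  rw [div_self two_ne_zero, Real.sqrt_one] at h
  refine h.congr' ?_
  filter_upwards [eventually_gt_atTop 1] with z hz
  have hX := phaseInt_pos ha0 ha1 hz
  have hM := modulusM0_pos (mul_pos hu hX)
  rw [Function.comp_apply, Real.sqrt_div (by positivity), Real.sqrt_mul (by positivity),
    Real.sqrt_sq hM.le, mul_div_assoc]

lemma abs_normalizedW_sub_le {u a : ℝ} (hu : 0 < u) (ha0 : 0 ≤ a) (ha1 : a < 1) {A G : ℝ → ℝ}
    (hA : IsRadialPair u a A G) (hlim : Tendsto A (𝓝[>] 1) (𝓝 (1 / √2))) {z : ℝ} (hz : 1 < z)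
    (hzX : besselX0 < u * phaseInt a z) :
    |normalizedW u a A z - √(π * (u * phaseInt a z)) * besselJ0 (u * phaseInt a z) / √2| ≤
      √(π * (u * phaseInt a z)) * (modulusM0 (u * phaseInt a z) / √2) * phaseBound u a := by
  have hζ := zetaOf_neg ha0 ha1 hz
  have hX := phaseInt_pos ha0 ha1 hz
  have hl := lambda00_pos
  have h := abs_eps_le hu ha0 ha1 hA hlim hζ (div_pos lambda00_pos hu)
    (fun v hv => P0_mul_Q_le hu hv.2) (fun v hv => Q_mul_abs_le hu hv.2)
  rw [div_div_div_cancel_right₀ hu.ne', variation_zetaOf' ha0 ha1 hz, eps,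
    bigW_zetaOf ha0 ha1 A hz, sqrt_abs_zetaOf ha0 ha1 hz, P0, sqrt_abs_zetaOf ha0 ha1 hz,
    weightE0_of_gt hzX, div_one] at h
  have hB : lambda01 / lambda00 * (exp (lambda00 / u * varInt a z) - 1) ≤ phaseBound u a := by
    have h1 := varInt_le ha0 ha1 hz
    have h2 : 0 ≤ lambda01 / lambda00 := div_nonneg lambda01_nonneg hl.le
    rw [phaseBound]
    gcongr
  have hM := modulusM0_pos (mul_pos hu hX)
  have e : normalizedW u a A z - √(π * (u * phaseInt a z)) * besselJ0 (u * phaseInt a z) / √2 =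
      √(π * (u * phaseInt a z)) / (√2 * phaseInt a z) *
        (√2 * phaseInt a z * (A z / amp a z) - phaseInt a z * besselJ0 (u * phaseInt a z)) := by
    rw [normalizedW]
    field_simp
  rw [e, abs_mul, abs_of_pos (by positivity)]
  calc _ ≤ √(π * (u * phaseInt a z)) / (√2 * phaseInt a z) * (modulusM0 (u * phaseInt a z) *
        (phaseInt a z * (lambda01 / lambda00) * (exp (lambda00 / u * varInt a z) - 1))) := by
        gcongr
    _ = √(π * (u * phaseInt a z)) * (modulusM0 (u * phaseInt a z) / √2) *
        (lambda01 / lambda00 * (exp (lambda00 / u * varInt a z) - 1)) := by field_simp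
    _ ≤ _ := by gcongr

/-- Comparison of the two sinusoids at the points where `u ξ + π/4 ≡ y` modulo `2π`. -/
lemma abs_sin_sub_sin_le_phaseBound {u a : ℝ} (hu : 0 < u) (ha0 : 0 ≤ a) (ha1 : a < 1)
    {A G : ℝ → ℝ} (hA : IsRadialPair u a A G) (hlim : Tendsto A (𝓝[>] 1) (𝓝 (1 / √2))) {ρ δ : ℝ}
    (hP : HasPhase u a A ρ δ) (y : ℝ) :
    |(1 + ρ) * sin (y + δ) - sin y| ≤ phaseBound u a := by
  rw [hasPhase_iff hu ha0 ha1] at hP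
  have hJ := ((tendsto_besselJ0_phase hu ha0 ha1).div_const √2).abs
  have hM := (tendsto_modulus_phase hu ha0 ha1).mul_const (phaseBound u a)
  have hR := (hM.add hP.abs).add hJ
  rw [one_mul, abs_zero, zero_div, abs_zero, add_zero, add_zero] at hR
  refine ge_of_tendsto_of_frequently hR (((frequently_phaseInt_eq hu ha0 ha1 y).and_eventually
    (((tendsto_mul_phaseInt_atTop hu ha0 ha1).eventually (eventually_gt_atTop besselX0)).and
      (eventually_gt_atTop 1))).mono ?_)
  rintro z ⟨⟨k, hk⟩, hzX, hz⟩
  have h := abs_normalizedW_sub_le hu ha0 ha1 hA hlim hz hzX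
  have e1 : sin (u * phaseInt a z + π / 4 + δ) = sin (y + δ) := by
    rw [hk, add_right_comm, sin_add_nat_mul_two_pi]
  have e2 : sin (u * phaseInt a z + π / 4) = sin y := by rw [hk, sin_add_nat_mul_two_pi]
  rw [e1, e2]
  set n := normalizedW u a A z
  set J := √(π * (u * phaseInt a z)) * besselJ0 (u * phaseInt a z)
  have e3 : (1 + ρ) * sin (y + δ) - sin y = (n - J / √2) - (n - (1 + ρ) * sin (y + δ)) +
      (J - √2 * sin y) / √2 := by field_simp; ring
  rw [e3]
  exact (abs_add_le _ _).trans (add_le_add_left ((abs_sub _ _).trans (add_le_add_left h _)) _)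

theorem phase_error_bound {u a : ℝ} (hu : 0 < u) (ha0 : 0 ≤ a) (ha1 : a < 1)
    {A G : ℝ → ℝ} (hA : IsRadialPair u a A G) (hlim : Tendsto A (𝓝[>] 1) (𝓝 (1 / √2))) {ρ δ : ℝ}
    (hδ : |δ| ≤ π / 2) (hP : HasPhase u a A ρ δ) :
    2 * |δ| / π ≤ min 1 (phaseBound u a) ∧ (phaseBound u a < 1 → 0 < 1 + ρ) := by
  refine ⟨le_min ?_ ?_, fun hB => ?_⟩
  · rw [div_le_one pi_pos]; linarith
  · -- at `y = -δ` the sinusoid of the solution vanishes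
    have h := abs_sin_sub_sin_le_phaseBound hu ha0 ha1 hA hlim hP (-δ)
    rw [neg_add_cancel, sin_zero, mul_zero, zero_sub, sin_neg, neg_neg] at h
    refine le_trans ?_ ((Real.mul_abs_le_abs_sin hδ).trans h)
    exact le_of_eq (by ring)
  · -- at `y = π/2` the sinusoid of the Bessel function is `1`
    have h := abs_sin_sub_sin_le_phaseBound hu ha0 ha1 hA hlim hP (π / 2)
    rw [sin_pi_div_two, add_comm (π / 2), sin_add_pi_div_two] at h
    have h1 := (abs_le.1 h).1
    have h2 : 0 < (1 + ρ) * cos δ := by linarith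
    have h3 : 0 ≤ cos δ := cos_nonneg_of_neg_pi_div_two_le_of_le (abs_le.1 hδ).1 (abs_le.1 hδ).2
    exact pos_of_mul_pos_left h2 h3

end EguchiHanson

theorem mainTheorem2 (u a : ℝ) (hu : 0 < u) (ha0 : 0 ≤ a) (ha1 : a < 1) :
    BddAbove lambda00Set ∧ BddAbove lambda01Set ∧ 0 < lambda00 ∧
    IntegrableOn (fun v : ℝ => |psi a v| / √|v|) (Iio 0) ∧
    (∃ A : ℝ → ℝ, IsRecessive u a A) ∧
    ∀ A : ℝ → ℝ, IsRecessive u a A →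
      (∀ ζ : ℝ, ζ < 0 →
        -- the Volterra integral equation for the error
        (IntegrableOn (fun v : ℝ => kernel u ζ v * (psi a v / √|v|) *
            (eps u a A v + √|v| * besselJ0 (u * √|v|))) (Ioo ζ 0) ∧
          eps u a A ζ = ∫ v in Ioo ζ 0, kernel u ζ v * (psi a v / √|v|) *
            (eps u a A v + √|v| * besselJ0 (u * √|v|))) ∧
        -- the bounds for the error
        kappa0 u ζ ≤ lambda00 / u ∧ kappa u ζ ≤ lambda01 / u ∧
        |eps u a A ζ| ≤ P0 u ζ * (√|ζ| * (kappa u ζ / kappa0 u ζ) *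
          (exp (kappa0 u ζ * variation a ζ) - 1)) ∧
        |eps u a A ζ| ≤ P0 u ζ * (√|ζ| * (lambda01 / lambda00) *
          (exp (lambda00 / u * variation a ζ) - 1))) ∧
      -- existence and meaning of the phase error
      (∃ ρ δ : ℝ, 1 + ρ ≠ 0 ∧ -(π / 2) < δ ∧ δ ≤ π / 2 ∧ HasPhase u a A ρ δ) ∧
      (∃ L : ℝ, Tendsto (fun z : ℝ => phaseInt a z - 2 * √z) atTop (𝓝 L) ∧
        ∀ ρ δ : ℝ, HasPhase u a A ρ δ ↔
          Tendsto (fun z : ℝ => z ^ (3 / 4 : ℝ) * A z -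
            (1 + ρ) / √(π * u) * sin (2 * u * √z + (u * L + π / 4 + δ))) atTop (𝓝 0)) ∧
      -- the bound for the phase error
      (∀ ρ δ : ℝ, |δ| ≤ π / 2 → HasPhase u a A ρ δ →
        2 * |δ| / π ≤ min 1 (phaseBound u a) ∧ (phaseBound u a < 1 → 0 < 1 + ρ)) := by
  refine ⟨bddAbove_lambda00Set, bddAbove_lambda01Set, lambda00_pos, integrableOn_variation ha0 ha1,
    exists_isRecessive ha0 ha1, fun A hrec => ?_⟩
  obtain ⟨hsol, hlim⟩ := hrec
  obtain ⟨G, hA⟩ := isRadialSolution_iff.1 hsol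
  refine ⟨fun ζ hζ => ⟨volterra_equation hu ha0 ha1 hA hlim hζ, kappa0_le hu hζ, kappa_le hu hζ,
    ?_, ?_⟩, exists_hasPhase hu ha0 ha1 hA hlim, ?_,
    fun ρ δ hδ hP => phase_error_bound hu ha0 ha1 hA hlim hδ hP⟩
  · exact abs_eps_le hu ha0 ha1 hA hlim hζ (kappa0_pos hu hζ)
      (fun v hv => le_csSup (bddAbove_kappa0 hu ζ) ⟨v, hv, rfl⟩)
      (fun v hv => le_csSup (bddAbove_kappa hu ζ) ⟨v, hv, rfl⟩)
  · have h := abs_eps_le hu ha0 ha1 hA hlim hζ (div_pos lambda00_pos hu)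
      (fun v hv => P0_mul_Q_le hu hv.2) (fun v hv => Q_mul_abs_le hu hv.2)
    rwa [div_div_div_cancel_right₀ hu.ne'] at h
  · obtain ⟨L, hL⟩ := exists_tendsto_phaseInt_sub ha0 ha1
    exact ⟨L, hL, hasPhase_iff_tendsto hu ha0 ha1 A hL⟩
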